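/- Let $T>0$, let $H_1,H_2,H_3\in(1/2,1)$ satisfy $\bar\kappa:=H_1+H_2+H_3-2>0$, and put $f(z)=\prod_{i=1}^3|z_i|^{2H_i-2}$ for $z\in\mathbb R^3$. Let $W$ be a centred Gaussian family indexed by the smooth compactly supported functions $\varphi$ on $[0,T]\times\mathbb R^3$, with $$\mathbb E[W(\varphi)W(\psi)]=\int_0^T\!\!\int_{\mathbb R^3}\!\int_{\mathbb R^3}\varphi(s,y)f(y-z)\psi(s,z)\,dz\,dy\,ds ,$$ extended by isometry to $L^2([0,T];U)$, where $U$ is the completion of $C_c^\infty(\mathbb R^3)$ for the inner product $\langle\varphi,\psi\rangle_U=\iint\varphi(y)f(y-z)\psi(z)\,dy\,dz$. Let $G(t)=\frac{1}{4\pi t}\sigma_t$, $t>0$, where $\sigma_t$ is the surface measure of the sphere of radius $t$ about $0$ in $\mathbb R^3$, and let $$u(t,x)=\int_0^t\int_{\mathbb R^3}G(t-s,x-dy)\,W(ds,dy)\quad\text{a.s.},\qquad t\in[0,T],\ x\in\mathbb R^3,$$ be the mild solution of $\big(\frac{\partial^2}{\partial t^2}-\Delta\big)u=\dot W$ with $u(0,\cdot)=\frac{\partial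 u}{\partial t}(0,\cdot)=0$. Then the following hold. (a) There is a constant $c_2>0$ such that $\mathbb E|u(t,x)-u(t,y)|^2\le c_2|x-y|^{2\bar\kappa}$ for all $t\in[0,T]$ and $x,y\in\mathbb R^3$. For every $t_0\in(0,T]$ and $L>0$ there is a constant $c_1>0$ such that $c_1|x-y|^{2\bar\kappa}\le\mathbb E|u(t,x)-u(t,y)|^2$ for all $t\in[t_0,T]$ and all $x,y\in\mathbb R^3$ with $|x-y|\le L$. (b) There is a constant $c_2>0$ such that $\mathbb E|u(t,x)-u(\bar t,x)|^2\le c_2|\bar t-t|^{2\bar\kappa}$ for all $t,\bar t\in[0,T]$ and $x\in\mathbb R^3$. For every $t_0\in(0,T]$ there is a constant $c_1>0$ such that $c_1|\bar t-t|^{2\bar\kappa}\le\mathbb E|u(t,x)-u(\bar t,x)|^2$ for all $t,\bar t\in[t_0,T]$ and $x\in\mathbb R^3$. (c) Consequently $\bar\kappa$ is the optimal Hölder exponent, in the following sense. There is a modification $v$ of $u$ such that for all $\alpha\in(0,\bar\kappa)$ and $R>0$, almost surely there is a finite $K$ with $|v(s,x)-v(t,y)|\le K\,(|s-t|^{\alpha}+|x-y|^{\alpha})$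 for all $s,t\in[0,T]$ and all $x,y$ with $|x|,|y|\le R$. On the other hand, for every $\alpha>\bar\kappa$, $t\in(0,T]$ and $x\in\mathbb R^3$, almost surely there are no $K<\infty$ and $r>0$ with $|u(t,x)-u(t,y)|\le K|x-y|^{\alpha}$ for all $y$ with $|y-x|\le r$, and almost surely there are no $K<\infty$ and $r>0$ with $|u(t,x)-u(s,x)|\le K|t-s|^{\alpha}$ for all $s\in[0,T]$ with $|s-t|\le r$. -/

import Mathlib

open MeasureTheory ProbabilityTheory Filter Topology Set
open scoped ENNReal Distributions

noncomputable section

namespace StochWave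

/-- Three-dimensional Euclidean space. -/
abbrev Space : Type := EuclideanSpace ℝ (Fin 3)

/-- The spatial covariance `f(z) = |z₁|^(2H₁-2) |z₂|^(2H₂-2) |z₃|^(2H₃-2)` of fractional noise
with Hurst parameters `H₁, H₂, H₃` (without a normalising constant). -/
def fractionalKernel (H : Fin 3 → ℝ) (z : Space) : ℝ :=
  ∏ i, |z i| ^ (2 * H i - 2)

/-- Smooth compactly supported functions of time and space. The noise below only sees their
restrictions to `[0,T] × ℝ³`. -/
abbrev SpaceTimeTest : Type :=
  TestFunction (⊤ : TopologicalSpace.Opens (ℝ × Space)) ℝ ⊤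

/-- `∫₀ᵀ ∫ ∫ φ(s,y) f(y-z) ψ(s,z) dz dy ds`. -/
def testCov (f : Space → ℝ) (T : ℝ) (φ ψ : SpaceTimeTest) : ℝ :=
  ∫ s in (0 : ℝ)..T, ∫ y : Space, ∫ z : Space, φ (s, y) * f (y - z) * ψ (s, z)

/-- `W` is a centred Gaussian noise on `[0,T] × ℝ³`, white in time and with homogeneous spatial
covariance `f`. -/
structure IsNoise {Ω : Type*} [MeasurableSpace Ω] (f : Space → ℝ) (T : ℝ)
    (W : SpaceTimeTest → Ω → ℝ) (P : Measure Ω) : Prop where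
  gaussian : IsGaussianProcess W P
  centered : ∀ φ, ∫ ω, W φ ω ∂P = 0
  covariance : ∀ φ ψ, ∫ ω, W φ ω * W ψ ω ∂P = testCov f T φ ψ

/-- The uniform surface measure `σ_t` (total mass `4πt²`) on the sphere of radius `t > 0` about the
origin: the image of `t²` times the surface measure of the unit sphere. -/
def surfaceMeasure (t : ℝ) : Measure Space :=
  ENNReal.ofReal (t ^ 2) •
    ((volume : Measure Space).toSphere).map
      (fun θ : Metric.sphere (0 : Space) 1 => t • (θ : Space))

/-- The fundamental solution `G(t) = σ_t / (4πt)` of the wave equation on `ℝ³`, for `t > 0`. -/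
def waveKernel (t : ℝ) : Measure Space :=
  ENNReal.ofReal (1 / (4 * Real.pi * t)) • surfaceMeasure t

/-- The shifted kernel `G(t, x - dy)`, that is `A ↦ G(t)(x - A)`. -/
def shiftedKernel (t : ℝ) (x : Space) : Measure Space :=
  (waveKernel t).map (fun z => x - z)

/-- The squared distance `∫₀ᵀ ‖φ(s,·) - Γ_s‖²_U ds` in `L²([0,T]; U)` between a test function `φ`
and a path `s ↦ Γ_s` of measures on `ℝ³`, where `U` is the Hilbert space with inner product
`⟨m, n⟩_U = ∫ ∫ f(y-z) m(dy) n(dz)`; the square is expanded into its three terms. -/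
def sqDist (f : Space → ℝ) (T : ℝ) (φ : SpaceTimeTest) (Γ : ℝ → Measure Space) : ℝ :=
  ∫ s in (0 : ℝ)..T,
    ((∫ y : Space, ∫ z : Space, φ (s, y) * f (y - z) * φ (s, z))
      - 2 * (∫ y : Space, ∫ z, φ (s, y) * f (y - z) ∂(Γ s))
      + ∫ y, ∫ z, f (y - z) ∂(Γ s) ∂(Γ s))

/-- `X` is (a version of) the stochastic integral `∫₀ᵀ ∫ Γ_s(dy) W(ds,dy)` of the deterministic
measure-valued integrand `Γ`: the isometric extension of `φ ↦ W φ` from test functions to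
`L²([0,T]; U)`, evaluated at `Γ`. -/
def IsStochIntegral {Ω : Type*} [MeasurableSpace Ω] (f : Space → ℝ) (T : ℝ)
    (W : SpaceTimeTest → Ω → ℝ) (P : Measure Ω) (Γ : ℝ → Measure Space) (X : Ω → ℝ) : Prop :=
  MemLp X 2 P ∧
    ∃ φ : ℕ → SpaceTimeTest,
      Tendsto (fun n => sqDist f T (φ n) Γ) atTop (𝓝 0) ∧
      Tendsto (fun n => eLpNorm (fun ω => W (φ n) ω - X ω) 2 P) atTop (𝓝 0)

open Classical in
/-- `u` is a mild solution on `[0,T]` of `(∂²/∂t² - Δ) u = Ẇ` with zero initial position and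
velocity: `u(t,x) = ∫₀ᵗ ∫ G(t-s, x-dy) W(ds,dy)` almost surely, for all `t ∈ [0,T]` and `x`. -/
def IsMildSolution {Ω : Type*} [MeasurableSpace Ω] (f : Space → ℝ) (T : ℝ)
    (W : SpaceTimeTest → Ω → ℝ) (P : Measure Ω) (u : ℝ → Space → Ω → ℝ) : Prop :=
  ∀ t ∈ Icc (0 : ℝ) T, ∀ x : Space,
    IsStochIntegral f T W P (fun s => if s < t then shiftedKernel (t - s) x else 0) (u t x)

end StochWave

end

/-! ### Powers of |x| as Gaussian scale mixtures -/

namespace StochWave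

/-! After a Fourier transform in space every quantity becomes an explicit integral. The kernel f has
a spectral measure μ with density proportional to ∏|ξᵢ|^(1-2Hᵢ): a measure m of finite energy
satisfies ∬ f(y-z) m(dy) m(dz) = ∫ |m̂|² dμ. To see this without distributions, write |x|^(2h-2) as
a mixture over v of exp(-v x²/2), the characteristic function of N(0,v). The same mixture of
Gaussian densities is a multiple of |ξ|^(1-2h), so Tonelli gives the identity in [0,∞]
(`energy_mix`, `FiniteEnergy.integrable_self`). Polarisation extends it to mixed terms, and then to
signed densities. The transform of G(r) is sin(r|ξ|)/|ξ| (`charFun_shiftedKernel`). Hence increments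
of u are centred Gaussian, and their variance is the squared L²(ds ⊗ μ) norm of an explicit function
(`IsStochIntegral.sub`).

For a space or time increment of size δ the squared spectral integrand is at most min(δ², 4/|ξ|²).
The density of μ is homogeneous of degree -(2κ+1), so rescaling ξ by δ gives exactly δ^(2κ) times a
constant, finite because κ > 0 (`integral_specMeasure_scale`, `integrable_cutoff_one`). For the
lower bounds, keep only frequencies |ξ| ≥ 4/t₀, where integrating the oscillating squared factor
over time gives at least t₀/4. What remains rescales in the same way, and its integral is positive,
uniformly over directions by compactness (`integral_ge_lowerIntegral`,
`exists_lowerIntegral_inner_ge`).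

Gaussianity turns the variance bound into bounds on all moments, and chaining over dyadic grids
produces the Hölder modification. Conversely, a Gaussian variable of standard deviation at least
cδ^κ is below Kδ^α with probability O(δ^(α-κ)). By Borel-Cantelli along a geometric sequence of δ,
no exponent α > κ is possible (`ae_not_eventually_abs_le`). -/

theorem lintegral_pi_fin_prod {n : ℕ} (μ : Fin n → Measure ℝ) [∀ i, SigmaFinite (μ i)]
    (g : Fin n → ℝ → ℝ≥0∞) (hg : ∀ i, Measurable (g i)) :
    ∫⁻ x, ∏ i, g i (x i) ∂Measure.pi μ = ∏ i, ∫⁻ x, g i x ∂μ i := by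
  induction n with
  | zero => simp
  | succ n ih =>
    have hm : Measurable fun x : Fin (n + 1) → ℝ => ∏ i, g i (x i) :=
      Finset.measurable_prod _ fun i _ => (hg i).comp (measurable_pi_apply i)
    rw [← ((measurePreserving_piFinSuccAbove μ 0).symm).lintegral_comp hm]
    simp only [Fin.prod_univ_succ]
    simp only [MeasurableEquiv.piFinSuccAbove_symm_apply, Fin.insertNthEquiv_zero,
      Fin.consEquiv_apply, Fin.cons_zero, Fin.cons_succ]
    have hm2 : Measurable fun x : Fin n → ℝ => ∏ i, g (Fin.succ i) (x i) :=
      Finset.measurable_prod _ fun i _ => (hg i.succ).comp (measurable_pi_apply i)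
    refine (lintegral_prod_mul (μ := μ 0) (ν := Measure.pi fun j : Fin n => μ (Fin.succAbove 0 j))
      (hg 0).aemeasurable hm2.aemeasurable).trans ?_
    congr 1
    exact ih (fun i => μ i.succ) (fun i => g i.succ) (fun i => hg _)

theorem measurable_coord (i : Fin 3) : Measurable fun x : Space => x i := by fun_prop

theorem lintegral_space_prod (g : Fin 3 → ℝ → ℝ≥0∞) (hg : ∀ i, Measurable (g i)) :
    ∫⁻ x : Space, ∏ i, g i (x i) = ∏ i, ∫⁻ x, g i x := by
  have hm : Measurable fun x : Space => ∏ i, g i (x i) :=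
    Finset.measurable_prod _ fun i _ => (hg i).comp (measurable_coord i)
  rw [← lintegral_pi_fin_prod (fun _ => volume) g hg, ← volume_pi,
    ← (PiLp.volume_preserving_toLp (Fin 3)).lintegral_comp hm]

/-- The Gaussian scale mixture `∫₀^∞ v^(-h) exp(-v x² / 2) dv`. -/
noncomputable def physMix (h x : ℝ) : ℝ≥0∞ :=
  ∫⁻ v in Ioi (0 : ℝ), ENNReal.ofReal (v ^ (-h)) * ENNReal.ofReal (Real.exp (-(v * x ^ 2 / 2)))

/-- The mixture `∫₀^∞ v^(-h) p_v(ξ) dv` of the centred Gaussian densities `p_v` of variance `v`. -/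
noncomputable def specMix (h ξ : ℝ) : ℝ≥0∞ :=
  ∫⁻ v in Ioi (0 : ℝ), ENNReal.ofReal (v ^ (-h)) * gaussianPDF 0 v.toNNReal ξ

/-- Proportionality constants from the Gamma integral: off 0, `physMix h` is `physConst h` times
|x|^(2h-2) when h < 1, and `specMix h` is `specConst h` times |ξ|^(1-2h) when h > 1/2. -/
noncomputable def physConst (h : ℝ) : ℝ := 2 ^ (1 - h) * Real.Gamma (1 - h)

noncomputable def specConst (h : ℝ) : ℝ :=
  (√(2 * Real.pi))⁻¹ * (2 ^ (h - 1 / 2) * Real.Gamma (h - 1 / 2))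

theorem physConst_pos {h : ℝ} (hh : h < 1) : 0 < physConst h :=
  mul_pos (by positivity) (Real.Gamma_pos_of_pos (by linarith))

theorem specConst_pos {h : ℝ} (hh : 1 / 2 < h) : 0 < specConst h :=
  mul_pos (by positivity) (mul_pos (by positivity) (Real.Gamma_pos_of_pos (by linarith)))

theorem lintegral_rpow_mul_exp {a r : ℝ} (ha : 0 < a) (hr : 0 < r) :
    ∫⁻ t in Ioi (0 : ℝ), ENNReal.ofReal (t ^ (a - 1) * Real.exp (-(r * t)))
      = ENNReal.ofReal ((1 / r) ^ a * Real.Gamma a) := by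
  have hI := Real.integral_rpow_mul_exp_neg_mul_Ioi ha hr
  rw [← hI, ofReal_integral_eq_lintegral_ofReal]
  · refine Integrable.of_integral_ne_zero ?_
    rw [hI]
    exact (mul_pos (by positivity) (Real.Gamma_pos_of_pos ha)).ne'
  · filter_upwards [ae_restrict_mem measurableSet_Ioi] with t ht
    have : (0 : ℝ) < t := ht
    positivity

theorem two_div_sq_rpow {x : ℝ} (hx : x ≠ 0) (a : ℝ) :
    (1 / (x ^ 2 / 2)) ^ a = 2 ^ a * |x| ^ (-2 * a) := by
  have h1 : (1 : ℝ) / (x ^ 2 / 2) = 2 * (|x| ^ (-2 : ℝ)) := by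
    rw [Real.rpow_neg (abs_nonneg x), ← sq_abs]
    norm_num
    field_simp
  rw [h1, Real.mul_rpow (by norm_num) (by positivity), ← Real.rpow_mul (abs_nonneg x)]

/-- A Gamma integral of shape 1-h and rate x²/2; h < 1 makes the shape positive. -/
theorem physMix_eq {h x : ℝ} (hh : h < 1) (hx : x ≠ 0) :
    physMix h x = ENNReal.ofReal (physConst h * |x| ^ (2 * h - 2)) := by
  have hx2 : 0 < x ^ 2 / 2 := by positivity
  have := lintegral_rpow_mul_exp (a := 1 - h) (by linarith) hx2
  rw [two_div_sq_rpow hx] at this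
  rw [physMix, physConst, show (2 : ℝ) ^ (1 - h) * Real.Gamma (1 - h) * |x| ^ (2 * h - 2)
    = 2 ^ (1 - h) * |x| ^ (-2 * (1 - h)) * Real.Gamma (1 - h) by ring_nf, ← this]
  refine setLIntegral_congr_fun measurableSet_Ioi fun v hv => ?_
  have : (0 : ℝ) < v := hv
  rw [← ENNReal.ofReal_mul (by positivity)]
  ring_nf

/-- Substituting v ↦ 1/v moves the variance from the denominator of the exponent to its numerator.
The Jacobian v⁻², the weight v^h and the normalisation v^(1/2) then combine into a Gamma integral of
shape h-1/2, which needs h > 1/2. -/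
theorem specMix_eq {h x : ℝ} (hh : 1 / 2 < h) (hx : x ≠ 0) :
    specMix h x = ENNReal.ofReal (specConst h * |x| ^ (1 - 2 * h)) := by
  have hx2 : 0 < x ^ 2 / 2 := by positivity
  have := lintegral_rpow_mul_exp (a := h - 1 / 2) (by linarith) hx2
  rw [two_div_sq_rpow hx] at this
  have himg : (fun v : ℝ => v⁻¹) '' Ioi 0 = Ioi 0 := by
    ext y; constructor
    · rintro ⟨v, hv, rfl⟩; exact inv_pos.2 (mem_Ioi.1 hv)
    · intro hy; exact ⟨y⁻¹, mem_Ioi.2 (inv_pos.2 (mem_Ioi.1 hy)), inv_inv y⟩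
  rw [specMix, ← himg, lintegral_image_eq_lintegral_abs_deriv_mul (f' := fun v => -(v ^ 2)⁻¹)
    measurableSet_Ioi
    (fun v hv => (hasDerivAt_inv (ne_of_gt hv)).hasDerivWithinAt) (inv_injective.injOn)]
  rw [specConst, show (√(2 * Real.pi))⁻¹ * (2 ^ (h - 1 / 2) * Real.Gamma (h - 1 / 2))
     * |x| ^ (1 - 2 * h) = (√(2 * Real.pi))⁻¹ *
     (2 ^ (h - 1 / 2) * |x| ^ (-2 * (h - 1 / 2)) * Real.Gamma (h - 1 / 2)) by ring_nf,
     ENNReal.ofReal_mul (by positivity), ← this, ← lintegral_const_mul' _ _ ENNReal.ofReal_ne_top]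
  refine setLIntegral_congr_fun measurableSet_Ioi fun v hv => ?_
  have hv : (0 : ℝ) < v := hv
  simp only [gaussianPDF, gaussianPDFReal]
  rw [← ENNReal.ofReal_mul (by positivity), ← ENNReal.ofReal_mul (by positivity),
    ← ENNReal.ofReal_mul (by positivity)]
  congr 1
  rw [abs_neg, abs_of_pos (by positivity), Real.coe_toNNReal _ (by positivity),
    Real.sqrt_mul (by positivity), mul_inv, Real.sqrt_inv, inv_inv, Real.sqrt_eq_rpow v,
    Real.inv_rpow hv.le, Real.rpow_neg hv.le, inv_inv]
  have e1 : v ^ (h - 1 / 2 - 1) = (v ^ 2)⁻¹ * (v ^ h * v ^ (1 / 2 : ℝ)) := by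
    rw [← Real.rpow_natCast, ← Real.rpow_neg hv.le, ← Real.rpow_add hv, ← Real.rpow_add hv]
    norm_num; ring_nf
  rw [e1]
  have e2 : -(x - 0) ^ 2 / (2 * v⁻¹) = -(x ^ 2 / 2 * v) := by field_simp; ring
  rw [e2]; ring

end StochWave

/-! ### Parseval's identity for Gaussian mixtures -/

namespace StochWave

open scoped RealInnerProductSpace ComplexConjugate

/-- |m̂|² is the product of m̂(ξ) and m̂(-ξ), that is, the transform of the law of a difference of
two independent copies. -/
theorem normSq_charFun_eq_integral (m : Measure Space) [IsFiniteMeasure m] (ξ : Space) :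
    ((‖charFun m ξ‖ ^ 2 : ℝ) : ℂ)
      = ∫ p, Complex.exp (⟪p.1 - p.2, ξ⟫ * Complex.I) ∂(m.prod m) := by
  have h1 : ((‖charFun m ξ‖ ^ 2 : ℝ) : ℂ) = charFun m ξ * charFun m (-ξ) := by
    rw [charFun_neg, RCLike.mul_conj]; norm_cast
  rw [h1, charFun_apply, charFun_apply, ← integral_prod_mul]
  refine integral_congr_ae (Eventually.of_forall fun p => ?_)
  simp only [← Complex.exp_add, inner_sub_left, inner_neg_right]
  congr 1; push_cast; ring

/-- Fubini applied to the characters. Since γ and m are finite all integrands are bounded, so the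
exchange is made for Bochner integrals and only then read in [0,∞]. -/
theorem lintegral_prod_posDef (m γ : Measure Space) [IsFiniteMeasure m] [IsFiniteMeasure γ]
    (G : Space → ℝ) (hG : Continuous G) (hG0 : ∀ x, 0 ≤ G x)
    (hγ : ∀ x, charFun γ x = G x) :
    ∫⁻ p, ENNReal.ofReal (G (p.1 - p.2)) ∂(m.prod m) = ∫⁻ ξ, ‖charFun m ξ‖ₑ ^ 2 ∂γ := by
  have hb : ∀ x, ‖G x‖ ≤ γ.real univ := fun x => by
    have := norm_charFun_le (μ := γ) x
    rwa [hγ, Complex.norm_real] at this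
  have hint : Integrable (fun p : Space × Space => G (p.1 - p.2)) (m.prod m) :=
    Integrable.of_bound (by fun_prop) (γ.real univ) (Eventually.of_forall fun p => hb _)
  have hcm : Continuous (charFun m) := continuous_charFun
  have hint2 : Integrable (fun ξ => ‖charFun m ξ‖ ^ 2) γ := by
    refine Integrable.of_bound (by fun_prop) ((m.real univ) ^ 2) (Eventually.of_forall fun ξ => ?_)
    rw [Real.norm_of_nonneg (by positivity)]
    exact pow_le_pow_left₀ (norm_nonneg _) (norm_charFun_le ξ) 2
  have key : ∫ p, G (p.1 - p.2) ∂(m.prod m) = ∫ ξ, ‖charFun m ξ‖ ^ 2 ∂γ := by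
    rw [← Complex.ofReal_inj, ← integral_complex_ofReal, ← integral_complex_ofReal]
    simp_rw [normSq_charFun_eq_integral m, ← hγ, charFun_apply]
    rw [integral_integral_swap]
    · refine integral_congr_ae (Eventually.of_forall fun ξ => ?_)
      refine integral_congr_ae (Eventually.of_forall fun p => ?_)
      simp only
      rw [real_inner_comm]
    · refine Integrable.of_bound (by fun_prop) 1 (Eventually.of_forall fun p => ?_)
      simp only [Function.uncurry]
      rw [Complex.norm_exp_ofReal_mul_I]
  rw [← ofReal_integral_eq_lintegral_ofReal hint (Eventually.of_forall fun p => hG0 _), key,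
    ofReal_integral_eq_lintegral_ofReal hint2 (Eventually.of_forall fun p => by positivity)]
  refine lintegral_congr fun ξ => ?_
  rw [ENNReal.ofReal_pow (norm_nonneg _), ofReal_norm]

/-- Density of the centred Gaussian vector with independent coordinates of variances `v i`. -/
noncomputable def gaussWeight (v : Fin 3 → ℝ) (ξ : Space) : ℝ≥0∞ :=
  ∏ i, gaussianPDF 0 (v i).toNNReal (ξ i)

theorem measurable_gaussWeight (v : Fin 3 → ℝ) : Measurable (gaussWeight v) :=
  Finset.measurable_prod _ fun i _ => (measurable_gaussianPDF _ _).comp (measurable_coord i)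

theorem lintegral_gaussWeight {v : Fin 3 → ℝ} (hv : ∀ i, 0 < v i) :
    ∫⁻ ξ, gaussWeight v ξ = 1 := by
  simp only [gaussWeight]
  rw [lintegral_space_prod _ fun i => measurable_gaussianPDF _ _]
  refine Finset.prod_eq_one fun i _ => lintegral_gaussianPDF_eq_one _ ?_
  simpa using hv i

theorem charFun_gaussWeight {v : Fin 3 → ℝ} (hv : ∀ i, 0 < v i) (x : Space) :
    charFun (volume.withDensity (gaussWeight v)) x
      = ((∏ i, Real.exp (-(v i * x i ^ 2 / 2)) : ℝ) : ℂ) := by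
  have hlt : ∀ᵐ ξ : Space, gaussWeight v ξ < ∞ :=
    Eventually.of_forall fun ξ => ENNReal.prod_lt_top fun i _ => gaussianPDF_lt_top
  rw [charFun_apply, integral_withDensity_eq_integral_toReal_smul (measurable_gaussWeight v) hlt]
  have h1 : ∀ ξ : Space, (gaussWeight v ξ).toReal • Complex.exp (⟪ξ, x⟫ * Complex.I)
      = ∏ i, ((gaussianPDFReal 0 (v i).toNNReal (ξ i) : ℂ)
          * Complex.exp (x i * ξ i * Complex.I)) := fun ξ => by
    simp only [gaussWeight, ENNReal.toReal_prod, toReal_gaussianPDF]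
    rw [Finset.prod_mul_distrib, ← Complex.exp_sum, ← Finset.sum_mul, Complex.real_smul]
    congr 2
    · push_cast; rfl
    · rw [PiLp.inner_apply]; simp
  simp_rw [h1]
  rw [← (PiLp.volume_preserving_toLp (Fin 3)).integral_comp
    (MeasurableEquiv.toLp 2 (Fin 3 → ℝ)).measurableEmbedding]
  rw [integral_fintype_prod_volume_eq_prod
    (f := fun i (t : ℝ) => (gaussianPDFReal 0 (v i).toNNReal t : ℂ)
          * Complex.exp (x i * t * Complex.I))]
  push_cast
  refine Finset.prod_congr rfl fun i _ => ?_
  have h2 := charFun_gaussianReal (μ := 0) (v := (v i).toNNReal) (x i)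
  rw [charFun_apply_real, integral_gaussianReal_eq_integral_smul (by simpa using hv i)] at h2
  simp only [Complex.real_smul] at h2
  rw [h2]
  congr 1
  have : (((v i).toNNReal : ℝ) : ℂ) = (v i : ℂ) := by rw [Real.coe_toNNReal _ (hv i).le]
  rw [this]
  push_cast
  ring

theorem lintegral_prod_gauss (m : Measure Space) [IsFiniteMeasure m] {v : Fin 3 → ℝ}
    (hv : ∀ i, 0 < v i) :
    ∫⁻ p, ∏ i, ENNReal.ofReal (Real.exp (-(v i * (p.1 i - p.2 i) ^ 2 / 2))) ∂(m.prod m)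
      = ∫⁻ ξ, ‖charFun m ξ‖ₑ ^ 2 * gaussWeight v ξ := by
  have : IsFiniteMeasure (volume.withDensity (gaussWeight v)) :=
    isFiniteMeasure_withDensity (by rw [lintegral_gaussWeight hv]; simp)
  have := lintegral_prod_posDef m (volume.withDensity (gaussWeight v))
    (fun x => ∏ i, Real.exp (-(v i * x i ^ 2 / 2))) (by fun_prop) (fun x => by positivity)
    (charFun_gaussWeight hv)
  rw [lintegral_withDensity_eq_lintegral_mul _ (measurable_gaussWeight v)
    ((continuous_charFun (μ := m)).measurable.enorm.pow_const 2)] at this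
  simp only [Pi.mul_apply, mul_comm (gaussWeight v _)] at this
  rw [← this]
  refine lintegral_congr fun p => ?_
  rw [ENNReal.ofReal_prod_of_nonneg fun i _ => by positivity]
  rfl

/-- Each coordinate carries its own mixing variable. For a fixed vector v of variances this is
Parseval for a Gaussian kernel; integrating over v with weight `A v` and applying Tonelli on both
sides gives the claim. No finiteness of the energy is needed. -/
theorem energy_mix (h : Fin 3 → ℝ) (m : Measure Space) [IsFiniteMeasure m] :
    ∫⁻ p, ∏ i, physMix (h i) (p.1 i - p.2 i) ∂(m.prod m)
      = ∫⁻ ξ, ‖charFun m ξ‖ₑ ^ 2 * ∏ i, specMix (h i) (ξ i) := by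
  set π : Measure (Fin 3 → ℝ) := Measure.pi fun _ => volume.restrict (Ioi 0) with hπ
  have hpos : ∀ᵐ v ∂π, ∀ i, 0 < v i := by
    rw [eventually_all]
    intro i
    exact (Measure.quasiMeasurePreserving_eval (fun _ => volume.restrict (Ioi (0 : ℝ))) i).ae
      (ae_restrict_mem measurableSet_Ioi)
  set A : (Fin 3 → ℝ) → ℝ≥0∞ := fun v => ∏ i, ENNReal.ofReal (v i ^ (-h i)) with hA
  have hAm : Measurable A := by fun_prop
  have hcm : Measurable (charFun m) := (continuous_charFun (μ := m)).measurable
  have hphys : ∀ x : Space, ∏ i, physMix (h i) (x i)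
      = ∫⁻ v, A v * ∏ i, ENNReal.ofReal (Real.exp (-(v i * x i ^ 2 / 2))) ∂π := fun x => by
    simp only [physMix, hA, ← Finset.prod_mul_distrib]
    rw [hπ, lintegral_pi_fin_prod _ (fun i t => ENNReal.ofReal (t ^ (-h i))
      * ENNReal.ofReal (Real.exp (-(t * x i ^ 2 / 2)))) (fun i => by fun_prop)]
  have hgm : ∀ i : Fin 3, Measurable fun p : (Fin 3 → ℝ) × Space =>
      gaussianPDF 0 (p.1 i).toNNReal (p.2 i) := fun i =>
    measurable_uncurry_gaussianPDF.comp (by fun_prop :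
      Measurable fun p : (Fin 3 → ℝ) × Space => ((0 : ℝ), (p.1 i).toNNReal, p.2 i))
  have hgw : Measurable fun p : (Fin 3 → ℝ) × Space => gaussWeight p.1 p.2 :=
    Finset.measurable_prod _ fun i _ => hgm i
  have hspec : ∀ ξ : Space, ∏ i, specMix (h i) (ξ i) = ∫⁻ v, A v * gaussWeight v ξ ∂π := fun ξ => by
    simp only [specMix, hA, gaussWeight, ← Finset.prod_mul_distrib]
    have h1 : ∀ i, Measurable fun t : ℝ => gaussianPDF 0 t.toNNReal (ξ i) := fun i =>
      measurable_uncurry_gaussianPDF.comp (by fun_prop :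
        Measurable fun t : ℝ => ((0 : ℝ), t.toNNReal, ξ i))
    have h2 : ∀ i, Measurable fun t : ℝ => ENNReal.ofReal (t ^ (-h i)) := fun i => by fun_prop
    rw [hπ, lintegral_pi_fin_prod _ (fun i t => ENNReal.ofReal (t ^ (-h i))
      * gaussianPDF 0 t.toNNReal (ξ i)) (fun i => (h2 i).mul (h1 i))]
  calc ∫⁻ p, ∏ i, physMix (h i) (p.1 i - p.2 i) ∂(m.prod m)
      = ∫⁻ p, ∫⁻ v, A v * ∏ i, ENNReal.ofReal (Real.exp (-(v i * (p.1 i - p.2 i) ^ 2 / 2))) ∂π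
          ∂(m.prod m) := lintegral_congr fun p => hphys (p.1 - p.2)
    _ = ∫⁻ v, ∫⁻ p, A v * ∏ i, ENNReal.ofReal (Real.exp (-(v i * (p.1 i - p.2 i) ^ 2 / 2)))
          ∂(m.prod m) ∂π := by
        rw [lintegral_lintegral_swap]
        refine Measurable.aemeasurable ?_
        simp only [Function.uncurry_def]
        fun_prop
    _ = ∫⁻ v, (∫⁻ ξ : Space, A v * (‖charFun m ξ‖ₑ ^ 2 * gaussWeight v ξ)) ∂π := by
        refine lintegral_congr_ae ?_
        filter_upwards [hpos] with v hv
        rw [lintegral_const_mul _ (by fun_prop), lintegral_prod_gauss m hv, lintegral_const_mul]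
        exact (hcm.enorm.pow_const 2).mul (measurable_gaussWeight v)
    _ = ∫⁻ ξ : Space, ∫⁻ v, A v * (‖charFun m ξ‖ₑ ^ 2 * gaussWeight v ξ) ∂π := by
        rw [lintegral_lintegral_swap]
        refine Measurable.aemeasurable ?_
        exact (hAm.comp measurable_fst).mul (((hcm.comp measurable_snd).enorm.pow_const 2).mul hgw)
    _ = _ := by
        refine lintegral_congr fun ξ => ?_
        rw [hspec, ← lintegral_const_mul' _ _ (by simp)]
        refine lintegral_congr fun v => ?_
        rw [mul_left_comm]

end StochWave

/-! ### Spherical integrals and the Fourier transform of the wave kernel -/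

namespace StochWave

open scoped RealInnerProductSpace

/-- With a Gaussian radial factor k, this transfers integrals over the sphere to Gaussian integrals
over the whole space, where independence of coordinates and parity are available. -/
theorem integral_polar (g h : Space → ℝ) (k : ℝ → ℝ)
    (hg : ∀ x : Space, x ≠ 0 → h x = g (‖x‖⁻¹ • x) * k ‖x‖) :
    ∫ x : Space, h x
      = (∫ θ : Metric.sphere (0 : Space) 1, g θ ∂(volume : Measure Space).toSphere)
        * ∫ r in Ioi (0 : ℝ), r ^ 2 * k r := by
  have h1 : ∫ x : Space, h x = ∫ x : ({(0 : Space)}ᶜ : Set Space), h x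
      ∂((volume : Measure Space).comap (↑)) := by
    rw [integral_subtype_comap (measurableSet_singleton _).compl fun x : Space => h x,
      restrict_compl_singleton]
  have h2 := ((volume : Measure Space).measurePreserving_homeomorphUnitSphereProd).integral_comp
        (Homeomorph.measurableEmbedding _) (fun p => g (p.1 : Space) * k p.2)
  have h3 : ∫ r : Ioi (0 : ℝ), k r ∂(Measure.volumeIoiPow 2) = ∫ r in Ioi (0 : ℝ), r ^ 2 * k r := by
    simp only [Measure.volumeIoiPow, ENNReal.ofReal]
    rw [integral_withDensity_eq_integral_smul
      (measurable_subtype_coe.pow_const _).real_toNNReal,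
      integral_subtype_comap measurableSet_Ioi fun a : ℝ => Real.toNNReal (a ^ 2) • k a]
    refine setIntegral_congr_fun measurableSet_Ioi fun x hx => ?_
    rw [NNReal.smul_def, Real.coe_toNNReal _ (by positivity), smul_eq_mul]
  have hd : Module.finrank ℝ Space - 1 = 2 := by simp
  rw [h1, ← h3, ← hd, ← integral_prod_mul (fun θ : Metric.sphere (0 : Space) 1 => g θ)
    (fun r : Ioi (0 : ℝ) => k r), ← h2]
  refine integral_congr_ae (Eventually.of_forall fun x => ?_)
  simp only [homeomorphUnitSphereProd_apply_fst_coe, homeomorphUnitSphereProd_apply_snd_coe]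
  exact hg x x.2

/-- Half-line Gaussian moments `∫₀^∞ t^(2k) exp(-t² / 2) dt`. -/
noncomputable def halfMoment (k : ℕ) : ℝ :=
  ∫ t in Ioi (0 : ℝ), t ^ (2 * k) * Real.exp (-(t ^ 2 / 2))

theorem halfMoment_eq (k : ℕ) :
    halfMoment k = (1 / 2 : ℝ) ^ (-((k : ℝ) + 1 / 2)) * (1 / 2) * Real.Gamma (k + 1 / 2) := by
  have h := integral_rpow_mul_exp_neg_mul_rpow (p := 2) (q := 2 * (k : ℝ)) (b := 1 / 2)
    (by norm_num) (by have : (0 : ℝ) ≤ k := k.cast_nonneg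
                      linarith) (by norm_num)
  have e : (2 * (k : ℝ) + 1) / 2 = k + 1 / 2 := by ring
  rw [neg_div, e] at h
  rw [halfMoment, ← h]
  refine setIntegral_congr_fun measurableSet_Ioi fun t ht => ?_
  rw [← Real.rpow_natCast]
  push_cast
  congr 2
  rw [Real.rpow_two]; ring

theorem halfMoment_pos (k : ℕ) : 0 < halfMoment k := by
  rw [halfMoment_eq]
  have := Real.Gamma_pos_of_pos (s := (k : ℝ) + 1 / 2) (by positivity)
  positivity

theorem halfMoment_succ (k : ℕ) : halfMoment (k + 1) = (2 * k + 1) * halfMoment k := by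
  rw [halfMoment_eq, halfMoment_eq]
  have e : ((k + 1 : ℕ) : ℝ) + 1 / 2 = (k + 1 / 2) + 1 := by push_cast; ring
  rw [e, Real.Gamma_add_one (by positivity), neg_add, Real.rpow_add (by norm_num),
    Real.rpow_neg_one]
  ring

theorem integral_pow_gaussianReal (k : ℕ) :
    ∫ t, t ^ (2 * k) ∂(gaussianReal 0 1) = 2 * (√(2 * Real.pi))⁻¹ * halfMoment k := by
  rw [integral_gaussianReal_eq_integral_smul one_ne_zero]
  have h := integral_comp_abs (f := fun t : ℝ => t ^ (2 * k) * Real.exp (-(t ^ 2 / 2)))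
  rw [halfMoment, mul_comm (2 : ℝ) (√(2 * Real.pi))⁻¹, mul_assoc (√(2 * Real.pi))⁻¹ 2, ← h,
    ← integral_const_mul]
  refine integral_congr_ae (Eventually.of_forall fun t => ?_)
  simp only [gaussianPDFReal, pow_mul, sq_abs, smul_eq_mul]
  norm_num
  ring_nf

/-- Rotation invariance of the standard Gaussian in the form needed here, read off from
characteristic functions. -/
theorem map_inner_gaussWeight (w : Space) :
    (volume.withDensity (gaussWeight 1)).map (fun x : Space => ⟪x, w⟫)
      = gaussianReal 0 (‖w‖₊ ^ 2) := by
  have h1 : ∀ i : Fin 3, (0 : ℝ) < (1 : Fin 3 → ℝ) i := fun i => one_pos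
  have : IsFiniteMeasure (volume.withDensity (gaussWeight 1)) :=
    isFiniteMeasure_withDensity (by rw [lintegral_gaussWeight h1]; simp)
  refine Measure.ext_of_charFun (funext fun t => ?_)
  have h2 := charFun_gaussWeight h1 (t • w)
  rw [charFun_apply_real, integral_map (by fun_prop) (by fun_prop), charFun_gaussianReal]
  rw [charFun_apply] at h2
  simp only [inner_smul_right, Complex.ofReal_mul] at h2
  rw [h2, ← Real.exp_sum, Complex.ofReal_exp]
  congr 1
  have : ‖w‖ ^ 2 = ∑ i, w i ^ 2 := by
    rw [EuclideanSpace.norm_sq_eq]; simp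
  have h3 : (∑ i, -((1 : Fin 3 → ℝ) i * (t • w) i ^ 2 / 2)) = -(‖w‖ ^ 2 * t ^ 2 / 2) := by
    rw [this, Finset.sum_mul, Finset.sum_div, ← Finset.sum_neg_distrib]
    refine Finset.sum_congr rfl fun i _ => ?_
    simp; ring
  rw [h3]
  push_cast
  simp

theorem gaussWeight_one (x : Space) :
    (gaussWeight 1 x).toReal = ((√(2 * Real.pi))⁻¹) ^ 3 * Real.exp (-(‖x‖ ^ 2 / 2)) := by
  rw [EuclideanSpace.norm_sq_eq]
  simp only [gaussWeight, ENNReal.toReal_prod, toReal_gaussianPDF, gaussianPDFReal]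
  simp [Fin.prod_univ_three, Fin.sum_univ_three]
  rw [show -((x 0 ^ 2 + x 1 ^ 2 + x 2 ^ 2) / 2) = -x 0 ^ 2 / 2 + -x 1 ^ 2 / 2 + -x 2 ^ 2 / 2 by ring,
    Real.exp_add, Real.exp_add]
  ring

theorem integral_inner_pow_gauss (w : Space) (k : ℕ) :
    ∫ x : Space, ⟪x, w⟫ ^ (2 * k) * Real.exp (-(‖x‖ ^ 2 / 2))
      = 4 * Real.pi * ‖w‖ ^ (2 * k) * halfMoment k := by
  have hlt : ∀ᵐ ξ : Space, gaussWeight 1 ξ < ∞ :=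
    Eventually.of_forall fun ξ => ENNReal.prod_lt_top fun i _ => gaussianPDF_lt_top
  have hs : (gaussianReal 0 1).map (fun t => ‖w‖ * t) = gaussianReal 0 (‖w‖₊ ^ 2) := by
    rw [gaussianReal_map_const_mul]
    congr 1
    · simp
    · ext; simp
  have h1 : ∫ t, t ^ (2 * k) ∂(gaussianReal 0 (‖w‖₊ ^ 2))
      = ‖w‖ ^ (2 * k) * (2 * (√(2 * Real.pi))⁻¹ * halfMoment k) := by
    rw [← hs, integral_map (by fun_prop) (by fun_prop), ← integral_pow_gaussianReal,
      ← integral_const_mul]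
    simp_rw [mul_pow]
  rw [← map_inner_gaussWeight, integral_map (by fun_prop) (by fun_prop),
    integral_withDensity_eq_integral_toReal_smul (measurable_gaussWeight 1) hlt] at h1
  simp_rw [gaussWeight_one, smul_eq_mul, mul_assoc] at h1
  rw [integral_const_mul] at h1
  have hp : (0 : ℝ) < √(2 * Real.pi) := by positivity
  have hp2 : √(2 * Real.pi) ^ 2 = 2 * Real.pi := Real.sq_sqrt (by positivity)
  have h2 : ∫ x : Space, Real.exp (-(‖x‖ ^ 2 / 2)) * ⟪x, w⟫ ^ (2 * k)
      = √(2 * Real.pi) ^ 3 * (‖w‖ ^ (2 * k) * (2 * ((√(2 * Real.pi))⁻¹ * halfMoment k))) := by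
    rw [← h1]; field_simp
  simp_rw [mul_comm (⟪_, w⟫ ^ (2 * k))]
  rw [h2]
  -- The factor 4π of the statement is (2π)^(3/2) · 2 · (2π)^(-1/2).
  have h3 : √(2 * Real.pi) ^ 3 * (√(2 * Real.pi))⁻¹ = 2 * Real.pi := by
    field_simp
    exact hp2
  linear_combination (2 * ‖w‖ ^ (2 * k) * halfMoment k) * h3

/-- In polar coordinates the Gaussian integral of ⟪x, w⟫^(2k) has radial part `halfMoment (k + 1)`,
which is (2k+1) times `halfMoment k`; the half moments cancel and leave the denominator 2k+1. -/
theorem integral_sphere_inner_pow (w : Space) (k : ℕ) :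
    ∫ θ : Metric.sphere (0 : Space) 1, ⟪(θ : Space), w⟫ ^ (2 * k) ∂(volume : Measure Space).toSphere
      = 4 * Real.pi * ‖w‖ ^ (2 * k) / (2 * k + 1) := by
  have h := integral_polar (fun x => ⟪x, w⟫ ^ (2 * k))
    (fun x => ⟪x, w⟫ ^ (2 * k) * Real.exp (-(‖x‖ ^ 2 / 2)))
    (fun r => r ^ (2 * k) * Real.exp (-(r ^ 2 / 2))) (fun x hx => by
      have : ‖x‖ ≠ 0 := norm_ne_zero_iff.2 hx
      simp only [real_inner_smul_left, mul_pow, inv_pow]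
      field_simp)
  rw [integral_inner_pow_gauss] at h
  have e : ∫ r in Ioi (0 : ℝ), r ^ 2 * (r ^ (2 * k) * Real.exp (-(r ^ 2 / 2)))
      = halfMoment (k + 1) := by
    rw [halfMoment]
    congr 1; ext r; ring
  rw [e, halfMoment_succ] at h
  have := halfMoment_pos k
  field_simp at h ⊢
  linarith

/-- Integrate the cosine series termwise. The moment of order 2n contributes the factor 1/(2n+1),
which turns (2n)! into (2n+1)! and hence the cosine series into that of sinc. The cosh series
justifies the exchange. -/
theorem integral_sphere_cos (w : Space) :
    ∫ θ : Metric.sphere (0 : Space) 1, Real.cos ⟪(θ : Space), w⟫ ∂(volume : Measure Space).toSphere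
      = 4 * Real.pi * Real.sinc ‖w‖ := by
  have hb : ∀ θ : Metric.sphere (0 : Space) 1, |⟪(θ : Space), w⟫| ≤ ‖w‖ := fun θ => by
    refine (abs_real_inner_le_norm _ _).trans ?_
    simp
  have h := hasSum_integral_of_summable_integral_norm (μ := (volume : Measure Space).toSphere)
    (F := fun (n : ℕ) (θ : Metric.sphere (0 : Space) 1) =>
      (-1) ^ n * ⟪(θ : Space), w⟫ ^ (2 * n) / (2 * n).factorial)
    (fun n => ?_) ?_
  · simp_rw [(Real.hasSum_cos _).tsum_eq] at h
    refine h.unique ?_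
    simp_rw [mul_div_assoc, integral_const_mul, integral_div, integral_sphere_inner_pow]
    by_cases hw : ‖w‖ = 0
    · rw [hw, Real.sinc_zero]
      convert hasSum_single 0 (fun n hn => ?_) using 1
      · simp
      · have : 2 * n ≠ 0 := by omega
        simp [this]
    · have h2 := ((Real.hasSum_sin ‖w‖).mul_left (4 * Real.pi / ‖w‖))
      rw [Real.sinc_of_ne_zero hw]
      have e : 4 * Real.pi * (Real.sin ‖w‖ / ‖w‖) = 4 * Real.pi / ‖w‖ * Real.sin ‖w‖ := by ring
      rw [e]
      have hfe : ∀ n : ℕ, 4 * Real.pi / ‖w‖ * ((-1) ^ n * ‖w‖ ^ (2 * n + 1) / (2 * n + 1).factorial)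
          = (-1) ^ n * (4 * Real.pi * (‖w‖ ^ (2 * n) / (2 * n + 1)) / (2 * n).factorial) := fun n => by
        rw [Nat.factorial_succ]
        push_cast
        field_simp
        ring
      simp_rw [hfe] at h2
      simpa only [mul_div_assoc] using h2
  · refine Integrable.of_bound (by fun_prop) (‖w‖ ^ (2 * n) / (2 * n).factorial)
      (Eventually.of_forall fun θ => ?_)
    rw [norm_div, norm_mul, norm_pow, norm_pow]
    simp only [norm_neg, norm_one, one_pow, one_mul, Real.norm_natCast]
    gcongr
    exact hb θ
  · refine Summable.of_nonneg_of_le (fun n => integral_nonneg fun θ => norm_nonneg _)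
      (fun n => ?_) ((((Real.hasSum_cosh ‖w‖).summable).mul_left
        ((volume : Measure Space).toSphere.real univ)))
    refine (integral_mono_of_nonneg (Eventually.of_forall fun θ => norm_nonneg _)
      (integrable_const (‖w‖ ^ (2 * n) / (2 * n).factorial)) (Eventually.of_forall fun θ => ?_)).trans
      (by simp)
    simp only
    rw [norm_div, norm_mul, norm_pow, norm_pow]
    simp only [norm_neg, norm_one, one_pow, one_mul, Real.norm_natCast]
    gcongr
    exact hb θ

/-- Oddness, used on the whole space and brought back to the sphere by dividing by the nonzero
radial integral `halfMoment 1`. -/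
theorem integral_sphere_sin (w : Space) :
    ∫ θ : Metric.sphere (0 : Space) 1, Real.sin ⟪(θ : Space), w⟫ ∂(volume : Measure Space).toSphere
      = 0 := by
  have h := integral_polar (fun x => Real.sin ⟪x, w⟫)
    (fun x => Real.sin ⟪‖x‖⁻¹ • x, w⟫ * Real.exp (-(‖x‖ ^ 2 / 2)))
    (fun r => Real.exp (-(r ^ 2 / 2))) (fun x hx => rfl)
  have h0 : ∫ x : Space, Real.sin ⟪‖x‖⁻¹ • x, w⟫ * Real.exp (-(‖x‖ ^ 2 / 2)) = 0 := by
    have := integral_neg_eq_self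
      (fun x : Space => Real.sin ⟪‖x‖⁻¹ • x, w⟫ * Real.exp (-(‖x‖ ^ 2 / 2))) volume
    simp only [norm_neg, smul_neg, inner_neg_left, Real.sin_neg, neg_mul, integral_neg] at this
    linarith
  rw [h0] at h
  have e : ∫ r in Ioi (0 : ℝ), r ^ 2 * Real.exp (-(r ^ 2 / 2)) = halfMoment 1 := by
    simp [halfMoment]
  rw [e] at h
  exact (mul_eq_zero.1 h.symm).resolve_right (halfMoment_pos 1).ne'

theorem integral_sphere_exp (w : Space) :
    ∫ θ : Metric.sphere (0 : Space) 1, Complex.exp (⟪(θ : Space), w⟫ * Complex.I)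
        ∂(volume : Measure Space).toSphere
      = ((4 * Real.pi * Real.sinc ‖w‖ : ℝ) : ℂ) := by
  have hc : Integrable (fun θ : Metric.sphere (0 : Space) 1 => Real.cos ⟪(θ : Space), w⟫)
      (volume : Measure Space).toSphere :=
    Integrable.of_bound (by fun_prop) 1 (Eventually.of_forall fun θ => Real.abs_cos_le_one _)
  have hs : Integrable (fun θ : Metric.sphere (0 : Space) 1 => Real.sin ⟪(θ : Space), w⟫)
      (volume : Measure Space).toSphere :=
    Integrable.of_bound (by fun_prop) 1 (Eventually.of_forall fun θ => Real.abs_sin_le_one _)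
  simp_rw [Complex.exp_mul_I, ← Complex.ofReal_cos, ← Complex.ofReal_sin]
  rw [integral_add hc.ofReal (hs.ofReal.mul_const _), integral_mul_const, integral_complex_ofReal,
    integral_complex_ofReal, integral_sphere_cos, integral_sphere_sin]
  simp

instance (t : ℝ) : IsFiniteMeasure (surfaceMeasure t) := by
  unfold surfaceMeasure
  exact Measure.smul_finite _ ENNReal.ofReal_ne_top

instance (t : ℝ) : IsFiniteMeasure (waveKernel t) := by
  unfold waveKernel
  exact Measure.smul_finite _ ENNReal.ofReal_ne_top

instance (t : ℝ) (x : Space) : IsFiniteMeasure (shiftedKernel t x) := by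
  unfold shiftedKernel
  infer_instance

/-- The Fourier transform of the shifted fundamental solution. -/
theorem charFun_shiftedKernel {r : ℝ} (hr : 0 < r) (x ξ : Space) :
    charFun (shiftedKernel r x) ξ
      = Complex.exp (⟪x, ξ⟫ * Complex.I) * ((r * Real.sinc (r * ‖ξ‖) : ℝ) : ℂ) := by
  rw [charFun_apply, shiftedKernel, integral_map (by fun_prop) (by fun_prop), waveKernel,
    surfaceMeasure, smul_smul, integral_smul_measure, integral_map (by fun_prop) (by fun_prop)]
  simp only [inner_sub_left, Complex.ofReal_sub, sub_mul, Complex.exp_sub]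
  have h1 : ∀ θ : Metric.sphere (0 : Space) 1,
      Complex.exp (⟪x, ξ⟫ * Complex.I) / Complex.exp (⟪r • (θ : Space), ξ⟫ * Complex.I)
      = Complex.exp (⟪x, ξ⟫ * Complex.I) * Complex.exp (⟪(θ : Space), -(r • ξ)⟫ * Complex.I) :=
    fun θ => by
      rw [div_eq_mul_inv, ← Complex.exp_neg, real_inner_smul_left, inner_neg_right,
        real_inner_smul_right]
      push_cast
      ring_nf
  simp_rw [h1]
  rw [integral_const_mul, integral_sphere_exp, norm_neg, norm_smul, Real.norm_of_nonneg hr.le,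
    ← ENNReal.ofReal_mul (by positivity), ENNReal.toReal_ofReal (by positivity),
    Complex.real_smul, mul_left_comm, ← Complex.ofReal_mul]
  congr 2
  field_simp

end StochWave

/-! ### The spectral measure and measures of finite energy -/

namespace StochWave

open scoped RealInnerProductSpace ComplexConjugate

/-- `|x|^r max(1,|x|)^(-s)` is integrable when `r > -1` and `r - s < -1`. -/
theorem lintegral_rpow_max_lt_top {r s : ℝ} (hr : -1 < r) (hs : r - s < -1) :
    ∫⁻ x : ℝ, ENNReal.ofReal (|x| ^ r * max 1 |x| ^ (-s)) < ∞ := by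
  have h1 : IntegrableOn (fun x : ℝ => |x| ^ r * max 1 |x| ^ (-s)) (Ioi 0) := by
    rw [← Ioc_union_Ioi_eq_Ioi zero_le_one]
    refine IntegrableOn.union ?_ ?_
    · have := (intervalIntegral.intervalIntegrable_rpow' (a := 0) (b := 1) hr).1
      refine this.congr_fun (fun x hx => ?_) measurableSet_Ioc
      simp only
      rw [abs_of_pos hx.1, max_eq_left hx.2, Real.one_rpow, mul_one]
    · refine (integrableOn_Ioi_rpow_of_lt hs one_pos).congr_fun (fun x hx => ?_) measurableSet_Ioi
      have hx1 : (1 : ℝ) < x := hx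
      have hx0 : (0 : ℝ) < x := by linarith
      simp only
      rw [abs_of_pos hx0, max_eq_right hx1.le, ← Real.rpow_add hx0, sub_eq_add_neg]
  have h2 : Integrable (fun x : ℝ => |x| ^ r * max 1 |x| ^ (-s)) := by
    have h3 := IntegrableOn.comp_neg_Iio (c := (0 : ℝ)) ((neg_zero (G := ℝ)).symm ▸ h1)
    simp only [abs_neg] at h3
    have h4 := h3.union ((integrableOn_Ici_iff_integrableOn_Ioi (by simp)).2 h1)
    rwa [Iio_union_Ici, integrableOn_univ] at h4
  exact h2.lintegral_lt_top

/-- The ratio of constants makes the energy identity for `fractionalKernel` hold with no further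
factor: the mixtures carry `physConst` on one side and `specConst` on the other. -/
noncomputable def specDensity (H : Fin 3 → ℝ) (ξ : Space) : ℝ :=
  (∏ i, specConst (H i) / physConst (H i)) * ∏ i, |ξ i| ^ (1 - 2 * H i)

/-- The spectral measure of the fractional covariance. -/
noncomputable def specMeasure (H : Fin 3 → ℝ) : Measure Space :=
  volume.withDensity fun ξ => ENNReal.ofReal (specDensity H ξ)

theorem measurable_specDensity (H : Fin 3 → ℝ) : Measurable (specDensity H) := by
  unfold specDensity
  fun_prop

instance (H : Fin 3 → ℝ) : SigmaFinite (specMeasure H) := by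
  unfold specMeasure
  infer_instance

theorem measurable_fractionalKernel (H : Fin 3 → ℝ) : Measurable (fractionalKernel H) := by
  unfold fractionalKernel
  fun_prop

theorem fractionalKernel_nonneg (H : Fin 3 → ℝ) (x : Space) : 0 ≤ fractionalKernel H x :=
  Finset.prod_nonneg fun i _ => by positivity

theorem fractionalKernel_neg (H : Fin 3 → ℝ) (x : Space) :
    fractionalKernel H (-x) = fractionalKernel H x := by
  simp [fractionalKernel]

theorem ae_coord_ne_zero : ∀ᵐ ξ : Space, ∀ i, ξ i ≠ 0 := by
  rw [eventually_all]
  intro i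
  have h : ∀ᵐ x : Fin 3 → ℝ, x i ≠ 0 :=
    (Measure.quasiMeasurePreserving_eval (fun _ => (volume : Measure ℝ)) i).ae
      (Measure.ae_ne volume 0)
  exact (PiLp.volume_preserving_ofLp (Fin 3)).quasiMeasurePreserving.ae h

/-- At 0 the mixture is infinite, whereas the real power |0|^(2h-2) is 0 by convention. The value ∞
is what later shows that finite energy excludes pairs of points with a common coordinate. -/
theorem physMix_zero {h : ℝ} (hh : h < 1) : physMix h 0 = ∞ := by
  refine ENNReal.eq_top_of_forall_nnreal_le fun r => ?_
  by_cases hr : r = 0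
  · simp [hr]
  have hr0 : (0 : ℝ) < r := by positivity
  have hc := physConst_pos hh
  -- Chosen so that `physMix h x = r`; the integrand at 0 dominates the one at x.
  set x : ℝ := (r / physConst h) ^ (1 / (2 * h - 2)) with hx
  have hx0 : 0 < x := by positivity
  have h1 : physMix h x = r := by
    rw [physMix_eq hh hx0.ne', abs_of_pos hx0, hx, ← Real.rpow_mul (by positivity),
      one_div_mul_cancel (by linarith), Real.rpow_one, mul_div_cancel₀ _ hc.ne',
      ENNReal.ofReal_coe_nnreal]
  rw [← h1]
  refine setLIntegral_mono' measurableSet_Ioi fun v hv => ?_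
  have hv : (0 : ℝ) < v := hv
  gcongr

theorem physMix_ne_zero {h : ℝ} (hh : h < 1) (x : ℝ) : physMix h x ≠ 0 := by
  by_cases hx : x = 0
  · rw [hx, physMix_zero hh]; simp
  · rw [physMix_eq hh hx]
    have := physConst_pos hh
    have : 0 < |x| := abs_pos.2 hx
    simp only [ne_eq, ENNReal.ofReal_eq_zero, not_le]
    positivity

variable {H : Fin 3 → ℝ}

theorem prod_physMix_eq (hH : ∀ i, 1 / 2 < H i ∧ H i < 1) {x : Space} (hx : ∀ i, x i ≠ 0) :
    ∏ i, physMix (H i) (x i)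
      = ENNReal.ofReal (∏ i, physConst (H i)) * ENNReal.ofReal (fractionalKernel H x) := by
  have hc : ∀ i, 0 < physConst (H i) := fun i => physConst_pos (hH i).2
  rw [← ENNReal.ofReal_mul (Finset.prod_nonneg fun i _ => (hc i).le), fractionalKernel,
    ← Finset.prod_mul_distrib, ENNReal.ofReal_prod_of_nonneg]
  · exact Finset.prod_congr rfl fun i _ => physMix_eq (hH i).2 (hx i)
  · intro i _
    have := hc i
    positivity

theorem prod_specMix_eq (hH : ∀ i, 1 / 2 < H i ∧ H i < 1) {x : Space} (hx : ∀ i, x i ≠ 0) :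
    ∏ i, specMix (H i) (x i)
      = ENNReal.ofReal (∏ i, physConst (H i)) * ENNReal.ofReal (specDensity H x) := by
  have hc : ∀ i, 0 < physConst (H i) := fun i => physConst_pos (hH i).2
  have hs : ∀ i, 0 < specConst (H i) := fun i => specConst_pos (hH i).1
  rw [← ENNReal.ofReal_mul (Finset.prod_nonneg fun i _ => (hc i).le), specDensity,
    ← Finset.prod_mul_distrib, ← Finset.prod_mul_distrib, ENNReal.ofReal_prod_of_nonneg]
  · refine Finset.prod_congr rfl fun i _ => ?_
    rw [specMix_eq (hH i).1 (hx i), ← mul_assoc, mul_div_cancel₀ _ (hc i).ne']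
  · intro i _
    have := hc i
    have := hs i
    positivity

theorem lintegral_physMix_eq (hH : ∀ i, 1 / 2 < H i ∧ H i < 1) (m : Measure Space)
    [IsFiniteMeasure m] :
    ∫⁻ p, ∏ i, physMix (H i) (p.1 i - p.2 i) ∂(m.prod m)
      = ENNReal.ofReal (∏ i, physConst (H i)) * ∫⁻ ξ, ‖charFun m ξ‖ₑ ^ 2 ∂(specMeasure H) := by
  have hm : Measurable fun ξ : Space => ‖charFun m ξ‖ₑ ^ 2 :=
    (continuous_charFun (μ := m)).measurable.enorm.pow_const 2
  have hd : Measurable fun ξ : Space => ENNReal.ofReal (specDensity H ξ) :=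
    (measurable_specDensity H).ennreal_ofReal
  rw [energy_mix, specMeasure, lintegral_withDensity_eq_lintegral_mul _ hd hm,
    ← lintegral_const_mul' _ _ ENNReal.ofReal_ne_top]
  refine lintegral_congr_ae ?_
  filter_upwards [ae_coord_ne_zero] with ξ hξ
  rw [prod_specMix_eq hH hξ, Pi.mul_apply]
  ring

/-- Measures of finite energy for the fractional kernel. -/
def FiniteEnergy (H : Fin 3 → ℝ) (m : Measure Space) : Prop :=
  MemLp (charFun m) 2 (specMeasure H)

theorem aestronglyMeasurable_charFun (m : Measure Space) [IsFiniteMeasure m] (ν : Measure Space) :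
    AEStronglyMeasurable (charFun m) ν :=
  (continuous_charFun (μ := m)).aestronglyMeasurable

theorem finiteEnergy_iff (m : Measure Space) [IsFiniteMeasure m] :
    FiniteEnergy H m ↔ ∫⁻ ξ, ‖charFun m ξ‖ₑ ^ 2 ∂(specMeasure H) < ∞ := by
  rw [FiniteEnergy, MemLp, eLpNorm_lt_top_iff_lintegral_rpow_enorm_lt_top (by simp) (by simp)]
  simp [aestronglyMeasurable_charFun]

/-- Finite spectral energy makes the product of mixtures integrable for m ⊗ m, hence finite almost
everywhere. No factor vanishes, so pairs with a common coordinate, where the product is ∞, form a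
null set. Off that set the product is a constant multiple of `fractionalKernel`, and the constant
cancels. -/
theorem FiniteEnergy.integrable_self (hH : ∀ i, 1 / 2 < H i ∧ H i < 1) {m : Measure Space}
    [IsFiniteMeasure m] (hm : FiniteEnergy H m) :
    Integrable (fun p : Space × Space => fractionalKernel H (p.1 - p.2)) (m.prod m) ∧
    ∫ p, fractionalKernel H (p.1 - p.2) ∂(m.prod m) = ∫ ξ, ‖charFun m ξ‖ ^ 2 ∂(specMeasure H) := by
  have hc : 0 < ∏ i, physConst (H i) := Finset.prod_pos fun i _ => physConst_pos (hH i).2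
  have hE := (finiteEnergy_iff m).1 hm
  have h1 := lintegral_physMix_eq hH m
  have hfin : ∫⁻ p, ∏ i, physMix (H i) (p.1 i - p.2 i) ∂(m.prod m) < ∞ := by
    rw [h1]; exact ENNReal.mul_lt_top ENNReal.ofReal_lt_top hE
  have hmeas : Measurable fun p : Space × Space => ∏ i, physMix (H i) (p.1 i - p.2 i) := by
    refine Finset.measurable_prod _ fun i _ => ?_
    have : Measurable (physMix (H i)) := by
      unfold physMix
      exact Measurable.lintegral_prod_right (by fun_prop)
    exact this.comp (by fun_prop)
  have hne : ∀ᵐ p ∂(m.prod m), ∀ i, (p.1 - p.2) i ≠ 0 := by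
    filter_upwards [ae_lt_top hmeas hfin.ne] with p hp i hi
    refine hp.ne (WithTop.prod_eq_top (Finset.mem_univ i) ?_ fun j _ => physMix_ne_zero (hH j).2 _)
    have : p.1 i - p.2 i = 0 := hi
    rw [this, physMix_zero (hH i).2]
    rfl
  have h2 : ∫⁻ p, ENNReal.ofReal (fractionalKernel H (p.1 - p.2)) ∂(m.prod m)
      = ∫⁻ ξ, ‖charFun m ξ‖ₑ ^ 2 ∂(specMeasure H) := by
    have h3 : ∫⁻ p, ∏ i, physMix (H i) (p.1 i - p.2 i) ∂(m.prod m)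
        = ENNReal.ofReal (∏ i, physConst (H i)) *
          ∫⁻ p, ENNReal.ofReal (fractionalKernel H (p.1 - p.2)) ∂(m.prod m) := by
      rw [← lintegral_const_mul' _ _ ENNReal.ofReal_ne_top]
      refine lintegral_congr_ae ?_
      filter_upwards [hne] with p hp
      have h4 := prod_physMix_eq hH hp
      simp only [PiLp.sub_apply] at h4
      exact h4
    rw [h3] at h1
    exact (ENNReal.mul_right_inj (by simpa using hc) ENNReal.ofReal_ne_top).1 h1
  have hkm : Measurable fun p : Space × Space => fractionalKernel H (p.1 - p.2) :=
    (measurable_fractionalKernel H).comp (by fun_prop)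
  have hk0 : 0 ≤ᵐ[m.prod m] fun p : Space × Space => fractionalKernel H (p.1 - p.2) :=
    Eventually.of_forall fun p => fractionalKernel_nonneg H _
  refine ⟨⟨hkm.aestronglyMeasurable, ?_⟩, ?_⟩
  · rw [hasFiniteIntegral_iff_ofReal hk0, h2]; exact hE
  · rw [integral_eq_lintegral_of_nonneg_ae hk0 hkm.aestronglyMeasurable, h2,
      integral_eq_lintegral_of_nonneg_ae
        (Eventually.of_forall fun ξ => sq_nonneg ‖charFun m ξ‖)
        ((continuous_charFun (μ := m)).norm.pow 2).aestronglyMeasurable]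
    congr 1
    refine lintegral_congr fun ξ => ?_
    rw [ENNReal.ofReal_pow (norm_nonneg _), ofReal_norm]

theorem charFun_add_measure (m n : Measure Space) [IsFiniteMeasure m] [IsFiniteMeasure n] :
    charFun (m + n) = charFun m + charFun n := by
  ext ξ
  simp only [charFun_apply, Pi.add_apply]
  refine integral_add_measure ?_ ?_ <;>
  · refine Integrable.of_bound (by fun_prop) 1 (Eventually.of_forall fun p => ?_)
    rw [Complex.norm_exp_ofReal_mul_I]

theorem FiniteEnergy.add {m n : Measure Space} [IsFiniteMeasure m] [IsFiniteMeasure n]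
    (hm : FiniteEnergy H m) (hn : FiniteEnergy H n) : FiniteEnergy H (m + n) := by
  rw [FiniteEnergy, charFun_add_measure]
  exact MemLp.add hm hn

theorem integrable_mul_conj {a b : Space → ℂ} {ν : Measure Space} (ha : MemLp a 2 ν)
    (hb : MemLp b 2 ν) : Integrable (fun ξ => (a ξ * conj (b ξ)).re) ν :=
  (ha.integrable_mul hb.star).re

/-- Polarisation within positive measures: apply the energy identity to m + n, expand both sides,
and subtract the identities for m and n. The kernel is even, so the two cross terms agree. -/
theorem FiniteEnergy.integrable_cross (hH : ∀ i, 1 / 2 < H i ∧ H i < 1) {m n : Measure Space}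
    [IsFiniteMeasure m] [IsFiniteMeasure n] (hm : FiniteEnergy H m) (hn : FiniteEnergy H n) :
    Integrable (fun p : Space × Space => fractionalKernel H (p.1 - p.2)) (m.prod n) ∧
    ∫ p, fractionalKernel H (p.1 - p.2) ∂(m.prod n)
      = ∫ ξ, (charFun m ξ * conj (charFun n ξ)).re ∂(specMeasure H) := by
  obtain ⟨i1, e1⟩ := hm.integrable_self hH
  obtain ⟨i2, e2⟩ := hn.integrable_self hH
  obtain ⟨i3, e3⟩ := (hm.add hn).integrable_self hH
  rw [Measure.prod_add, Measure.add_prod, Measure.add_prod] at i3 e3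
  have imn := i3.right_of_add_measure.left_of_add_measure
  have inm := i3.left_of_add_measure.right_of_add_measure
  refine ⟨imn, ?_⟩
  have hsymm : ∫ p, fractionalKernel H (p.1 - p.2) ∂(n.prod m)
      = ∫ p, fractionalKernel H (p.1 - p.2) ∂(m.prod n) := by
    rw [← integral_prod_swap]
    refine integral_congr_ae (Eventually.of_forall fun p => ?_)
    simp only [Prod.fst_swap, Prod.snd_swap]
    rw [← fractionalKernel_neg, neg_sub]
  rw [integral_add_measure i3.left_of_add_measure i3.right_of_add_measure,
    integral_add_measure i1 inm, integral_add_measure imn i2, hsymm, e1, e2,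
    charFun_add_measure] at e3
  have hsq : ∀ ξ, ‖(charFun m + charFun n) ξ‖ ^ 2 = ‖charFun m ξ‖ ^ 2 + ‖charFun n ξ‖ ^ 2
      + 2 * (charFun m ξ * conj (charFun n ξ)).re := fun ξ => by
    rw [Pi.add_apply, ← Complex.normSq_eq_norm_sq, ← Complex.normSq_eq_norm_sq,
      ← Complex.normSq_eq_norm_sq, Complex.normSq_add]
  simp_rw [hsq] at e3
  have j1 : Integrable (fun ξ => ‖charFun m ξ‖ ^ 2) (specMeasure H) := MemLp.integrable_norm_pow hm two_ne_zero
  have j2 : Integrable (fun ξ => ‖charFun n ξ‖ ^ 2) (specMeasure H) := MemLp.integrable_norm_pow hn two_ne_zero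
  have j3 : Integrable (fun ξ => ‖charFun m ξ‖ ^ 2 + ‖charFun n ξ‖ ^ 2) (specMeasure H) := j1.add j2
  rw [integral_add j3 ((integrable_mul_conj hm hn).const_mul 2), integral_add j1 j2,
    integral_const_mul] at e3
  linarith

end StochWave

/-! ### Bounded signed densities and the spectral form of squared distances -/

namespace StochWave

open scoped RealInnerProductSpace ComplexConjugate

variable {H : Fin 3 → ℝ}

/-- Bounded measurable functions vanishing off the cube of half-side `R`. -/
structure BoxBounded (M R : ℝ) (g : Space → ℝ) : Prop where
  meas : Measurable g
  bound : ∀ y, |g y| ≤ M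
  support : ∀ y, g y ≠ 0 → ∀ i, |y i| ≤ R

theorem BoxBounded.neg {M R : ℝ} {g : Space → ℝ} (hg : BoxBounded M R g) :
    BoxBounded M R (fun y => -g y) :=
  ⟨hg.meas.neg, fun y => by rw [abs_neg]; exact hg.bound y,
    fun y hy => hg.support y (fun h => hy (by rw [h, neg_zero]))⟩

/-- The measure with density the positive part of `g`. -/
noncomputable def posMeasure (g : Space → ℝ) : Measure Space :=
  volume.withDensity fun y => ENNReal.ofReal (g y)

theorem BoxBounded.ofReal_le {M R : ℝ} {g : Space → ℝ} (hg : BoxBounded M R g) (y : Space) :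
    ENNReal.ofReal (g y) ≤ ENNReal.ofReal M * ∏ i, (Icc (-R) R).indicator 1 (y i) := by
  by_cases h : g y = 0
  · simp [h]
  · have h1 : ∏ i, (Icc (-R) R).indicator (1 : ℝ → ℝ≥0∞) (y i) = 1 := by
      refine Finset.prod_eq_one fun i _ => ?_
      rw [indicator_of_mem, Pi.one_apply]
      exact abs_le.1 (hg.support y h i)
    rw [h1, mul_one]
    exact ENNReal.ofReal_le_ofReal ((le_abs_self _).trans (hg.bound y))

theorem lintegral_cube_lt_top {c : ℝ≥0∞} (hc : c < ∞) (R : ℝ) :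
    ∫⁻ y : Space, c * ∏ i, (Icc (-R) R).indicator 1 (y i) < ∞ := by
  have hm : Measurable ((Icc (-R) R).indicator (1 : ℝ → ℝ≥0∞)) :=
    measurable_one.indicator measurableSet_Icc
  rw [lintegral_const_mul' _ _ hc.ne, lintegral_space_prod _ fun i => hm]
  refine ENNReal.mul_lt_top hc (ENNReal.prod_lt_top fun i _ => ?_)
  change ∫⁻ x, (Icc (-R) R).indicator (fun _ => 1) x < ∞
  rw [lintegral_indicator_const measurableSet_Icc]
  simp

theorem lintegral_posMeasure {g : Space → ℝ} (hg : Measurable g) {F : Space → ℝ≥0∞}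
    (hF : Measurable F) :
    ∫⁻ y, F y ∂(posMeasure g) = ∫⁻ y, ENNReal.ofReal (g y) * F y := by
  rw [posMeasure, lintegral_withDensity_eq_lintegral_mul _ hg.ennreal_ofReal hF]
  rfl

theorem BoxBounded.isFiniteMeasure {M R : ℝ} {g : Space → ℝ} (hg : BoxBounded M R g) :
    IsFiniteMeasure (posMeasure g) := by
  refine isFiniteMeasure_withDensity (ne_of_lt ?_)
  exact (lintegral_mono hg.ofReal_le).trans_lt (lintegral_cube_lt_top ENNReal.ofReal_lt_top R)

theorem measurable_physMix (h : ℝ) : Measurable (physMix h) := by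
  unfold physMix
  exact Measurable.lintegral_prod_right (by fun_prop)

theorem setLIntegral_physMix_lt_top {h : ℝ} (hh : 1 / 2 < h ∧ h < 1) (R : ℝ) :
    ∫⁻ x in Icc (-R) R, physMix h x < ∞ := by
  have h1 := lintegral_rpow_max_lt_top (r := 2 * h - 2) (s := 2) (by linarith) (by linarith)
  have hle : ∫⁻ x in Icc (-R) R, physMix h x
      ≤ ∫⁻ x, ENNReal.ofReal (physConst h * max 1 |R| ^ (2 : ℝ))
        * ENNReal.ofReal (|x| ^ (2 * h - 2) * max 1 |x| ^ (-2 : ℝ)) := by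
    refine le_trans (setLIntegral_mono_ae' measurableSet_Icc ?_) (setLIntegral_le_lintegral _ _)
    filter_upwards [Measure.ae_ne volume 0] with x hx hxR
    rw [physMix_eq hh.2 hx, ← ENNReal.ofReal_mul
      (mul_nonneg (physConst_pos hh.2).le (by positivity))]
    refine ENNReal.ofReal_le_ofReal ?_
    rw [mul_assoc, mul_left_comm (max 1 |R| ^ (2 : ℝ))]
    refine mul_le_mul_of_nonneg_left ?_ (physConst_pos hh.2).le
    refine le_mul_of_one_le_right (by positivity) ?_
    have hpos : 0 < max 1 |x| := by positivity
    rw [Real.rpow_neg hpos.le, ← div_eq_mul_inv, one_le_div (by positivity)]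
    refine Real.rpow_le_rpow hpos.le (max_le_max le_rfl ?_) (by norm_num)
    exact (abs_le.2 hxR).trans (le_abs_self R)
  refine hle.trans_lt ?_
  rw [lintegral_const_mul' _ _ ENNReal.ofReal_ne_top]
  exact ENNReal.mul_lt_top ENNReal.ofReal_lt_top h1

/-- The bound depends on g only through M and R, so one constant serves all time slices of a test
function. Two points of the cube differ by at most 2R in each coordinate, and the mixtures are
integrable on such intervals. -/
theorem exists_energy_bound (hH : ∀ i, 1 / 2 < H i ∧ H i < 1) (M R : ℝ) :
    ∃ C : ℝ≥0∞, C < ∞ ∧ ∀ g : Space → ℝ, BoxBounded M R g →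
      ∫⁻ ξ, ‖charFun (posMeasure g) ξ‖ₑ ^ 2 ∂(specMeasure H) ≤ C := by
  set K : ℝ≥0∞ := ∏ i, ∫⁻ x in Icc (-(2 * R)) (2 * R), physMix (H i) x with hK
  have hKfin : K < ∞ := ENNReal.prod_lt_top fun i _ => setLIntegral_physMix_lt_top (hH i) _
  set V : ℝ≥0∞ := ∫⁻ y : Space, ENNReal.ofReal M * ∏ i, (Icc (-R) R).indicator 1 (y i) with hV
  have hVfin : V < ∞ := lintegral_cube_lt_top ENNReal.ofReal_lt_top R
  have hc : 0 < ∏ i, physConst (H i) := Finset.prod_pos fun i _ => physConst_pos (hH i).2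
  refine ⟨(ENNReal.ofReal (∏ i, physConst (H i)))⁻¹ * (V * (ENNReal.ofReal M * K)),
    ENNReal.mul_lt_top (by simpa using hc) (ENNReal.mul_lt_top hVfin
      (ENNReal.mul_lt_top ENNReal.ofReal_lt_top hKfin)), fun g hg => ?_⟩
  have := hg.isFiniteMeasure
  have hkm : Measurable fun p : Space × Space => ∏ i, physMix (H i) (p.1 i - p.2 i) :=
    Finset.measurable_prod _ fun i _ => (measurable_physMix (H i)).comp (by fun_prop)
  have hinner : ∀ y : Space, (∀ i, |y i| ≤ R) →
      ∫⁻ z, ∏ i, physMix (H i) (y i - z i) ∂(posMeasure g) ≤ ENNReal.ofReal M * K := fun y hy => by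
    have hym : Measurable fun z : Space => ∏ i, physMix (H i) (y i - z i) :=
      Finset.measurable_prod _ fun i _ => (measurable_physMix (H i)).comp (by fun_prop)
    rw [lintegral_posMeasure hg.meas hym]
    have h1 : ∀ z : Space, ENNReal.ofReal (g z) * ∏ i, physMix (H i) (y i - z i)
        ≤ ENNReal.ofReal M * ∏ i, ((Icc (-(2 * R)) (2 * R)).indicator (physMix (H i)) (y i - z i)) :=
      fun z => by
        by_cases h : g z = 0
        · simp [h]
        · refine mul_le_mul' (ENNReal.ofReal_le_ofReal ((le_abs_self _).trans (hg.bound z)))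
            (Finset.prod_le_prod' fun i _ => ?_)
          rw [indicator_of_mem]
          have h2 := abs_le.1 (hy i)
          have h3 := abs_le.1 (hg.support z h i)
          constructor <;> linarith [h2.1, h2.2, h3.1, h3.2]
    refine (lintegral_mono h1).trans (le_of_eq ?_)
    rw [lintegral_const_mul' _ _ ENNReal.ofReal_ne_top,
      lintegral_space_prod (fun i t => (Icc (-(2 * R)) (2 * R)).indicator (physMix (H i)) (y i - t))
      fun i => ((measurable_physMix (H i)).indicator measurableSet_Icc).comp (by fun_prop), hK]
    congr 1
    refine Finset.prod_congr rfl fun i _ => ?_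
    rw [lintegral_sub_left_eq_self (fun t => (Icc (-(2 * R)) (2 * R)).indicator (physMix (H i)) t),
      lintegral_indicator measurableSet_Icc]
  have htot : ∫⁻ p, ∏ i, physMix (H i) (p.1 i - p.2 i) ∂((posMeasure g).prod (posMeasure g))
      ≤ V * (ENNReal.ofReal M * K) := by
    rw [lintegral_prod _ hkm.aemeasurable]
    have hmm : Measurable fun y : Space => ∫⁻ z, ∏ i, physMix (H i) (y i - z i) ∂(posMeasure g) :=
      hkm.lintegral_prod_right'
    rw [lintegral_posMeasure hg.meas hmm, hV, ← lintegral_mul_const']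
    · refine lintegral_mono fun y => ?_
      by_cases h : g y = 0
      · simp [h]
      · exact mul_le_mul' (hg.ofReal_le y) (hinner y (hg.support y h))
    · exact (ENNReal.mul_lt_top ENNReal.ofReal_lt_top hKfin).ne
  rw [lintegral_physMix_eq hH] at htot
  rw [mul_comm, ← div_eq_mul_inv, ENNReal.le_div_iff_mul_le (by simp [hc]) (by simp), mul_comm]
  exact htot

theorem BoxBounded.finiteEnergy (hH : ∀ i, 1 / 2 < H i ∧ H i < 1) {M R : ℝ} {g : Space → ℝ}
    (hg : BoxBounded M R g) : FiniteEnergy H (posMeasure g) := by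
  have := hg.isFiniteMeasure
  obtain ⟨C, hC, h⟩ := exists_energy_bound hH M R
  exact (finiteEnergy_iff _).2 ((h g hg).trans_lt hC)

/-- A signed density is handled as the difference of two positive measures, to which the energy
identities apply. -/
theorem integral_mul_eq_sub {E : Type*} [NormedAddCommGroup E] [NormedSpace ℝ E] {g : Space → ℝ}
    (hg : Measurable g) {F : Space → E} (h1 : Integrable F (posMeasure g))
    (h2 : Integrable F (posMeasure fun y => -g y)) :
    ∫ y, g y • F y = ∫ y, F y ∂(posMeasure g) - ∫ y, F y ∂(posMeasure fun y => -g y) := by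
  have hlt : ∀ k : Space → ℝ, ∀ᵐ y : Space, ENNReal.ofReal (k y) < ∞ :=
    fun k => Eventually.of_forall fun y => ENNReal.ofReal_lt_top
  have m1 : Measurable fun y => ENNReal.ofReal (g y) := hg.ennreal_ofReal
  have m2 : Measurable fun y => ENNReal.ofReal (-g y) := hg.neg.ennreal_ofReal
  unfold posMeasure at *
  rw [integral_withDensity_eq_integral_toReal_smul m1 (hlt _),
    integral_withDensity_eq_integral_toReal_smul m2 (hlt _), ← integral_sub]
  · refine integral_congr_ae (Eventually.of_forall fun y => ?_)
    simp only [ENNReal.toReal_ofReal', ← sub_smul]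
    congr 1
    rcases le_total 0 (g y) with h | h <;> simp [h]
  · exact (integrable_withDensity_iff_integrable_smul' m1 (hlt _)).1 h1
  · exact (integrable_withDensity_iff_integrable_smul' m2 (hlt _)).1 h2

/-- Fourier transform of a signed density. -/
noncomputable def densityFourier (g : Space → ℝ) (ξ : Space) : ℂ :=
  ∫ y, g y • Complex.exp (⟪y, ξ⟫ * Complex.I)

theorem integrable_character (m : Measure Space) [IsFiniteMeasure m] (ξ : Space) :
    Integrable (fun y => Complex.exp (⟪y, ξ⟫ * Complex.I)) m := by
  refine Integrable.of_bound (by fun_prop) 1 (Eventually.of_forall fun p => ?_)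
  rw [Complex.norm_exp_ofReal_mul_I]

theorem BoxBounded.densityFourier_eq {M R : ℝ} {g : Space → ℝ} (hg : BoxBounded M R g) :
    densityFourier g = charFun (posMeasure g) - charFun (posMeasure fun y => -g y) := by
  have := hg.isFiniteMeasure
  have := hg.neg.isFiniteMeasure
  ext ξ
  exact integral_mul_eq_sub hg.meas (integrable_character _ ξ) (integrable_character _ ξ)

theorem BoxBounded.memLp (hH : ∀ i, 1 / 2 < H i ∧ H i < 1) {M R : ℝ} {g : Space → ℝ}
    (hg : BoxBounded M R g) : MemLp (densityFourier g) 2 (specMeasure H) := by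
  rw [hg.densityFourier_eq]
  exact MemLp.sub (hg.finiteEnergy hH) (hg.neg.finiteEnergy hH)

theorem BoxBounded.integral_cross_measure (hH : ∀ i, 1 / 2 < H i ∧ H i < 1) {M R : ℝ}
    {g : Space → ℝ} (hg : BoxBounded M R g) {γ : Measure Space} [IsFiniteMeasure γ]
    (hγ : FiniteEnergy H γ) :
    ∫ y, ∫ z, g y * fractionalKernel H (y - z) ∂γ
      = ∫ ξ, (densityFourier g ξ * conj (charFun γ ξ)).re ∂(specMeasure H) := by
  have := hg.isFiniteMeasure
  have := hg.neg.isFiniteMeasure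
  obtain ⟨i1, e1⟩ := (hg.finiteEnergy hH).integrable_cross hH hγ
  obtain ⟨i2, e2⟩ := (hg.neg.finiteEnergy hH).integrable_cross hH hγ
  simp_rw [integral_const_mul, ← smul_eq_mul]
  rw [integral_mul_eq_sub hg.meas i1.integral_prod_left i2.integral_prod_left,
    ← integral_prod _ i1, ← integral_prod _ i2, e1, e2, hg.densityFourier_eq,
    ← integral_sub (integrable_mul_conj (hg.finiteEnergy hH) hγ)
      (integrable_mul_conj (hg.neg.finiteEnergy hH) hγ)]
  simp only [Pi.sub_apply, sub_mul, Complex.sub_re, smul_eq_mul]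

theorem BoxBounded.integral_cross (hH : ∀ i, 1 / 2 < H i ∧ H i < 1) {M R M' R' : ℝ}
    {g g' : Space → ℝ} (hg : BoxBounded M R g) (hg' : BoxBounded M' R' g') :
    ∫ y, ∫ z, g y * fractionalKernel H (y - z) * g' z
      = ∫ ξ, (densityFourier g ξ * conj (densityFourier g' ξ)).re ∂(specMeasure H) := by
  have := hg.isFiniteMeasure
  have := hg.neg.isFiniteMeasure
  have := hg'.isFiniteMeasure
  have := hg'.neg.isFiniteMeasure
  have key : ∀ k : Space → ℝ, BoxBounded M R k →
      Integrable (fun y => ∫ z, g' z • fractionalKernel H (y - z)) (posMeasure k) ∧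
      ∫ y, (∫ z, g' z • fractionalKernel H (y - z)) ∂(posMeasure k)
        = ∫ ξ, (charFun (posMeasure k) ξ * conj (densityFourier g' ξ)).re ∂(specMeasure H) :=
    fun k hk => by
      have := hk.isFiniteMeasure
      obtain ⟨i1, e1⟩ := (hk.finiteEnergy hH).integrable_cross hH (hg'.finiteEnergy hH)
      obtain ⟨i2, e2⟩ := (hk.finiteEnergy hH).integrable_cross hH (hg'.neg.finiteEnergy hH)
      -- Integrability of the inner kernel in z is known from Fubini only for almost every y, so the
      -- splitting of g' is an almost-everywhere identity.
      have hae : (fun y => ∫ z, g' z • fractionalKernel H (y - z)) =ᵐ[posMeasure k]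
          fun y => ∫ z, fractionalKernel H (y - z) ∂(posMeasure g')
            - ∫ z, fractionalKernel H (y - z) ∂(posMeasure fun y => -g' y) := by
        filter_upwards [i1.prod_right_ae, i2.prod_right_ae] with y h1 h2
        exact integral_mul_eq_sub hg'.meas h1 h2
      refine ⟨(i1.integral_prod_left.sub i2.integral_prod_left).congr hae.symm, ?_⟩
      rw [integral_congr_ae hae, integral_sub i1.integral_prod_left i2.integral_prod_left,
        ← integral_prod _ i1, ← integral_prod _ i2, e1, e2, hg'.densityFourier_eq,
        ← integral_sub (integrable_mul_conj (hk.finiteEnergy hH) (hg'.finiteEnergy hH))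
          (integrable_mul_conj (hk.finiteEnergy hH) (hg'.neg.finiteEnergy hH))]
      simp only [Pi.sub_apply, mul_sub, map_sub, Complex.sub_re]
  obtain ⟨i1, e1⟩ := key g hg
  obtain ⟨i2, e2⟩ := key _ hg.neg
  have h1 : ∀ y, ∫ z, g y * fractionalKernel H (y - z) * g' z
      = g y • ∫ z, g' z • fractionalKernel H (y - z) := fun y => by
    rw [smul_eq_mul, ← integral_const_mul]
    refine integral_congr_ae (Eventually.of_forall fun z => ?_)
    simp only [smul_eq_mul]; ring
  simp_rw [h1]
  rw [integral_mul_eq_sub hg.meas i1 i2, e1, e2, hg.densityFourier_eq,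
    ← integral_sub (integrable_mul_conj (hg.finiteEnergy hH) (hg'.memLp hH))
      (integrable_mul_conj (hg.neg.finiteEnergy hH) (hg'.memLp hH))]
  simp only [Pi.sub_apply, sub_mul, Complex.sub_re]

theorem normSq_sub_expand (a b : ℂ) :
    ‖a - b‖ ^ 2 = (a * conj a).re - 2 * (a * conj b).re + (b * conj b).re := by
  rw [← Complex.normSq_eq_norm_sq, Complex.normSq_sub, Complex.mul_conj, Complex.mul_conj,
    Complex.ofReal_re, Complex.ofReal_re]
  ring

/-- The integrand of `sqDist` is a squared distance in the spectral `L²` space. -/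
theorem BoxBounded.sq_dist (hH : ∀ i, 1 / 2 < H i ∧ H i < 1) {M R : ℝ}
    {g : Space → ℝ} (hg : BoxBounded M R g) {γ : Measure Space} [IsFiniteMeasure γ]
    (hγ : FiniteEnergy H γ) :
    (∫ y, ∫ z, g y * fractionalKernel H (y - z) * g z)
      - 2 * (∫ y, ∫ z, g y * fractionalKernel H (y - z) ∂γ)
      + ∫ y, ∫ z, fractionalKernel H (y - z) ∂γ ∂γ
      = ∫ ξ, ‖densityFourier g ξ - charFun γ ξ‖ ^ 2 ∂(specMeasure H) := by
  obtain ⟨i1, e1⟩ := hγ.integrable_cross hH hγ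
  have j1 := integrable_mul_conj (hg.memLp hH) (hg.memLp hH)
  have j2 := (integrable_mul_conj (hg.memLp hH) hγ).const_mul 2
  have j3 := integrable_mul_conj hγ hγ
  have j4 : Integrable (fun ξ => (densityFourier g ξ * conj (densityFourier g ξ)).re
    - 2 * (densityFourier g ξ * conj (charFun γ ξ)).re) (specMeasure H) := j1.sub j2
  rw [hg.integral_cross hH hg, hg.integral_cross_measure hH hγ, ← integral_prod _ i1, e1,
    ← integral_const_mul, ← integral_sub j1 j2, ← integral_add j4 j3]
  refine integral_congr_ae (Eventually.of_forall fun ξ => ?_)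
  simp only [normSq_sub_expand]

end StochWave

/-! ### The Wiener isometry and Gaussian laws of increments -/

namespace StochWave

open scoped RealInnerProductSpace ComplexConjugate

section L2

variable {α E : Type*} [MeasurableSpace α] [NormedAddCommGroup E] {μ : Measure α}

theorem eLpNorm_two_eq_sqrt {f : α → E} (hf : MemLp f 2 μ) :
    eLpNorm f 2 μ = ENNReal.ofReal (√(∫ x, ‖f x‖ ^ 2 ∂μ)) := by
  rw [hf.eLpNorm_eq_integral_rpow_norm (by simp) (by simp), Real.sqrt_eq_rpow]
  simp

theorem tendsto_eLpNorm_of_tendsto_sub {f : ℕ → α → E} {g : α → E} (hf : ∀ n, MemLp (f n) 2 μ)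
    (hg : MemLp g 2 μ) (h : Tendsto (fun n => eLpNorm (f n - g) 2 μ) atTop (𝓝 0)) :
    Tendsto (fun n => eLpNorm (f n) 2 μ) atTop (𝓝 (eLpNorm g 2 μ)) := by
  have h1 : Tendsto (fun n => eLpNorm g 2 μ - eLpNorm (f n - g) 2 μ) atTop (𝓝 (eLpNorm g 2 μ)) := by
    have := ENNReal.Tendsto.sub (tendsto_const_nhds (x := eLpNorm g 2 μ)) h
      (Or.inl hg.eLpNorm_lt_top.ne)
    rwa [tsub_zero] at this
  have h2 : Tendsto (fun n => eLpNorm g 2 μ + eLpNorm (f n - g) 2 μ) atTop (𝓝 (eLpNorm g 2 μ)) := by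
    have := (tendsto_const_nhds (x := eLpNorm g 2 μ)).add h
    rwa [add_zero] at this
  refine tendsto_of_tendsto_of_tendsto_of_le_of_le h1 h2 (fun n => ?_) (fun n => ?_)
  · refine tsub_le_iff_right.2 ?_
    have := eLpNorm_sub_le (p := 2) (hf n).1 ((hf n).sub hg).1 (by norm_num)
    simpa using this
  · have := eLpNorm_add_le (p := 2) hg.1 ((hf n).sub hg).1 (by norm_num)
    simpa using this

theorem tendsto_eLpNorm_sub_sub {a b : ℕ → α → E} {a' b' : α → E}
    (ha : ∀ n, MemLp (a n) 2 μ) (hb : ∀ n, MemLp (b n) 2 μ) (ha' : MemLp a' 2 μ)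
    (hb' : MemLp b' 2 μ) (h : Tendsto (fun n => eLpNorm (a n - a') 2 μ) atTop (𝓝 0))
    (h' : Tendsto (fun n => eLpNorm (b n - b') 2 μ) atTop (𝓝 0)) :
    Tendsto (fun n => eLpNorm ((a n - b n) - (a' - b')) 2 μ) atTop (𝓝 0) := by
  have h3 := h.add h'
  rw [add_zero] at h3
  refine tendsto_of_tendsto_of_tendsto_of_le_of_le tendsto_const_nhds h3 (fun n => zero_le)
    (fun n => ?_)
  rw [sub_sub_sub_comm]
  exact eLpNorm_sub_le ((ha n).sub ha').1 ((hb n).sub hb').1 (by norm_num)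

end L2

/-- L² convergence gives convergence of the second moments and, along a subsequence, almost sure
convergence. Characteristic functions then converge by domination, and the limit is the Gaussian
one; a zero limiting variance is allowed. -/
theorem map_eq_gaussianReal_of_tendsto {Ω : Type*} [MeasurableSpace Ω] {P : Measure Ω}
    [IsProbabilityMeasure P] {Y : ℕ → Ω → ℝ} {Z : Ω → ℝ} (hY : ∀ n, MemLp (Y n) 2 P)
    (hZ : MemLp Z 2 P)
    (hlaw : ∀ n, P.map (Y n) = gaussianReal 0 (∫ ω, ‖Y n ω‖ ^ 2 ∂P).toNNReal)
    (h : Tendsto (fun n => eLpNorm (Y n - Z) 2 P) atTop (𝓝 0)) :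
    P.map Z = gaussianReal 0 (∫ ω, ‖Z ω‖ ^ 2 ∂P).toNNReal := by
  have hvar : Tendsto (fun n => ∫ ω, ‖Y n ω‖ ^ 2 ∂P) atTop (𝓝 (∫ ω, ‖Z ω‖ ^ 2 ∂P)) := by
    have h1 := tendsto_eLpNorm_of_tendsto_sub hY hZ h
    simp_rw [eLpNorm_two_eq_sqrt (hY _), eLpNorm_two_eq_sqrt hZ] at h1
    have h2 := (ENNReal.tendsto_toReal ENNReal.ofReal_ne_top).comp h1
    have h3 := h2.pow 2
    simp only [Function.comp_def, ENNReal.toReal_ofReal (Real.sqrt_nonneg _)] at h3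
    simp_rw [Real.sq_sqrt (integral_nonneg fun ω => sq_nonneg ‖Z ω‖),
      Real.sq_sqrt (integral_nonneg fun ω => sq_nonneg ‖Y _ ω‖)] at h3
    exact h3
  obtain ⟨ns, hns, hae⟩ := (tendstoInMeasure_of_tendsto_eLpNorm (p := 2) (by norm_num)
    (fun n => (hY n).1) hZ.1 h).exists_seq_tendsto_ae
  have : IsProbabilityMeasure (P.map Z) := Measure.isProbabilityMeasure_map hZ.1.aemeasurable
  refine Measure.ext_of_charFun (funext fun t => ?_)
  have hc1 : Tendsto (fun k => charFun (P.map (Y (ns k))) t) atTop (𝓝 (charFun (P.map Z) t)) := by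
    simp_rw [charFun_apply_real]
    rw [integral_map hZ.1.aemeasurable (by fun_prop)]
    simp_rw [fun k => integral_map (hY (ns k)).1.aemeasurable (f := fun x : ℝ =>
      Complex.exp (t * x * Complex.I)) (by fun_prop)]
    refine tendsto_integral_of_dominated_convergence (fun _ => 1) (fun k => ?_)
      (integrable_const 1) (fun k => Eventually.of_forall fun ω => ?_) ?_
    · exact Continuous.comp_aestronglyMeasurable
        (g := fun x : ℝ => Complex.exp (t * x * Complex.I)) (by fun_prop) (hY (ns k)).1
    · rw [← Complex.ofReal_mul, Complex.norm_exp_ofReal_mul_I]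
    · filter_upwards [hae] with ω hω
      have : Continuous fun x : ℝ => Complex.exp (t * x * Complex.I) := by fun_prop
      exact (this.tendsto _).comp hω
  refine tendsto_nhds_unique hc1 ?_
  simp_rw [hlaw, charFun_gaussianReal]
  have hc2 : Continuous fun v : ℝ =>
      Complex.exp (t * (0 : ℝ) * Complex.I - ((v.toNNReal : ℝ) : ℂ) * t ^ 2 / 2) := by fun_prop
  exact (hc2.tendsto _).comp (hvar.comp hns.tendsto_atTop)

variable {H : Fin 3 → ℝ} {T : ℝ}

theorem exists_boxBounded (φ : SpaceTimeTest) :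
    ∃ M R : ℝ, ∀ s, BoxBounded M R fun y => φ (s, y) := by
  obtain ⟨M, hM⟩ := φ.continuous.bounded_above_of_compact_support φ.hasCompactSupport
  obtain ⟨R, hR⟩ := φ.hasCompactSupport.isCompact.isBounded.exists_norm_le
  refine ⟨M, R, fun s => ⟨by fun_prop, fun y => hM _, fun y hy i => ?_⟩⟩
  have h1 := hR (s, y) (subset_tsupport _ hy)
  exact (PiLp.norm_apply_le y i).trans ((norm_snd_le (s, y)).trans h1)

/-- Spatial Fourier transform of a test function. -/
noncomputable def testFourier (φ : SpaceTimeTest) (p : ℝ × Space) : ℂ :=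
  densityFourier (fun y => φ (p.1, y)) p.2

theorem stronglyMeasurable_testFourier (φ : SpaceTimeTest) :
    StronglyMeasurable (testFourier φ) := by
  unfold testFourier densityFourier
  refine StronglyMeasurable.integral_prod_right' (f := fun q : (ℝ × Space) × Space =>
    φ (q.1.1, q.2) • Complex.exp (⟪q.2, q.1.2⟫ * Complex.I)) ?_
  refine Continuous.stronglyMeasurable ?_
  fun_prop

/-- Lebesgue measure on `(0,T]` times the spectral measure. -/
noncomputable def spaceTimeMeasure (H : Fin 3 → ℝ) (T : ℝ) : Measure (ℝ × Space) :=
  (volume.restrict (Ioc 0 T)).prod (specMeasure H)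

/-- The positive and negative parts of every time slice have uniformly bounded energy, and the time
interval has finite length. -/
theorem memLp_testFourier (hH : ∀ i, 1 / 2 < H i ∧ H i < 1) (φ : SpaceTimeTest) :
    MemLp (testFourier φ) 2 (spaceTimeMeasure H T) := by
  obtain ⟨M, R, hb⟩ := exists_boxBounded φ
  obtain ⟨C, hC, hbound⟩ := exists_energy_bound hH M R
  refine ⟨(stronglyMeasurable_testFourier φ).aestronglyMeasurable, ?_⟩
  rw [eLpNorm_lt_top_iff_lintegral_rpow_enorm_lt_top (by simp) (by simp)]
  simp only [ENNReal.toReal_ofNat, ENNReal.rpow_ofNat]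
  rw [spaceTimeMeasure, lintegral_prod _
    ((stronglyMeasurable_testFourier φ).measurable.enorm.pow_const 2).aemeasurable]
  have hs : ∀ s, ∫⁻ ξ, ‖testFourier φ (s, ξ)‖ₑ ^ 2 ∂(specMeasure H) ≤ 2 * (C + C) := fun s => by
    have := (hb s).isFiniteMeasure
    have := (hb s).neg.isFiniteMeasure
    have hm : ∀ m : Measure Space, [IsFiniteMeasure m] →
        Measurable fun ξ : Space => ‖charFun m ξ‖ₑ ^ 2 := fun m _ =>
      (continuous_charFun (μ := m)).measurable.enorm.pow_const 2
    calc ∫⁻ ξ, ‖testFourier φ (s, ξ)‖ₑ ^ 2 ∂(specMeasure H)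
        ≤ ∫⁻ ξ, 2 * (‖charFun (posMeasure fun y => φ (s, y)) ξ‖ₑ ^ 2
            + ‖charFun (posMeasure fun y => -φ (s, y)) ξ‖ₑ ^ 2) ∂(specMeasure H) := by
          refine lintegral_mono fun ξ => ?_
          have h1 : testFourier φ (s, ξ) = charFun (posMeasure fun y => φ (s, y)) ξ
              - charFun (posMeasure fun y => -φ (s, y)) ξ := congrFun (hb s).densityFourier_eq ξ
          rw [h1]
          refine (pow_le_pow_left' enorm_sub_le 2).trans ?_
          have := ENNReal.rpow_add_le_mul_rpow_add_rpow
            ‖charFun (posMeasure fun y => φ (s, y)) ξ‖ₑ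
            ‖charFun (posMeasure fun y => -φ (s, y)) ξ‖ₑ (p := 2) (by norm_num)
          norm_num at this
          exact this
      _ ≤ 2 * (C + C) := by
          rw [lintegral_const_mul' _ _ (by simp), lintegral_add_left (hm _)]
          gcongr
          · exact hbound _ (hb s)
          · exact hbound _ (hb s).neg
  refine (lintegral_mono hs).trans_lt ?_
  rw [lintegral_const]
  refine ENNReal.mul_lt_top (ENNReal.mul_lt_top (by simp) (ENNReal.add_lt_top.2 ⟨hC, hC⟩)) ?_
  simp

theorem integrable_re_mul_conj {α : Type*} [MeasurableSpace α] {μ : Measure α} {a b : α → ℂ}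
    (ha : MemLp a 2 μ) (hb : MemLp b 2 μ) : Integrable (fun ξ => (a ξ * conj (b ξ)).re) μ :=
  (ha.integrable_mul hb.star).re

theorem testCov_eq (hH : ∀ i, 1 / 2 < H i ∧ H i < 1) (hT : 0 < T) (φ ψ : SpaceTimeTest) :
    testCov (fractionalKernel H) T φ ψ
      = ∫ p, (testFourier φ p * conj (testFourier ψ p)).re ∂(spaceTimeMeasure H T) := by
  obtain ⟨M, R, hb⟩ := exists_boxBounded φ
  obtain ⟨M', R', hb'⟩ := exists_boxBounded ψ
  rw [testCov, intervalIntegral.integral_of_le hT.le, spaceTimeMeasure, integral_prod]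
  · refine integral_congr_ae (Eventually.of_forall fun s => ?_)
    exact (hb s).integral_cross hH (hb' s)
  · exact integrable_re_mul_conj (memLp_testFourier hH φ) (memLp_testFourier hH ψ)

/-- `G` is the spatial Fourier transform of the measure-valued path `Γ`, square integrable. -/
structure IsPathFourier (H : Fin 3 → ℝ) (T : ℝ) (Γ : ℝ → Measure Space) (G : ℝ × Space → ℂ) :
    Prop where
  finite : ∀ s ∈ Ioc 0 T, IsFiniteMeasure (Γ s)
  charFun_eq : ∀ s ∈ Ioc 0 T, ∀ ξ, charFun (Γ s) ξ = G (s, ξ)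
  energy : ∀ s ∈ Ioc 0 T, FiniteEnergy H (Γ s)
  memLp : MemLp G 2 (spaceTimeMeasure H T)

theorem IsPathFourier.sqDist_eq (hH : ∀ i, 1 / 2 < H i ∧ H i < 1) (hT : 0 < T)
    {Γ : ℝ → Measure Space} {G : ℝ × Space → ℂ} (hG : IsPathFourier H T Γ G) (φ : SpaceTimeTest) :
    sqDist (fractionalKernel H) T φ Γ
      = ∫ p, ‖(testFourier φ - G) p‖ ^ 2 ∂(spaceTimeMeasure H T) := by
  obtain ⟨M, R, hb⟩ := exists_boxBounded φ
  rw [sqDist, intervalIntegral.integral_of_le hT.le, spaceTimeMeasure, integral_prod]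
  · refine setIntegral_congr_fun measurableSet_Ioc fun s hs => ?_
    have := hG.finite s hs
    refine ((hb s).sq_dist hH (hG.energy s hs)).trans ?_
    simp only [hG.charFun_eq s hs]
    rfl
  · exact MemLp.integrable_norm_pow ((memLp_testFourier hH φ).sub hG.memLp) two_ne_zero

theorem IsPathFourier.tendsto (hH : ∀ i, 1 / 2 < H i ∧ H i < 1) (hT : 0 < T)
    {Γ : ℝ → Measure Space} {G : ℝ × Space → ℂ} (hG : IsPathFourier H T Γ G)
    {φ : ℕ → SpaceTimeTest}
    (h : Tendsto (fun n => sqDist (fractionalKernel H) T (φ n) Γ) atTop (𝓝 0)) :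
    Tendsto (fun n => eLpNorm (testFourier (φ n) - G) 2 (spaceTimeMeasure H T)) atTop (𝓝 0) := by
  simp_rw [eLpNorm_two_eq_sqrt ((memLp_testFourier hH _).sub hG.memLp), ← hG.sqDist_eq hH hT]
  have hc : Continuous fun x : ℝ => ENNReal.ofReal (√x) :=
    ENNReal.continuous_ofReal.comp Real.continuous_sqrt
  have := (hc.tendsto 0).comp h
  simpa [Function.comp_def] using this

variable {Ω : Type*} [MeasurableSpace Ω] {P : Measure Ω} {W : SpaceTimeTest → Ω → ℝ}

theorem IsNoise.eLpNorm_sub (hH : ∀ i, 1 / 2 < H i ∧ H i < 1) (hT : 0 < T)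
    (hW : IsNoise (fractionalKernel H) T W P) (φ ψ : SpaceTimeTest) :
    eLpNorm (W φ - W ψ) 2 P
      = eLpNorm (testFourier φ - testFourier ψ) 2 (spaceTimeMeasure H T) := by
  have hm : ∀ φ, MemLp (W φ) 2 P := fun φ => (hW.gaussian.hasGaussianLaw_eval φ).memLp_two
  have hF : ∀ φ, MemLp (testFourier φ) 2 (spaceTimeMeasure H T) := memLp_testFourier hH
  have j1 := integrable_re_mul_conj (hF φ) (hF φ)
  have j2 := (integrable_re_mul_conj (hF φ) (hF ψ)).const_mul 2
  have j3 := integrable_re_mul_conj (hF ψ) (hF ψ)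
  have j4 : Integrable (fun p => (testFourier φ p * conj (testFourier φ p)).re
    - 2 * (testFourier φ p * conj (testFourier ψ p)).re) (spaceTimeMeasure H T) := j1.sub j2
  have k1 : Integrable (fun ω => W φ ω * W φ ω) P := (hm φ).integrable_mul (hm φ)
  have k2 : Integrable (fun ω => 2 * (W φ ω * W ψ ω)) P :=
    ((hm φ).integrable_mul (hm ψ)).const_mul 2
  have k3 : Integrable (fun ω => W ψ ω * W ψ ω) P := (hm ψ).integrable_mul (hm ψ)
  have k4 : Integrable (fun ω => W φ ω * W φ ω - 2 * (W φ ω * W ψ ω)) P := k1.sub k2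
  have e1 : ∫ ω, ‖(W φ - W ψ) ω‖ ^ 2 ∂P
      = ∫ ω, (W φ ω * W φ ω - 2 * (W φ ω * W ψ ω) + W ψ ω * W ψ ω) ∂P := by
    refine integral_congr_ae (Eventually.of_forall fun ω => ?_)
    simp only [Pi.sub_apply, Real.norm_eq_abs, sq_abs]
    ring
  rw [eLpNorm_two_eq_sqrt ((hm φ).sub (hm ψ)), eLpNorm_two_eq_sqrt ((hF φ).sub (hF ψ)), e1,
    integral_add k4 k3, integral_sub k1 k2, integral_const_mul, hW.covariance, hW.covariance,
    hW.covariance, testCov_eq hH hT, testCov_eq hH hT, testCov_eq hH hT, ← integral_const_mul,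
    ← integral_sub j1 j2, ← integral_add j4 j3]
  simp only [Pi.sub_apply, normSq_sub_expand]

theorem IsNoise.map_sub (hW : IsNoise (fractionalKernel H) T W P) (φ ψ : SpaceTimeTest) :
    P.map (W φ - W ψ) = gaussianReal 0 (∫ ω, ‖(W φ - W ψ) ω‖ ^ 2 ∂P).toNNReal := by
  have hi : ∀ φ, Integrable (W φ) P := fun φ => (hW.gaussian.hasGaussianLaw_eval φ).integrable
  have hm := (hW.gaussian.hasGaussianLaw_sub (s := φ) (t := ψ))
  have h0 : ∫ ω, (W φ - W ψ) ω ∂P = 0 := by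
    simp only [Pi.sub_apply]
    rw [integral_sub (hi φ) (hi ψ), hW.centered, hW.centered, sub_zero]
  rw [hm.map_eq_gaussianReal, h0, variance_of_integral_eq_zero hm.aemeasurable h0]
  simp only [Real.norm_eq_abs, sq_abs]

/-- The isometry for differences of stochastic integrals, and their Gaussian law. -/
theorem IsStochIntegral.sub [IsProbabilityMeasure P] (hH : ∀ i, 1 / 2 < H i ∧ H i < 1)
    (hT : 0 < T) (hW : IsNoise (fractionalKernel H) T W P) {Γ Γ' : ℝ → Measure Space}
    {G G' : ℝ × Space → ℂ} (hG : IsPathFourier H T Γ G) (hG' : IsPathFourier H T Γ' G')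
    {X X' : Ω → ℝ} (hX : IsStochIntegral (fractionalKernel H) T W P Γ X)
    (hX' : IsStochIntegral (fractionalKernel H) T W P Γ' X') :
    ∫ ω, ‖(X - X') ω‖ ^ 2 ∂P = ∫ p, ‖(G - G') p‖ ^ 2 ∂(spaceTimeMeasure H T) ∧
    P.map (X - X') = gaussianReal 0 (∫ ω, ‖(X - X') ω‖ ^ 2 ∂P).toNNReal := by
  obtain ⟨hXm, φ, hφ, hφX⟩ := hX
  obtain ⟨hXm', ψ, hψ, hψX⟩ := hX'
  have hm : ∀ φ, MemLp (W φ) 2 P := fun φ => (hW.gaussian.hasGaussianLaw_eval φ).memLp_two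
  have hF : ∀ φ, MemLp (testFourier φ) 2 (spaceTimeMeasure H T) := memLp_testFourier hH
  have t1 := tendsto_eLpNorm_sub_sub (fun n => hF (φ n)) (fun n => hF (ψ n)) hG.memLp hG'.memLp
    (hG.tendsto hH hT hφ) (hG'.tendsto hH hT hψ)
  have t2 := tendsto_eLpNorm_sub_sub (fun n => hm (φ n)) (fun n => hm (ψ n)) hXm hXm' hφX hψX
  have t3 := tendsto_eLpNorm_of_tendsto_sub (fun n => (hF (φ n)).sub (hF (ψ n)))
    (hG.memLp.sub hG'.memLp) t1
  have t4 := tendsto_eLpNorm_of_tendsto_sub (fun n => (hm (φ n)).sub (hm (ψ n)))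
    (hXm.sub hXm') t2
  -- The approximants have equal norms in L²(P) and in spectral L². Both sequences converge, so
  -- uniqueness of limits carries the isometry over to X - X'.
  simp_rw [hW.eLpNorm_sub hH hT] at t4
  have e := tendsto_nhds_unique t4 t3
  rw [eLpNorm_two_eq_sqrt (hXm.sub hXm'), eLpNorm_two_eq_sqrt (hG.memLp.sub hG'.memLp),
    ENNReal.ofReal_eq_ofReal_iff (Real.sqrt_nonneg _) (Real.sqrt_nonneg _),
    Real.sqrt_inj (integral_nonneg fun _ => by positivity)
      (integral_nonneg fun _ => by positivity)] at e
  exact ⟨e, map_eq_gaussianReal_of_tendsto (fun n => (hm (φ n)).sub (hm (ψ n))) (hXm.sub hXm')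
    (fun n => hW.map_sub _ _) t2⟩

end StochWave

/-! ### Scaling of spectral integrals -/

namespace StochWave

open scoped RealInnerProductSpace ComplexConjugate

variable {H : Fin 3 → ℝ} {κ : ℝ}

/-- The common majorant of the spectral increments. -/
noncomputable def cutoff (δ : ℝ) (ξ : Space) : ℝ := min (δ ^ 2) (4 / ‖ξ‖ ^ 2)

theorem cutoff_nonneg (δ : ℝ) (ξ : Space) : 0 ≤ cutoff δ ξ := le_min (sq_nonneg _) (by positivity)

theorem measurable_cutoff (δ : ℝ) : Measurable (cutoff δ) := by
  unfold cutoff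
  fun_prop

theorem specDensity_nonneg (hH : ∀ i, 1 / 2 < H i ∧ H i < 1) (ξ : Space) : 0 ≤ specDensity H ξ :=
  mul_nonneg (Finset.prod_nonneg fun i _ =>
    (div_pos (specConst_pos (hH i).1) (physConst_pos (hH i).2)).le)
    (Finset.prod_nonneg fun i _ => by positivity)

theorem specDensity_pos (hH : ∀ i, 1 / 2 < H i ∧ H i < 1) {ξ : Space} (hξ : ∀ i, ξ i ≠ 0) :
    0 < specDensity H ξ :=
  mul_pos (Finset.prod_pos fun i _ =>
    (div_pos (specConst_pos (hH i).1) (physConst_pos (hH i).2)))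
    (Finset.prod_pos fun i _ => Real.rpow_pos_of_pos (abs_pos.2 (hξ i)) _)

/-- The decay |ξ|⁻² is shared among the coordinates with exponents 2(1 - Hᵢ + κ/3), which add up to
2 because ∑Hᵢ = 2 + κ. The surplus κ/3 secures integrability at infinity in each coordinate. -/
theorem cutoff_one_le (hκ : κ = H 0 + H 1 + H 2 - 2) (hH : ∀ i, 1 / 2 < H i ∧ H i < 1)
    (hκ0 : 0 < κ) (ξ : Space) :
    cutoff 1 ξ ≤ 4 * ∏ i, max 1 |ξ i| ^ (-(2 * (1 - H i + κ / 3))) := by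
  have hm : 1 ≤ max 1 ‖ξ‖ := le_max_left _ _
  have h1 : cutoff 1 ξ ≤ 4 * max 1 ‖ξ‖ ^ (-2 : ℝ) := by
    rw [cutoff, Real.rpow_neg (by positivity), Real.rpow_two, ← div_eq_mul_inv]
    rcases le_total 1 ‖ξ‖ with h | h
    · rw [max_eq_right h]; exact min_le_right _ _
    · rw [max_eq_left h]
      refine (min_le_left _ _).trans (by norm_num)
  refine h1.trans ?_
  have h2 : max 1 ‖ξ‖ ^ (-2 : ℝ) = ∏ i, max 1 ‖ξ‖ ^ (-(2 * (1 - H i + κ / 3))) := by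
    rw [← Real.rpow_sum_of_pos (by positivity), Fin.sum_univ_three]
    congr 1
    rw [hκ]; ring
  rw [h2]
  refine mul_le_mul_of_nonneg_left (Finset.prod_le_prod (fun i _ => by positivity) fun i _ => ?_)
    (by norm_num)
  refine Real.rpow_le_rpow_of_nonpos (by positivity) (max_le_max le_rfl ?_) ?_
  · exact PiLp.norm_apply_le ξ i
  · have := (hH i).2
    linarith

/-- In each coordinate the majorant is |ξᵢ|^(1-2Hᵢ) near 0, integrable since Hᵢ < 1, and
|ξᵢ|^(-1-2κ/3) at infinity, integrable since κ > 0. -/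
theorem integrable_cutoff_one (hκ : κ = H 0 + H 1 + H 2 - 2) (hH : ∀ i, 1 / 2 < H i ∧ H i < 1)
    (hκ0 : 0 < κ) : Integrable (cutoff 1) (specMeasure H) := by
  refine ⟨(measurable_cutoff 1).aestronglyMeasurable, ?_⟩
  rw [hasFiniteIntegral_iff_ofReal (Eventually.of_forall (cutoff_nonneg 1)), specMeasure,
    lintegral_withDensity_eq_lintegral_mul _ (measurable_specDensity H).ennreal_ofReal
      (measurable_cutoff 1).ennreal_ofReal]
  set c : ℝ := ∏ i, specConst (H i) / physConst (H i) with hc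
  have hc0 : 0 ≤ c := Finset.prod_nonneg fun i _ =>
    (div_pos (specConst_pos (hH i).1) (physConst_pos (hH i).2)).le
  have hle : ∀ ξ : Space, ENNReal.ofReal (specDensity H ξ) * ENNReal.ofReal (cutoff 1 ξ)
      ≤ ENNReal.ofReal (c * 4) * ∏ i, ENNReal.ofReal (|ξ i| ^ (1 - 2 * H i)
        * max 1 |ξ i| ^ (-(2 * (1 - H i + κ / 3)))) := fun ξ => by
    rw [← ENNReal.ofReal_mul (specDensity_nonneg hH ξ),
      ← ENNReal.ofReal_prod_of_nonneg (fun i _ => by positivity),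
      ← ENNReal.ofReal_mul (by positivity), Finset.prod_mul_distrib]
    refine ENNReal.ofReal_le_ofReal ?_
    rw [specDensity, ← hc]
    have h1 := cutoff_one_le hκ hH hκ0 ξ
    have h2 : 0 ≤ c * ∏ i, |ξ i| ^ (1 - 2 * H i) :=
      mul_nonneg hc0 (Finset.prod_nonneg fun i _ => by positivity)
    calc _ ≤ c * (∏ i, |ξ i| ^ (1 - 2 * H i))
          * (4 * ∏ i, max 1 |ξ i| ^ (-(2 * (1 - H i + κ / 3)))) :=
          mul_le_mul_of_nonneg_left h1 h2
      _ = _ := by ring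
  refine (lintegral_mono hle).trans_lt ?_
  rw [lintegral_const_mul' _ _ ENNReal.ofReal_ne_top, lintegral_space_prod (fun i t =>
    ENNReal.ofReal (|t| ^ (1 - 2 * H i) * max 1 |t| ^ (-(2 * (1 - H i + κ / 3)))))
    (fun i => by fun_prop)]
  refine ENNReal.mul_lt_top ENNReal.ofReal_lt_top (ENNReal.prod_lt_top fun i _ => ?_)
  refine lintegral_rpow_max_lt_top ?_ ?_
  · linarith [(hH i).2]
  · linarith

theorem integrable_cutoff (hκ : κ = H 0 + H 1 + H 2 - 2) (hH : ∀ i, 1 / 2 < H i ∧ H i < 1)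
    (hκ0 : 0 < κ) (δ : ℝ) : Integrable (cutoff δ) (specMeasure H) := by
  refine ((integrable_cutoff_one hκ hH hκ0).const_mul (max 1 (δ ^ 2))).mono'
    (measurable_cutoff δ).aestronglyMeasurable (Eventually.of_forall fun ξ => ?_)
  rw [Real.norm_of_nonneg (cutoff_nonneg _ _), cutoff, cutoff]
  have h4 : 0 ≤ 4 / ‖ξ‖ ^ 2 := by positivity
  rcases le_total (1 ^ 2) (4 / ‖ξ‖ ^ 2) with h | h
  · rw [min_eq_left h]
    refine (min_le_left _ _).trans ?_
    simp
  · rw [min_eq_right h]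
    exact (min_le_right _ _).trans (le_mul_of_one_le_left h4 (le_max_left _ _))

theorem specDensity_smul (hκ : κ = H 0 + H 1 + H 2 - 2) {δ : ℝ} (hδ : 0 < δ) (ξ : Space) :
    specDensity H ξ = δ ^ (2 * κ + 1) * specDensity H (δ • ξ) := by
  have h1 : ∀ i, |(δ • ξ) i| ^ (1 - 2 * H i) = δ ^ (1 - 2 * H i) * |ξ i| ^ (1 - 2 * H i) :=
    fun i => by
      rw [PiLp.smul_apply, smul_eq_mul, abs_mul, abs_of_pos hδ,
        Real.mul_rpow hδ.le (abs_nonneg _)]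
  simp only [specDensity, h1, Finset.prod_mul_distrib]
  rw [← Real.rpow_sum_of_pos hδ, mul_left_comm (δ ^ (2 * κ + 1)), ← mul_assoc (δ ^ (2 * κ + 1)),
    ← Real.rpow_add hδ, Fin.sum_univ_three]
  have : 2 * κ + 1 + (1 - 2 * H 0 + (1 - 2 * H 1) + (1 - 2 * H 2)) = 0 := by rw [hκ]; ring
  rw [this, Real.rpow_zero, one_mul]

theorem integral_specMeasure (hH : ∀ i, 1 / 2 < H i ∧ H i < 1) (F : Space → ℝ) :
    ∫ ξ, F ξ ∂(specMeasure H) = ∫ ξ, specDensity H ξ * F ξ := by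
  rw [specMeasure, integral_withDensity_eq_integral_toReal_smul
    (measurable_specDensity H).ennreal_ofReal (Eventually.of_forall fun _ => ENNReal.ofReal_lt_top)]
  simp only [ENNReal.toReal_ofReal (specDensity_nonneg hH _), smul_eq_mul]

/-- The origin of the exponent 2κ: homogeneity contributes δ^(2κ+1), the Jacobian δ⁻³, and the
prefactor δ². -/
theorem integral_specMeasure_scale (hκ : κ = H 0 + H 1 + H 2 - 2)
    (hH : ∀ i, 1 / 2 < H i ∧ H i < 1) {δ : ℝ} (hδ : 0 < δ) (F : Space → ℝ) :
    ∫ ξ, δ ^ 2 * F (δ • ξ) ∂(specMeasure H) = δ ^ (2 * κ) * ∫ ξ, F ξ ∂(specMeasure H) := by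
  have h1 := Measure.integral_comp_smul (volume : Measure Space) (fun ξ => specDensity H ξ * F ξ) δ
  have h2 : δ ^ (2 * κ + 1) = δ ^ (2 * κ) * δ := by rw [Real.rpow_add hδ, Real.rpow_one]
  rw [integral_const_mul, integral_specMeasure hH, integral_specMeasure hH]
  have h3 : ∀ ξ, specDensity H ξ * F (δ • ξ)
      = δ ^ (2 * κ + 1) * (specDensity H (δ • ξ) * F (δ • ξ)) := fun ξ => by
    rw [specDensity_smul hκ hδ ξ, mul_assoc]
  simp_rw [h3]
  rw [integral_const_mul, h1]
  simp only [finrank_euclideanSpace, Fintype.card_fin, smul_eq_mul]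
  rw [abs_of_pos (by positivity), h2]
  field_simp

theorem cutoff_scale {δ : ℝ} (hδ : 0 < δ) (ξ : Space) :
    cutoff δ ξ = δ ^ 2 * cutoff 1 (δ • ξ) := by
  rw [cutoff, cutoff, mul_min_of_nonneg _ _ (sq_nonneg δ), norm_smul, Real.norm_of_nonneg hδ.le]
  congr 1
  · ring
  · by_cases h : ‖ξ‖ = 0
    · rw [h]; norm_num
    · field_simp

theorem integral_cutoff (hκ : κ = H 0 + H 1 + H 2 - 2)
    (hH : ∀ i, 1 / 2 < H i ∧ H i < 1) {δ : ℝ} (hδ : 0 < δ) :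
    ∫ ξ, cutoff δ ξ ∂(specMeasure H) = δ ^ (2 * κ) * ∫ ξ, cutoff 1 ξ ∂(specMeasure H) := by
  simp_rw [cutoff_scale hδ]
  exact integral_specMeasure_scale hκ hH hδ _

/-- Spectral integral controlling increments from below. -/
noncomputable def lowerIntegral (H : Fin 3 → ℝ) (M : ℝ) (q : Space → ℝ) : ℝ :=
  ∫ ξ, {ξ : Space | M ≤ ‖ξ‖}.indicator (fun ξ => 4 * Real.sin (q ξ / 2) ^ 2 / ‖ξ‖ ^ 2) ξ
    ∂(specMeasure H)

theorem measurableSet_norm_ge (M : ℝ) : MeasurableSet {ξ : Space | M ≤ ‖ξ‖} :=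
  measurableSet_le measurable_const measurable_norm

theorem lowerIntegrand_nonneg (M : ℝ) (q : Space → ℝ) (ξ : Space) :
    0 ≤ {ξ : Space | M ≤ ‖ξ‖}.indicator (fun ξ => 4 * Real.sin (q ξ / 2) ^ 2 / ‖ξ‖ ^ 2) ξ :=
  indicator_nonneg (fun ξ _ => by positivity) ξ

/-- M ≥ 2 makes 4/|ξ|² at most 1 on the region of integration, so `cutoff 1` dominates. -/
theorem lowerIntegrand_le {M : ℝ} (hM : 2 ≤ M) (q : Space → ℝ) (ξ : Space) :
    {ξ : Space | M ≤ ‖ξ‖}.indicator (fun ξ => 4 * Real.sin (q ξ / 2) ^ 2 / ‖ξ‖ ^ 2) ξ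
      ≤ cutoff 1 ξ := by
  refine indicator_le' (fun ξ hξ => ?_) (fun ξ _ => cutoff_nonneg 1 ξ) ξ
  have hξ : M ≤ ‖ξ‖ := hξ
  have h2 : (2 : ℝ) ≤ ‖ξ‖ := hM.trans hξ
  have h3 : Real.sin (q ξ / 2) ^ 2 ≤ 1 := Real.sin_sq_le_one _
  have h4 : 4 * Real.sin (q ξ / 2) ^ 2 / ‖ξ‖ ^ 2 ≤ 4 / ‖ξ‖ ^ 2 := by
    gcongr
    linarith
  refine le_min (h4.trans ?_) h4
  rw [div_le_iff₀ (by positivity)]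
  nlinarith

theorem measurable_lowerIntegrand (M : ℝ) {q : Space → ℝ} (hq : Measurable q) :
    Measurable ({ξ : Space | M ≤ ‖ξ‖}.indicator
      (fun ξ => 4 * Real.sin (q ξ / 2) ^ 2 / ‖ξ‖ ^ 2)) :=
  Measurable.indicator (by fun_prop) (measurableSet_norm_ge M)

theorem integrable_lowerIntegrand (hκ : κ = H 0 + H 1 + H 2 - 2)
    (hH : ∀ i, 1 / 2 < H i ∧ H i < 1) (hκ0 : 0 < κ) {M : ℝ} (hM : 2 ≤ M) {q : Space → ℝ}
    (hq : Measurable q) :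
    Integrable ({ξ : Space | M ≤ ‖ξ‖}.indicator
      (fun ξ => 4 * Real.sin (q ξ / 2) ^ 2 / ‖ξ‖ ^ 2)) (specMeasure H) := by
  refine (integrable_cutoff_one hκ hH hκ0).mono'
    (measurable_lowerIntegrand M hq).aestronglyMeasurable (Eventually.of_forall fun ξ => ?_)
  rw [Real.norm_of_nonneg (lowerIntegrand_nonneg M q ξ)]
  exact lowerIntegrand_le hM q ξ

/-- If the integral vanished, so would the integrand almost everywhere; but it is positive on a
nonempty open set, and the spectral density is positive off the coordinate hyperplanes. -/
theorem lowerIntegral_pos (hκ : κ = H 0 + H 1 + H 2 - 2)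
    (hH : ∀ i, 1 / 2 < H i ∧ H i < 1) (hκ0 : 0 < κ) {M : ℝ} (hM : 2 ≤ M) {q : Space → ℝ}
    (hq : Continuous q) {η : Space} (hη : M < ‖η‖) (hs : Real.sin (q η / 2) ≠ 0) :
    0 < lowerIntegral H M q := by
  refine lt_of_le_of_ne (integral_nonneg (lowerIntegrand_nonneg M q)) fun h0 => ?_
  have h1 := (integral_eq_zero_iff_of_nonneg (lowerIntegrand_nonneg M q)
    (integrable_lowerIntegrand hκ hH hκ0 hM hq.measurable)).1 h0.symm
  rw [specMeasure, Filter.EventuallyEq,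
    ae_withDensity_iff (measurable_specDensity H).ennreal_ofReal] at h1
  have hU : IsOpen ({ξ : Space | M < ‖ξ‖} ∩ {ξ | Real.sin (q ξ / 2) ≠ 0}) :=
    (isOpen_lt continuous_const continuous_norm).inter
      (isOpen_ne_fun (by fun_prop) continuous_const)
  have hpos := hU.measure_pos volume ⟨η, hη, hs⟩
  refine hpos.ne' (measure_mono_null (fun ξ hξ => ?_)
    (ae_iff.1 (h1.and ae_coord_ne_zero)))
  simp only [mem_ofPred_eq, not_and]
  intro h2 h3
  have h4 := h2 (by simpa using specDensity_pos hH h3)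
  have hM' : M < ‖ξ‖ := hξ.1
  have hp : 0 < ‖ξ‖ := by linarith
  have hs' : Real.sin (q ξ / 2) ≠ 0 := hξ.2
  rw [indicator_of_mem (show ξ ∈ {ξ : Space | M ≤ ‖ξ‖} from hM'.le)] at h4
  have : 0 < 4 * Real.sin (q ξ / 2) ^ 2 / ‖ξ‖ ^ 2 := by positivity
  simp only [Pi.zero_apply] at h4
  linarith

theorem exists_large_sin_ne_zero (M : ℝ) : ∃ a : ℝ, M < a ∧ 0 < a ∧ Real.sin (a / 2) ≠ 0 := by
  obtain ⟨n, hn⟩ := exists_nat_gt M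
  refine ⟨Real.pi + 2 * (n * Real.pi), ?_, by positivity, ?_⟩
  · have := Real.pi_gt_three
    have hn0 : (0 : ℝ) ≤ n := n.cast_nonneg
    nlinarith
  · have : (Real.pi + 2 * (n * Real.pi)) / 2 = n * Real.pi + Real.pi / 2 := by ring
    -- Half of the witness is nπ + π/2, where the sine is ±1.
    rw [this, Real.sin_add_pi_div_two, Real.cos_nat_mul_pi]
    positivity

/-- The spectral density is not rotation invariant, so the integral depends on the direction e. It
is continuous in e by domination, and attains a positive minimum on the unit sphere. -/
theorem exists_lowerIntegral_inner_ge (hκ : κ = H 0 + H 1 + H 2 - 2)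
    (hH : ∀ i, 1 / 2 < H i ∧ H i < 1) (hκ0 : 0 < κ) {M : ℝ} (hM : 2 ≤ M) :
    ∃ c : ℝ, 0 < c ∧ ∀ e : Space, ‖e‖ = 1 → c ≤ lowerIntegral H M (fun ξ => ⟪e, ξ⟫) := by
  have hcont : Continuous fun e : Space => lowerIntegral H M (fun ξ => ⟪e, ξ⟫) := by
    unfold lowerIntegral
    refine continuous_of_dominated (bound := cutoff 1) (fun e =>
      (measurable_lowerIntegrand M (by fun_prop)).aestronglyMeasurable)
      (fun e => Eventually.of_forall fun ξ => ?_) (integrable_cutoff_one hκ hH hκ0)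
      (Eventually.of_forall fun ξ => ?_)
    · rw [Real.norm_of_nonneg (lowerIntegrand_nonneg M _ ξ)]
      exact lowerIntegrand_le hM _ ξ
    · by_cases h : ξ ∈ {ξ : Space | M ≤ ‖ξ‖}
      · simp only [indicator_of_mem h]; fun_prop
      · simp only [indicator_of_notMem h]; fun_prop
  obtain ⟨e0, he0⟩ := (NormedSpace.sphere_nonempty (x := (0 : Space)) (r := 1)).2 zero_le_one
  obtain ⟨e1, he1, hmin⟩ := (isCompact_sphere (0 : Space) 1).exists_isMinOn ⟨e0, he0⟩
    hcont.continuousOn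
  refine ⟨_, ?_, fun e he => hmin (by simpa using he)⟩
  obtain ⟨a, ha, ha0, has⟩ := exists_large_sin_ne_zero M
  have hn : ‖e1‖ = 1 := by simpa using he1
  refine lowerIntegral_pos hκ hH hκ0 hM (by fun_prop) (η := a • e1) ?_ ?_
  · rw [norm_smul, hn, mul_one, Real.norm_of_nonneg ha0.le]; exact ha
  · rw [real_inner_smul_right, real_inner_self_eq_norm_sq, hn]; simpa using has

theorem lowerIntegral_norm_pos (hκ : κ = H 0 + H 1 + H 2 - 2)
    (hH : ∀ i, 1 / 2 < H i ∧ H i < 1) (hκ0 : 0 < κ) {M : ℝ} (hM : 2 ≤ M) :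
    0 < lowerIntegral H M (fun ξ => ‖ξ‖) := by
  obtain ⟨a, ha, ha0, has⟩ := exists_large_sin_ne_zero M
  obtain ⟨e, he⟩ := (NormedSpace.sphere_nonempty (x := (0 : Space)) (r := 1)).2 zero_le_one
  have hn : ‖e‖ = 1 := by simpa using he
  have h1 : ‖a • e‖ = a := by rw [norm_smul, hn, mul_one, Real.norm_of_nonneg ha0.le]
  refine lowerIntegral_pos hκ hH hκ0 hM (by fun_prop) (η := a • e) ?_ ?_
  · rwa [h1]
  · rwa [h1]

/-- Rescaling of the lower spectral integral. -/
theorem lowerIntegral_scale (hκ : κ = H 0 + H 1 + H 2 - 2)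
    (hH : ∀ i, 1 / 2 < H i ∧ H i < 1) {δ : ℝ} (hδ : 0 < δ) (M : ℝ) (q : Space → ℝ) :
    δ ^ (2 * κ) * lowerIntegral H M q = ∫ ξ, {ξ : Space | M ≤ δ * ‖ξ‖}.indicator
      (fun ξ => 4 * Real.sin (q (δ • ξ) / 2) ^ 2 / ‖ξ‖ ^ 2) ξ ∂(specMeasure H) := by
  rw [lowerIntegral, ← integral_specMeasure_scale hκ hH hδ]
  refine integral_congr_ae (Eventually.of_forall fun ξ => ?_)
  have hn : ‖δ • ξ‖ = δ * ‖ξ‖ := by rw [norm_smul, Real.norm_of_nonneg hδ.le]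
  simp only [indicator, mem_ofPred_eq, hn]
  split_ifs
  · by_cases h : ‖ξ‖ = 0
    · simp [h]
    · field_simp
  · simp

end StochWave

/-! ### Spectral bounds for increments of the wave kernel -/

namespace StochWave

open scoped RealInnerProductSpace ComplexConjugate

variable {H : Fin 3 → ℝ} {κ T : ℝ}

/-- Radial profile of the Fourier transform of the (causally truncated) fundamental solution. -/
noncomputable def pulse (r ρ : ℝ) : ℝ := max r 0 * Real.sinc (max r 0 * ρ)

theorem pulse_zero (ρ : ℝ) : pulse 0 ρ = 0 := by simp [pulse]

theorem pulse_eq {ρ : ℝ} (hρ : 0 < ρ) (r : ℝ) : pulse r ρ = Real.sin (max r 0 * ρ) / ρ := by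
  rw [pulse]
  rcases (le_max_right r 0).eq_or_lt with h | h
  · rw [← h]; simp
  · rw [Real.sinc_of_ne_zero (by positivity)]
    field_simp

theorem continuous_pulse (ρ : ℝ) : Continuous fun r => pulse r ρ := by
  unfold pulse
  have := Real.continuous_sinc
  fun_prop

theorem abs_sin_sub_sin_le (a b : ℝ) : |Real.sin a - Real.sin b| ≤ |a - b| := by
  have h := (Real.lipschitzWith_sin).dist_le_mul a b
  simpa [Real.dist_eq] using h

/-- Sine and r ↦ max r 0 are both 1-Lipschitz, and two sines differ by at most 2. Building causality
into the pulse through max r 0 means that the upper time bound needs no separate treatment of times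
s between t and t'. -/
theorem pulse_sub_sq_le {ρ : ℝ} (hρ : 0 < ρ) (r r' : ℝ) :
    (pulse r ρ - pulse r' ρ) ^ 2 ≤ min ((r - r') ^ 2) (4 / ρ ^ 2) := by
  rw [pulse_eq hρ, pulse_eq hρ, ← sub_div, div_pow]
  refine le_min ?_ ?_
  · rw [div_le_iff₀ (by positivity), ← mul_pow, ← sq_abs, ← sq_abs ((r - r') * ρ)]
    refine pow_le_pow_left₀ (abs_nonneg _) ((abs_sin_sub_sin_le _ _).trans ?_) 2
    rw [← sub_mul, abs_mul, abs_mul]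
    exact mul_le_mul_of_nonneg_right (abs_max_sub_max_le_abs _ _ _) (abs_nonneg _)
  · gcongr
    nlinarith [Real.neg_one_le_sin (max r 0 * ρ), Real.sin_le_one (max r 0 * ρ),
      Real.neg_one_le_sin (max r' 0 * ρ), Real.sin_le_one (max r' 0 * ρ)]

theorem pulse_sq_le {ρ : ℝ} (hρ : 0 < ρ) (r : ℝ) : pulse r ρ ^ 2 ≤ min (r ^ 2) (4 / ρ ^ 2) := by
  have := pulse_sub_sq_le hρ r 0
  rwa [pulse_zero, sub_zero, sub_zero] at this

/-- Fourier transform of the integrand of the mild solution. -/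
noncomputable def waveFourier (t : ℝ) (x : Space) (p : ℝ × Space) : ℂ :=
  Complex.exp (⟪x, p.2⟫ * Complex.I) * ((pulse (t - p.1) ‖p.2‖ : ℝ) : ℂ)

theorem continuous_waveFourier (t : ℝ) (x : Space) : Continuous (waveFourier t x) := by
  unfold waveFourier pulse
  have := Real.continuous_sinc
  fun_prop

theorem norm_waveFourier (t : ℝ) (x : Space) (p : ℝ × Space) :
    ‖waveFourier t x p‖ ^ 2 = pulse (t - p.1) ‖p.2‖ ^ 2 := by
  rw [waveFourier, norm_mul, Complex.norm_exp_ofReal_mul_I, one_mul, Complex.norm_real,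
    Real.norm_eq_abs, sq_abs]

theorem ae_norm_pos : ∀ᵐ ξ ∂(specMeasure H), 0 < ‖ξ‖ := by
  refine (withDensity_absolutelyContinuous _ _).ae_le ?_
  filter_upwards [Measure.ae_ne volume (0 : Space)] with ξ hξ
  exact norm_pos_iff.2 hξ

theorem ae_snd_norm_pos : ∀ᵐ p ∂(spaceTimeMeasure H T), 0 < ‖p.2‖ :=
  Measure.quasiMeasurePreserving_snd.ae ae_norm_pos

theorem ae_fst_mem : ∀ᵐ p ∂(spaceTimeMeasure H T), p.1 ∈ Ioc 0 T :=
  Measure.quasiMeasurePreserving_fst.ae (ae_restrict_mem measurableSet_Ioc)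

theorem charFun_causalKernel (t s : ℝ) (x ξ : Space) :
    charFun (if s < t then shiftedKernel (t - s) x else 0) ξ = waveFourier t x (s, ξ) := by
  split_ifs with h
  · have h' : 0 < t - s := sub_pos.2 h
    rw [charFun_shiftedKernel h', waveFourier, pulse]
    simp only [max_eq_left h'.le]
  · have h' : t - s ≤ 0 := by linarith
    rw [charFun_zero_measure, waveFourier, pulse]
    simp only [max_eq_right h']
    simp

theorem integrable_cutoff_snd (hκ : κ = H 0 + H 1 + H 2 - 2) (hH : ∀ i, 1 / 2 < H i ∧ H i < 1)
    (hκ0 : 0 < κ) (δ : ℝ) :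
    Integrable (fun p : ℝ × Space => cutoff δ p.2) (spaceTimeMeasure H T) := by
  have : Integrable (fun p : ℝ × Space => (1 : ℝ) * cutoff δ p.2) (spaceTimeMeasure H T) :=
    (integrable_const 1).mul_prod (integrable_cutoff hκ hH hκ0 δ)
  simpa using this

theorem memLp_waveFourier (hκ : κ = H 0 + H 1 + H 2 - 2) (hH : ∀ i, 1 / 2 < H i ∧ H i < 1)
    (hκ0 : 0 < κ) (t : ℝ) (x : Space) : MemLp (waveFourier t x) 2 (spaceTimeMeasure H T) := by
  have hm := (continuous_waveFourier t x).aestronglyMeasurable (μ := spaceTimeMeasure H T)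
  rw [memLp_two_iff_integrable_sq_norm hm]
  refine (integrable_cutoff_snd hκ hH hκ0 (|t| + T)).mono' (hm.norm.pow 2) ?_
  filter_upwards [ae_snd_norm_pos, ae_fst_mem] with p hp hs
  rw [Real.norm_of_nonneg (by positivity), norm_waveFourier]
  refine (pulse_sq_le hp _).trans (min_le_min_right _ ?_)
  rw [← sq_abs]
  refine pow_le_pow_left₀ (abs_nonneg _) ((abs_sub _ _).trans ?_) 2
  rw [abs_of_pos hs.1]
  linarith [hs.2]

open Classical in
theorem isPathFourier_wave (hκ : κ = H 0 + H 1 + H 2 - 2) (hH : ∀ i, 1 / 2 < H i ∧ H i < 1)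
    (hκ0 : 0 < κ) (t : ℝ) (x : Space) :
    IsPathFourier H T (fun s => if s < t then shiftedKernel (t - s) x else 0)
      (waveFourier t x) where
  finite s _ := by
    split_ifs <;> infer_instance
  charFun_eq s _ ξ := by
    convert charFun_causalKernel t s x ξ
  energy s _ := by
    have h1 : charFun (if s < t then shiftedKernel (t - s) x else 0)
        = fun ξ => waveFourier t x (s, ξ) := by
      ext ξ
      convert charFun_causalKernel t s x ξ
    have hm : AEStronglyMeasurable (fun ξ => waveFourier t x (s, ξ)) (specMeasure H) :=
      ((continuous_waveFourier t x).comp (by fun_prop)).aestronglyMeasurable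
    rw [FiniteEnergy, h1, memLp_two_iff_integrable_sq_norm hm]
    refine (integrable_cutoff hκ hH hκ0 (t - s)).mono' (hm.norm.pow 2) ?_
    filter_upwards [ae_norm_pos] with ξ hξ
    rw [Real.norm_of_nonneg (by positivity), norm_waveFourier]
    exact pulse_sq_le hξ _
  memLp := memLp_waveFourier hκ hH hκ0 t x

theorem norm_exp_sub_exp_sq (a b : ℝ) :
    ‖Complex.exp (a * Complex.I) - Complex.exp (b * Complex.I)‖ ^ 2
      = 4 * Real.sin ((a - b) / 2) ^ 2 := by
  have h1 : Complex.exp (a * Complex.I) - Complex.exp (b * Complex.I)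
      = Complex.exp (b * Complex.I) * (Complex.exp (Complex.I * ((a - b : ℝ) : ℂ)) - 1) := by
    rw [mul_sub, ← Complex.exp_add, mul_one]
    congr 2
    push_cast; ring
  rw [h1, norm_mul, Complex.norm_exp_ofReal_mul_I, one_mul,
    Complex.norm_exp_I_mul_ofReal_sub_one, Real.norm_eq_abs, sq_abs]
  ring

theorem norm_waveFourier_sub_space (t : ℝ) (x y : Space) (p : ℝ × Space) :
    ‖(waveFourier t x - waveFourier t y) p‖ ^ 2
      = 4 * Real.sin (⟪x - y, p.2⟫ / 2) ^ 2 * pulse (t - p.1) ‖p.2‖ ^ 2 := by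
  rw [Pi.sub_apply, waveFourier, waveFourier, ← sub_mul, norm_mul, mul_pow, norm_exp_sub_exp_sq,
    inner_sub_left, Complex.norm_real, Real.norm_eq_abs, sq_abs]

theorem norm_waveFourier_sub_time (t t' : ℝ) (x : Space) (p : ℝ × Space) :
    ‖(waveFourier t x - waveFourier t' x) p‖ ^ 2
      = (pulse (t - p.1) ‖p.2‖ - pulse (t' - p.1) ‖p.2‖) ^ 2 := by
  rw [Pi.sub_apply, waveFourier, waveFourier, ← mul_sub, norm_mul, Complex.norm_exp_ofReal_mul_I,
    one_mul, ← Complex.ofReal_sub, Complex.norm_real, Real.norm_eq_abs, sq_abs]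

/-- Both upper bounds reduce to a pointwise comparison with the cutoff: it does not depend on s, so
time contributes the factor T and rescaling the power of δ. -/
theorem integral_le_of_le_cutoff (hκ : κ = H 0 + H 1 + H 2 - 2)
    (hH : ∀ i, 1 / 2 < H i ∧ H i < 1) (hκ0 : 0 < κ) (hT : 0 < T) {δ : ℝ} (hδ : 0 < δ)
    {F : ℝ × Space → ℝ} (hF0 : ∀ p, 0 ≤ F p)
    (hF : ∀ p : ℝ × Space, 0 < ‖p.2‖ → F p ≤ cutoff δ p.2) :
    ∫ p, F p ∂(spaceTimeMeasure H T)
      ≤ T * (∫ ξ, cutoff 1 ξ ∂(specMeasure H)) * δ ^ (2 * κ) := by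
  have h1 : ∫ p, F p ∂(spaceTimeMeasure H T)
      ≤ ∫ p, cutoff δ p.2 ∂(spaceTimeMeasure H T) := by
    refine integral_mono_of_nonneg (Eventually.of_forall hF0)
      (integrable_cutoff_snd hκ hH hκ0 δ) ?_
    filter_upwards [ae_snd_norm_pos] with p hp using hF p hp
  refine h1.trans (le_of_eq ?_)
  rw [spaceTimeMeasure, integral_fun_snd (fun ξ => cutoff δ ξ), integral_cutoff hκ hH hδ]
  simp only [measureReal_restrict_apply_univ, Real.volume_real_Ioc, sub_zero, smul_eq_mul,
    max_eq_left hT.le]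
  ring

theorem integral_wave_space_le (hκ : κ = H 0 + H 1 + H 2 - 2)
    (hH : ∀ i, 1 / 2 < H i ∧ H i < 1) (hκ0 : 0 < κ) (hT : 0 < T) (t : ℝ) {x y : Space}
    (hxy : x ≠ y) :
    ∫ p, ‖(waveFourier t x - waveFourier t y) p‖ ^ 2 ∂(spaceTimeMeasure H T)
      ≤ T * (∫ ξ, cutoff 1 ξ ∂(specMeasure H)) * ‖x - y‖ ^ (2 * κ) := by
  refine integral_le_of_le_cutoff hκ hH hκ0 hT (norm_pos_iff.2 (sub_ne_zero.2 hxy))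
    (fun p => by positivity) fun p hp => ?_
  rw [norm_waveFourier_sub_space, pulse_eq hp, div_pow, cutoff]
  have hs1 := Real.sin_sq_le_one (⟪x - y, p.2⟫ / 2)
  have hs2 := Real.sin_sq_le_one (max (t - p.1) 0 * ‖p.2‖)
  have hs3 : 4 * Real.sin (⟪x - y, p.2⟫ / 2) ^ 2 ≤ ‖x - y‖ ^ 2 * ‖p.2‖ ^ 2 := by
    have h1 : |Real.sin (⟪x - y, p.2⟫ / 2)| ≤ ‖x - y‖ * ‖p.2‖ / 2 := by
      refine Real.abs_sin_le_abs.trans ?_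
      rw [abs_div, abs_two]
      have := abs_real_inner_le_norm (x - y) p.2
      linarith
    have h2 := pow_le_pow_left₀ (abs_nonneg _) h1 2
    rw [sq_abs] at h2
    nlinarith
  have h0 : 0 ≤ Real.sin (max (t - p.1) 0 * ‖p.2‖) ^ 2 := sq_nonneg _
  rw [← mul_div_assoc]
  refine le_min ?_ ?_
  · rw [div_le_iff₀ (by positivity)]
    calc _ ≤ 4 * Real.sin (⟪x - y, p.2⟫ / 2) ^ 2 * 1 :=
          mul_le_mul_of_nonneg_left hs2 (by positivity)
      _ ≤ _ := by rw [mul_one]; exact hs3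
  · gcongr
    have : 0 ≤ Real.sin (⟪x - y, p.2⟫ / 2) ^ 2 := sq_nonneg _
    nlinarith

theorem integral_wave_time_le (hκ : κ = H 0 + H 1 + H 2 - 2)
    (hH : ∀ i, 1 / 2 < H i ∧ H i < 1) (hκ0 : 0 < κ) (hT : 0 < T) {t t' : ℝ} (htt : t' ≠ t)
    (x : Space) :
    ∫ p, ‖(waveFourier t x - waveFourier t' x) p‖ ^ 2 ∂(spaceTimeMeasure H T)
      ≤ T * (∫ ξ, cutoff 1 ξ ∂(specMeasure H)) * |t' - t| ^ (2 * κ) := by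
  refine integral_le_of_le_cutoff hκ hH hκ0 hT (abs_pos.2 (sub_ne_zero.2 htt))
    (fun p => by positivity) fun p hp => ?_
  rw [norm_waveFourier_sub_time, cutoff, sq_abs]
  refine (pulse_sub_sq_le hp _ _).trans (le_of_eq ?_)
  congr 1
  ring

/-- The integral is t/2 plus boundary terms divided by 2ρ. These contribute at least -1/(2ρ), and
1/(2ρ) ≤ t/8 when ρt ≥ 4. -/
theorem integral_cos_sq_ge {t ρ : ℝ} (ht : 0 < t) (hρ : 4 / t ≤ ρ) (d : ℝ) :
    t / 4 ≤ ∫ s in (0 : ℝ)..t, Real.cos (ρ * s + d) ^ 2 := by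
  have hρ0 : 0 < ρ := lt_of_lt_of_le (by positivity) hρ
  have h4 : 4 ≤ ρ * t := by rwa [div_le_iff₀ ht] at hρ
  have h := intervalIntegral.integral_comp_mul_add (a := 0) (b := t)
    (fun u => Real.cos u ^ 2) hρ0.ne' d
  rw [h, integral_cos_sq, smul_eq_mul, inv_mul_eq_div, le_div_iff₀ hρ0]
  nlinarith [Real.sin_sq_add_cos_sq (ρ * t + d), Real.sin_sq_add_cos_sq (ρ * 0 + d),
    sq_nonneg (Real.cos (ρ * t + d) + Real.sin (ρ * t + d)),
    sq_nonneg (Real.cos (ρ * 0 + d) - Real.sin (ρ * 0 + d))]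

/-- The increments have the form A cos² only while s ≤ t; the rest of (0,T] is discarded by
nonnegativity. -/
theorem setIntegral_ge_of_eq {F : ℝ → ℝ} (hF : Continuous F) (hF0 : ∀ s, 0 ≤ F s) {t A d ρ : ℝ}
    (ht : 0 < t) (htT : t ≤ T) (hA : 0 ≤ A) (hρ : 4 / t ≤ ρ)
    (h : ∀ s ∈ Ioc 0 t, F s = A * Real.cos (ρ * s + d) ^ 2) :
    t / 4 * A ≤ ∫ s in Ioc 0 T, F s := by
  have hint : IntegrableOn F (Ioc 0 T) := (hF.integrableOn_Icc (μ := volume)).mono_set Ioc_subset_Icc_self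
  have h1 : ∫ s in Ioc 0 t, F s ≤ ∫ s in Ioc 0 T, F s :=
    setIntegral_mono_set hint (Eventually.of_forall hF0)
      (Eventually.of_forall (Ioc_subset_Ioc_right htT))
  refine le_trans ?_ h1
  rw [setIntegral_congr_fun measurableSet_Ioc h, integral_const_mul, mul_comm,
    ← intervalIntegral.integral_of_le ht.le]
  exact mul_le_mul_of_nonneg_left (integral_cos_sq_ge ht hρ d) hA

/-- In the rescaled variable the threshold is max(2, 4L/t₀), independent of δ, so the constant is
uniform. Since δ ≤ L, the condition 4L/t₀ ≤ δ|ξ| forces |ξ| ≥ 4/t₀, the range in which the time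
integral is controlled. -/
theorem integral_ge_lowerIntegral (hκ : κ = H 0 + H 1 + H 2 - 2)
    (hH : ∀ i, 1 / 2 < H i ∧ H i < 1) {t₀ L δ : ℝ}
    (ht₀ : 0 < t₀) (hδ : 0 < δ) (hδL : δ ≤ L) {G : ℝ × Space → ℂ}
    (hG : MemLp G 2 (spaceTimeMeasure H T)) {q : Space → ℝ}
    (h : ∀ ξ : Space, 4 / t₀ ≤ ‖ξ‖ → t₀ / 4 * (4 * Real.sin (q (δ • ξ) / 2) ^ 2 / ‖ξ‖ ^ 2)
      ≤ ∫ s in Ioc 0 T, ‖G (s, ξ)‖ ^ 2) :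
    t₀ / 4 * lowerIntegral H (max 2 (4 * L / t₀)) q * δ ^ (2 * κ)
      ≤ ∫ p, ‖G p‖ ^ 2 ∂(spaceTimeMeasure H T) := by
  have hint : Integrable (fun p => ‖G p‖ ^ 2) (spaceTimeMeasure H T) :=
    MemLp.integrable_norm_pow hG two_ne_zero
  rw [mul_assoc, mul_comm (lowerIntegral H _ q), lowerIntegral_scale hκ hH hδ,
    ← integral_const_mul]
  rw [spaceTimeMeasure] at hint ⊢
  rw [integral_prod_symm _ hint]
  refine integral_mono_of_nonneg (Eventually.of_forall fun ξ => ?_) hint.integral_prod_right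
    (Eventually.of_forall fun ξ => ?_)
  · exact mul_nonneg (by positivity) (indicator_nonneg (fun ξ _ => by positivity) ξ)
  · simp only [indicator, mem_ofPred_eq]
    split_ifs with hξ
    · refine h ξ ?_
      have h1 : 4 * L / t₀ ≤ δ * ‖ξ‖ := (le_max_right _ _).trans hξ
      have h2 : 4 / t₀ * δ ≤ 4 * L / t₀ := by
        rw [div_mul_eq_mul_div]; gcongr
      nlinarith
    · rw [mul_zero]; exact integral_nonneg fun s => by positivity

theorem continuous_pulse_comp (t ρ : ℝ) : Continuous fun s => pulse (t - s) ρ :=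
  (continuous_pulse ρ).comp (by fun_prop)

theorem integral_wave_space_ge (hκ : κ = H 0 + H 1 + H 2 - 2)
    (hH : ∀ i, 1 / 2 < H i ∧ H i < 1) (hκ0 : 0 < κ) {t₀ L t : ℝ} (ht₀ : 0 < t₀)
    (ht : t₀ ≤ t) (htT : t ≤ T) {x y : Space} (hxy : x ≠ y) (hL : ‖x - y‖ ≤ L) :
    t₀ / 4 * lowerIntegral H (max 2 (4 * L / t₀)) (fun ξ => ⟪‖x - y‖⁻¹ • (x - y), ξ⟫)
        * ‖x - y‖ ^ (2 * κ)
      ≤ ∫ p, ‖(waveFourier t x - waveFourier t y) p‖ ^ 2 ∂(spaceTimeMeasure H T) := by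
  have hδ : 0 < ‖x - y‖ := norm_pos_iff.2 (sub_ne_zero.2 hxy)
  refine integral_ge_lowerIntegral hκ hH ht₀ hδ hL
    ((memLp_waveFourier hκ hH hκ0 t x).sub (memLp_waveFourier hκ hH hκ0 t y)) fun ξ hξ => ?_
  have hξ0 : 0 < ‖ξ‖ := lt_of_lt_of_le (by positivity) hξ
  have ht0 : 0 < t := ht₀.trans_le ht
  have hi : ⟪‖x - y‖⁻¹ • (x - y), ‖x - y‖ • ξ⟫ = ⟪x - y, ξ⟫ := by
    rw [real_inner_smul_left, real_inner_smul_right, inv_mul_cancel_left₀ hδ.ne']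
  simp only [norm_waveFourier_sub_space, hi]
  set A := 4 * Real.sin (⟪x - y, ξ⟫ / 2) ^ 2 / ‖ξ‖ ^ 2 with hA
  have hA0 : 0 ≤ A := by positivity
  refine (mul_le_mul_of_nonneg_right (by linarith : t₀ / 4 ≤ t / 4) hA0).trans ?_
  -- The phase shift by π/2 writes sin²((t-s)|ξ|) as a squared cosine.
  refine setIntegral_ge_of_eq (d := -(t * ‖ξ‖) + Real.pi / 2) ?_ (fun s => by positivity) ht0 htT
    hA0 ((div_le_div_of_nonneg_left (by norm_num) ht₀ ht).trans hξ) fun s hs => ?_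
  · exact continuous_const.mul ((continuous_pulse_comp t ‖ξ‖).pow 2)
  · have e1 : ‖ξ‖ * s + (-(t * ‖ξ‖) + Real.pi / 2) = -((t - s) * ‖ξ‖) + Real.pi / 2 := by ring
    rw [pulse_eq hξ0, max_eq_left (by linarith [hs.2]), e1, Real.cos_add_pi_div_two, hA,
      Real.sin_neg, neg_neg]
    ring

/-- For s at most the smaller time neither pulse is truncated, and the difference of sines factors
into sin((t'-t)|ξ|/2), free of s, times an oscillating cosine. The final time T plays the role of L.
-/
theorem integral_wave_time_ge (hκ : κ = H 0 + H 1 + H 2 - 2)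
    (hH : ∀ i, 1 / 2 < H i ∧ H i < 1) (hκ0 : 0 < κ) {t₀ t t' : ℝ} (ht₀ : 0 < t₀)
    (ht : t₀ ≤ t) (htt : t < t') (htT : t' ≤ T) (x : Space) :
    t₀ / 4 * lowerIntegral H (max 2 (4 * T / t₀)) (fun ξ => ‖ξ‖) * |t' - t| ^ (2 * κ)
      ≤ ∫ p, ‖(waveFourier t x - waveFourier t' x) p‖ ^ 2 ∂(spaceTimeMeasure H T) := by
  have hδ : 0 < t' - t := sub_pos.2 htt
  have ht0 : 0 < t := ht₀.trans_le ht
  rw [abs_of_pos hδ]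
  refine integral_ge_lowerIntegral hκ hH ht₀ hδ (by linarith)
    ((memLp_waveFourier hκ hH hκ0 t x).sub (memLp_waveFourier hκ hH hκ0 t' x)) fun ξ hξ => ?_
  have hξ0 : 0 < ‖ξ‖ := lt_of_lt_of_le (by positivity) hξ
  simp only [norm_waveFourier_sub_time, norm_smul, Real.norm_of_nonneg hδ.le]
  set A := 4 * Real.sin ((t' - t) * ‖ξ‖ / 2) ^ 2 / ‖ξ‖ ^ 2 with hA
  have hA0 : 0 ≤ A := by positivity
  refine (mul_le_mul_of_nonneg_right (by linarith : t₀ / 4 ≤ t / 4) hA0).trans ?_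
  refine setIntegral_ge_of_eq (d := -((t + t') * ‖ξ‖ / 2)) ?_ (fun s => by positivity) ht0
    (by linarith) hA0 ((div_le_div_of_nonneg_left (by norm_num) ht₀ ht).trans hξ) fun s hs => ?_
  · exact ((continuous_pulse_comp t ‖ξ‖).sub (continuous_pulse_comp t' ‖ξ‖)).pow 2
  · rw [pulse_eq hξ0, pulse_eq hξ0, max_eq_left (by linarith [hs.2]),
      max_eq_left (by linarith [hs.2]), ← sub_div, Real.sin_sub_sin, hA]
    have e1 : ((t - s) * ‖ξ‖ - (t' - s) * ‖ξ‖) / 2 = -((t' - t) * ‖ξ‖ / 2) := by ring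
    have e2 : ((t - s) * ‖ξ‖ + (t' - s) * ‖ξ‖) / 2 = -(‖ξ‖ * s + -((t + t') * ‖ξ‖ / 2)) := by ring
    rw [e1, e2, Real.sin_neg, Real.cos_neg]
    ring

end StochWave

namespace StochWave

/-! ### A Kolmogorov-Chentsov theorem on `ι → ℝ` -/

section Dyadic

variable {ι : Type*}

/-- The point of the grid of mesh `2⁻ⁿ` with integer coordinates `z`. -/
noncomputable def gridPoint (n : ℕ) (z : ι → ℤ) : ι → ℝ := fun i => (z i : ℝ) / 2 ^ n

/-- The integer coordinates of the largest grid point of mesh `2⁻ⁿ` below `p`. -/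
noncomputable def gridFloor (n : ℕ) (p : ι → ℝ) : ι → ℤ := fun i => ⌊2 ^ n * p i⌋

theorem gridPoint_succ_two_mul (n : ℕ) (z : ι → ℤ) :
    gridPoint (n + 1) (fun i => 2 * z i) = gridPoint n z := by
  ext i
  simp only [gridPoint, pow_succ]
  push_cast
  field_simp

theorem abs_gridFloor_le {N : ℕ} {p : ι → ℝ} (hp : ∀ i, |p i| ≤ N) (n : ℕ) (i : ι) :
    |gridFloor n p i| ≤ N * 2 ^ n := by
  have h := abs_le.1 (hp i)
  have h2 : (0 : ℝ) < 2 ^ n := by positivity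
  rw [abs_le]
  constructor
  · refine Int.le_floor.2 ?_
    push_cast
    nlinarith [h.1]
  · have : ((gridFloor n p i : ℤ) : ℝ) ≤ ((N * 2 ^ n : ℤ) : ℝ) := by
      refine (Int.floor_le _).trans ?_
      push_cast
      nlinarith [h.2]
    exact_mod_cast this

/-- ⌊2y⌋ - 2⌊y⌋ is 0 or 1, so refining the approximation of p is a single neighbour step on the
finer grid. -/
theorem abs_gridFloor_succ_sub_le (n : ℕ) (p : ι → ℝ) (i : ι) :
    |gridFloor (n + 1) p i - 2 * gridFloor n p i| ≤ 1 := by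
  have h1 := Int.floor_le (2 ^ n * p i)
  have h2 := Int.lt_floor_add_one (2 ^ n * p i)
  have h3 := Int.floor_le (2 ^ (n + 1) * p i)
  have h4 := Int.lt_floor_add_one (2 ^ (n + 1) * p i)
  have e : (2 : ℝ) ^ (n + 1) * p i = 2 * (2 ^ n * p i) := by ring
  simp only [gridFloor]
  rw [e] at h3 h4 ⊢
  have a1 : ((⌊2 * (2 ^ n * p i)⌋ - 2 * ⌊2 ^ n * p i⌋ : ℤ) : ℝ) < ((2 : ℤ) : ℝ) := by
    push_cast; linarith
  have a2 : ((-1 : ℤ) : ℝ) < ((⌊2 * (2 ^ n * p i)⌋ - 2 * ⌊2 ^ n * p i⌋ : ℤ) : ℝ) := by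
    push_cast; linarith
  rw [Int.cast_lt] at a1 a2
  rw [abs_le]
  omega

theorem abs_gridFloor_sub_le {n : ℕ} {p q : ι → ℝ} {i : ι} (h : |q i - p i| ≤ (1 / 2) ^ n) :
    |gridFloor n q i - gridFloor n p i| ≤ 1 := by
  have h1 := Int.floor_le (2 ^ n * p i)
  have h2 := Int.lt_floor_add_one (2 ^ n * p i)
  have h3 := Int.floor_le (2 ^ n * q i)
  have h4 := Int.lt_floor_add_one (2 ^ n * q i)
  have e : |2 ^ n * q i - 2 ^ n * p i| ≤ 1 := by
    rw [← mul_sub, abs_mul, abs_of_pos (by positivity : (0 : ℝ) < 2 ^ n)]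
    calc (2 : ℝ) ^ n * |q i - p i| ≤ 2 ^ n * (1 / 2) ^ n := by gcongr
      _ = 1 := by rw [← mul_pow]; norm_num
  have e' := abs_le.1 e
  simp only [gridFloor]
  have a1 : ((⌊2 ^ n * q i⌋ - ⌊2 ^ n * p i⌋ : ℤ) : ℝ) < ((2 : ℤ) : ℝ) := by
    push_cast; linarith
  have a2 : ((-2 : ℤ) : ℝ) < ((⌊2 ^ n * q i⌋ - ⌊2 ^ n * p i⌋ : ℤ) : ℝ) := by
    push_cast; linarith
  rw [Int.cast_lt] at a1 a2
  rw [abs_le]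
  omega

theorem abs_gridPoint_floor_sub_le (n : ℕ) (p : ι → ℝ) (i : ι) :
    |gridPoint n (gridFloor n p) i - p i| ≤ (1 / 2) ^ n := by
  have h1 := Int.floor_le (2 ^ n * p i)
  have h2 := Int.lt_floor_add_one (2 ^ n * p i)
  have h0 : (0 : ℝ) < 2 ^ n := by positivity
  have e : gridPoint n (gridFloor n p) i - p i = (⌊2 ^ n * p i⌋ - 2 ^ n * p i) / 2 ^ n := by
    simp only [gridPoint, gridFloor]
    field_simp
  rw [e, abs_div, abs_of_pos h0, one_div, inv_pow, ← one_div]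
  gcongr
  rw [abs_le]
  constructor <;> linarith

variable {x : (ι → ℝ) → ℝ} {v : (ι → ℝ) → ℝ} {N : ℕ} {B c : ℝ}

/-- The increments of `x` between neighbouring grid points of mesh `2⁻ⁿ` in the box of size `N`
are at most `B cⁿ`. -/
def GridIncrementsLE (x : (ι → ℝ) → ℝ) (N : ℕ) (B c : ℝ) : Prop :=
  ∀ (n : ℕ) (z e : ι → ℤ), (∀ i, |z i| ≤ N * 2 ^ n) → (∀ i, |e i| ≤ 1) →
    |x (gridPoint n z) - x (gridPoint n (z + e))| ≤ B * c ^ n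

theorem GridIncrementsLE.floor_succ (h : GridIncrementsLE x N B c) {p : ι → ℝ}
    (hp : ∀ i, |p i| ≤ N) (n : ℕ) :
    dist (x (gridPoint n (gridFloor n p))) (x (gridPoint (n + 1) (gridFloor (n + 1) p)))
      ≤ B * c * c ^ n := by
  have := h (n + 1) (fun i => 2 * gridFloor n p i)
    (fun i => gridFloor (n + 1) p i - 2 * gridFloor n p i) (fun i => ?_)
    (abs_gridFloor_succ_sub_le n p)
  · rw [gridPoint_succ_two_mul] at this
    have e : (fun i => 2 * gridFloor n p i)
        + (fun i => gridFloor (n + 1) p i - 2 * gridFloor n p i) = gridFloor (n + 1) p := by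
      ext i; simp
    rw [e] at this
    rw [Real.dist_eq, mul_assoc, ← pow_succ']
    exact this
  · have := abs_gridFloor_le hp n i
    rw [abs_mul, pow_succ]
    norm_num
    linarith

theorem GridIncrementsLE.floor_sub (h : GridIncrementsLE x N B c) {p q : ι → ℝ}
    (hp : ∀ i, |p i| ≤ N) {n : ℕ} (hpq : ∀ i, |q i - p i| ≤ (1 / 2) ^ n) :
    dist (x (gridPoint n (gridFloor n p))) (x (gridPoint n (gridFloor n q))) ≤ B * c ^ n := by
  have := h n (gridFloor n p) (gridFloor n q - gridFloor n p) (abs_gridFloor_le hp n)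
    (fun i => abs_gridFloor_sub_le (hpq i))
  rwa [add_sub_cancel] at this

theorem GridIncrementsLE.dist_limit_le (h : GridIncrementsLE x N B c) (hB : 0 ≤ B) (hc0 : 0 < c)
    (hc1 : c < 1)
    (hv : ∀ p, v p = limUnder atTop fun n => x (gridPoint n (gridFloor n p))) {p : ι → ℝ}
    (hp : ∀ i, |p i| ≤ N) (n : ℕ) :
    dist (x (gridPoint n (gridFloor n p))) (v p) ≤ B / (1 - c) * c ^ n := by
  have ht : Tendsto (fun n => x (gridPoint n (gridFloor n p))) atTop (𝓝 (v p)) := by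
    rw [hv]
    exact (cauchySeq_of_le_geometric c (B * c) hc1 (h.floor_succ hp)).tendsto_limUnder
  refine (dist_le_of_le_geometric_of_tendsto c (B * c) hc1 (h.floor_succ hp) ht n).trans ?_
  rw [div_mul_eq_mul_div]
  have : 0 < 1 - c := sub_pos.2 hc1
  gcongr
  nlinarith

/-- Hölder continuity on a box of the limit along dyadic approximations. -/
theorem GridIncrementsLE.exists_holder [Fintype ι] {α : ℝ} (hα : 0 < α) (hB : 0 ≤ B)
    (h : GridIncrementsLE x N B ((1 / 2) ^ α))
    (hv : ∀ p, v p = limUnder atTop fun n => x (gridPoint n (gridFloor n p))) :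
    ∃ K, 0 ≤ K ∧ ∀ p q : ι → ℝ, (∀ i, |p i| ≤ N) → (∀ i, |q i| ≤ N) →
      |v p - v q| ≤ K * ‖p - q‖ ^ α := by
  classical
  set c : ℝ := (1 / 2) ^ α with hc
  have hc0 : 0 < c := by positivity
  have hc1 : c < 1 := Real.rpow_lt_one (by norm_num) (by norm_num) hα
  have hc1' : 0 < 1 - c := sub_pos.2 hc1
  set D := B / (1 - c) with hD
  have hD0 : 0 ≤ D := by positivity
  -- Bounds x on the finitely many level-0 grid points of the box, hence v on the whole box; this
  -- settles pairs at distance more than 1.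
  set M := ∑ z ∈ Fintype.piFinset fun _ : ι => Finset.Icc (-(N : ℤ)) N, |x (gridPoint 0 z)|
    with hM
  have hM0 : 0 ≤ M := Finset.sum_nonneg fun _ _ => abs_nonneg _
  have hlim := fun p hp n => h.dist_limit_le hB hc0 hc1 hv (p := p) hp n
  have hbd : ∀ p : ι → ℝ, (∀ i, |p i| ≤ N) → |v p| ≤ M + D := by
    intro p hp
    have h1 := hlim p hp 0
    rw [pow_zero, mul_one, Real.dist_eq, abs_sub_comm] at h1
    have h2 : |x (gridPoint 0 (gridFloor 0 p))| ≤ M := by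
      refine Finset.single_le_sum (f := fun z => |x (gridPoint 0 z)|)
        (fun _ _ => abs_nonneg _) ?_
      rw [Fintype.mem_piFinset]
      intro i
      have := abs_gridFloor_le hp 0 i
      rw [pow_zero, mul_one, abs_le] at this
      exact Finset.mem_Icc.2 this
    have h3 := abs_sub_abs_le_abs_sub (v p) (x (gridPoint 0 (gridFloor 0 p)))
    linarith
  have hloc : ∀ p q : ι → ℝ, (∀ i, |p i| ≤ N) → (∀ i, |q i| ≤ N) → ∀ n : ℕ,
      ‖p - q‖ ≤ (1 / 2) ^ n → |v p - v q| ≤ (B + 2 * D) * c ^ n := by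
    intro p q hp hq n hn
    have h1 := hlim p hp n
    have h2 := hlim q hq n
    have h3 := h.floor_sub hp (q := q) (n := n) fun i => by
      rw [abs_sub_comm]
      exact (norm_le_pi_norm (p - q) i).trans hn
    have h4 := dist_triangle4 (v p) (x (gridPoint n (gridFloor n p)))
      (x (gridPoint n (gridFloor n q))) (v q)
    rw [dist_comm (v p) (x _)] at h4
    rw [← Real.dist_eq]
    linarith
  -- The first summand handles ‖p - q‖ > 1. For closer points take n with 2^(-n-1) < ‖p - q‖ ≤
  -- 2^(-n); replacing cⁿ by ‖p - q‖^α costs the factor 1/c.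
  refine ⟨2 * (M + D) + (B + 2 * D) / c, by positivity, fun p q hp hq => ?_⟩
  rcases lt_or_ge 1 ‖p - q‖ with h1 | h1
  · have h2 : 1 ≤ ‖p - q‖ ^ α := Real.one_le_rpow h1.le hα.le
    have h3 : |v p - v q| ≤ 2 * (M + D) := by
      refine (abs_sub _ _).trans ?_
      linarith [hbd p hp, hbd q hq]
    have h4 : 0 ≤ (B + 2 * D) / c := by positivity
    nlinarith
  rcases (norm_nonneg (p - q)).eq_or_lt with h0 | h0
  · have : p = q := sub_eq_zero.1 (norm_eq_zero.1 h0.symm)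
    subst this
    simp only [sub_self, abs_zero]
    positivity
  obtain ⟨n, hn1, hn2⟩ := exists_nat_pow_near_of_lt_one h0 h1 (by norm_num : (0 : ℝ) < 1 / 2)
    (by norm_num)
  have hcn : c ^ n ≤ ‖p - q‖ ^ α / c := by
    rw [le_div_iff₀ hc0, ← pow_succ, hc, ← Real.rpow_natCast, ← Real.rpow_mul (by norm_num),
      mul_comm, Real.rpow_mul (by norm_num), Real.rpow_natCast]
    exact Real.rpow_le_rpow (by positivity) hn1.le hα.le
  refine (hloc p q hp hq n hn2).trans ?_
  calc (B + 2 * D) * c ^ n ≤ (B + 2 * D) * (‖p - q‖ ^ α / c) := by gcongr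
    _ = (B + 2 * D) / c * ‖p - q‖ ^ α := by ring
    _ ≤ _ := by
      gcongr
      have : 0 ≤ 2 * (M + D) := by positivity
      linarith

end Dyadic

/-! ### From moment bounds to a Hölder modification -/

section Modification

variable {Ω : Type*} [MeasurableSpace Ω] {P : Measure Ω}

theorem ae_tsum_lt_top {f : ℕ → Ω → ℝ≥0∞} (hf : ∀ n, AEMeasurable (f n) P)
    (h : ∑' n, ∫⁻ ω, f n ω ∂P ≠ ∞) : ∀ᵐ ω ∂P, ∑' n, f n ω < ∞ := by
  rw [← lintegral_tsum hf] at h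
  exact ae_lt_top' (AEMeasurable.tsum hf) h

theorem tsum_ofReal_geometric_ne_top {a r : ℝ} (hr0 : 0 ≤ r) (hr1 : r < 1) :
    ∑' n : ℕ, ENNReal.ofReal (a * r ^ n) ≠ ∞ :=
  ((summable_geometric_of_lt_one hr0 hr1).mul_left a).tsum_ofReal_ne_top

variable {ι : Type*} [Fintype ι] {X : (ι → ℝ) → Ω → ℝ} {κ : ℝ}

theorem rpow_le_pow_half {ρ : ℝ} (hκ : 0 ≤ κ) (hρ : 0 ≤ ρ) {n : ℕ} (h : ρ ≤ (1 / 2) ^ n) :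
    ρ ^ κ ≤ ((1 / 2) ^ κ) ^ n := by
  rw [← Real.rpow_natCast, ← Real.rpow_mul (by norm_num), mul_comm κ,
    Real.rpow_mul (by norm_num), Real.rpow_natCast]
  exact Real.rpow_le_rpow hρ h hκ

/-- All absolute moments of the increments of `X` are bounded by powers of the distance, as for a
Gaussian process with standard deviation of order `‖p - q‖ ^ κ`. -/
def HasMomentBounds (X : (ι → ℝ) → Ω → ℝ) (κ : ℝ) (P : Measure Ω) : Prop :=
  ∀ m : ℕ, ∃ C : ℝ, 0 ≤ C ∧ ∀ p q : ι → ℝ,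
    ∫⁻ ω, ENNReal.ofReal (|X p ω - X q ω| ^ m) ∂P ≤ ENNReal.ofReal (C * (‖p - q‖ ^ κ) ^ m)

/-- First moments of the errors are geometrically summable, so the errors tend to 0 almost surely.
This identifies the dyadic limit with X p. -/
theorem HasMomentBounds.ae_tendsto (hX : HasMomentBounds X κ P) (hκ : 0 < κ)
    (hm : ∀ p, AEMeasurable (X p) P) (p : ι → ℝ) :
    ∀ᵐ ω ∂P, Tendsto (fun n => X (gridPoint n (gridFloor n p)) ω) atTop (𝓝 (X p ω)) := by
  obtain ⟨C, hC, h⟩ := hX 1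
  have hfin := ae_tsum_lt_top (P := P)
    (f := fun n ω => ENNReal.ofReal (|X (gridPoint n (gridFloor n p)) ω - X p ω| ^ 1))
    (fun n => (((hm _).sub (hm _)).norm.pow_const 1).ennreal_ofReal) <| by
      refine ne_top_of_le_ne_top (tsum_ofReal_geometric_ne_top (a := C) (r := (1 / 2) ^ κ)
        (by positivity) (Real.rpow_lt_one (by norm_num) (by norm_num) hκ))
        (ENNReal.tsum_le_tsum fun n => (h _ _).trans (ENNReal.ofReal_le_ofReal ?_))
      rw [pow_one]
      gcongr
      exact rpow_le_pow_half hκ.le (norm_nonneg _)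
        ((pi_norm_le_iff_of_nonneg (by positivity)).2 (abs_gridPoint_floor_sub_le n p))
  filter_upwards [hfin] with ω hω
  have h1 := ENNReal.tendsto_atTop_zero_of_tsum_ne_top hω.ne
  have h2 := (ENNReal.tendsto_toReal ENNReal.zero_ne_top).comp h1
  rw [tendsto_iff_dist_tendsto_zero]
  refine h2.congr fun n => ?_
  simp only [Function.comp_apply, pow_one]
  rw [ENNReal.toReal_ofReal (abs_nonneg _), Real.dist_eq]

theorem HasMomentBounds.ae_gridIncrementsLE [IsProbabilityMeasure P]
    (hX : HasMomentBounds X κ P) (hκ : 0 < κ) (hm : ∀ p, AEMeasurable (X p) P) {α : ℝ}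
    (hακ : α < κ) (N : ℕ) :
    ∀ᵐ ω ∂P, ∃ B, 0 ≤ B ∧ GridIncrementsLE (fun p => X p ω) N B ((1 / 2) ^ α) := by
  classical
  set d := Fintype.card ι
  set b : ℝ := 2 ^ α with hb
  set a : ℝ := (1 / 2) ^ κ with ha
  have hb0 : 0 < b := by positivity
  have ha0 : 0 < a := by positivity
  have hab : b * a < 1 := by
    rw [hb, ha, one_div, Real.inv_rpow (by norm_num), ← Real.rpow_neg (by norm_num),
      ← Real.rpow_add (by norm_num)]
    exact Real.rpow_lt_one_of_one_lt_of_neg (by norm_num) (by linarith)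
  -- Level n has of order 2^(dn) neighbouring pairs, and the m-th moment of 2^(αn) times an
  -- increment is of order 2^((α-κ)mn). As α < κ, a large m makes the total summable.
  obtain ⟨m, hm1⟩ := exists_pow_lt_of_lt_one (by positivity : (0 : ℝ) < (1 / 2) ^ d) hab
  have hmz : m ≠ 0 := by
    rintro rfl
    rw [pow_zero] at hm1
    exact absurd hm1 (not_lt.2 (pow_le_one₀ (by norm_num) (by norm_num)))
  set r : ℝ := 2 ^ d * (b * a) ^ m with hr
  have hr0 : 0 ≤ r := by positivity
  have hr1 : r < 1 := by
    calc r < 2 ^ d * (1 / 2) ^ d := by rw [hr]; gcongr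
      _ = 1 := by rw [← mul_pow]; norm_num
  obtain ⟨C, hC, h⟩ := hX m
  let box : ℕ → Finset (ι → ℤ) := fun n =>
    Fintype.piFinset fun _ => Finset.Icc (-(N * 2 ^ n : ℤ)) (N * 2 ^ n)
  let nbr : Finset (ι → ℤ) := Fintype.piFinset fun _ => Finset.Icc (-1) 1
  let D : ℕ → (ι → ℤ) → (ι → ℤ) → Ω → ℝ := fun n z e ω =>
    X (gridPoint n z) ω - X (gridPoint n (z + e)) ω
  have hDm : ∀ n z e, AEMeasurable (fun ω => ENNReal.ofReal ((b ^ n) ^ m * |D n z e ω| ^ m)) P :=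
    fun n z e => ((((hm _).sub (hm _)).norm.pow_const m).const_mul _).ennreal_ofReal
  have hcard : ∀ n, ((box n).card * nbr.card : ℝ) ≤ (3 * (2 * N + 1)) ^ d * (2 ^ d) ^ n := by
    intro n
    have h1 : ((box n).card : ℝ) = (2 * (N * 2 ^ n) + 1) ^ d := by
      have : (Finset.Icc (-(N * 2 ^ n : ℤ)) (N * 2 ^ n)).card = 2 * (N * 2 ^ n) + 1 := by
        rw [Int.card_Icc]
        zify
        have h0 : (0 : ℤ) ≤ N * 2 ^ n := by positivity
        rw [Int.toNat_of_nonneg (by linarith)]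
        ring
      simp only [box, Fintype.card_piFinset, Finset.prod_const, this]
      push_cast
      rfl
    have h2 : (nbr.card : ℝ) = 3 ^ d := by
      simp [nbr, Fintype.card_piFinset, d]
    have h3 : (1 : ℝ) ≤ 2 ^ n := one_le_pow₀ (by norm_num)
    rw [h1, h2, ← pow_mul, mul_comm d n, pow_mul, ← mul_pow, ← mul_pow]
    refine pow_le_pow_left₀ (by positivity) ?_ d
    linarith
  have hterm : ∀ n z, ∀ e ∈ nbr,
      ∫⁻ ω, ENNReal.ofReal ((b ^ n) ^ m * |D n z e ω| ^ m) ∂P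
        ≤ ENNReal.ofReal (C * ((b * a) ^ m) ^ n) := by
    intro n z e he
    simp_rw [ENNReal.ofReal_mul (by positivity : 0 ≤ (b ^ n) ^ m)]
    rw [lintegral_const_mul' _ _ ENNReal.ofReal_ne_top]
    refine (mul_le_mul_right (h _ _) _).trans ?_
    rw [← ENNReal.ofReal_mul (by positivity)]
    refine ENNReal.ofReal_le_ofReal ?_
    have h1 : ‖gridPoint n z - gridPoint n (z + e)‖ ≤ (1 / 2) ^ n := by
      refine (pi_norm_le_iff_of_nonneg (by positivity)).2 fun i => ?_
      have h2 := Finset.mem_Icc.1 (Fintype.mem_piFinset.1 he i)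
      have h3 : |(e i : ℝ)| ≤ 1 := by exact_mod_cast abs_le.2 h2
      have e1 : (gridPoint n z - gridPoint n (z + e)) i = -(e i : ℝ) * (1 / 2) ^ n := by
        simp only [gridPoint, Pi.sub_apply, Pi.add_apply, one_div, inv_pow]
        push_cast
        ring
      rw [e1, norm_mul, norm_neg, Real.norm_eq_abs, Real.norm_of_nonneg (by positivity)]
      exact mul_le_of_le_one_left (by positivity) h3
    have h2 : ‖gridPoint n z - gridPoint n (z + e)‖ ^ κ ≤ a ^ n := by
      exact rpow_le_pow_half hκ.le (norm_nonneg _) h1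
    calc (b ^ n) ^ m * (C * (‖gridPoint n z - gridPoint n (z + e)‖ ^ κ) ^ m)
        ≤ (b ^ n) ^ m * (C * (a ^ n) ^ m) := by gcongr
      _ = _ := by rw [mul_pow, mul_pow, ← pow_mul, ← pow_mul, ← pow_mul, ← pow_mul,
                    mul_comm n m]; ring
  have hfin := ae_tsum_lt_top (P := P)
    (f := fun n ω => ∑ z ∈ box n, ∑ e ∈ nbr, ENNReal.ofReal ((b ^ n) ^ m * |D n z e ω| ^ m))
    (fun n => Finset.aemeasurable_fun_sum _ fun z _ =>
      Finset.aemeasurable_fun_sum _ fun e _ => hDm n z e) <| by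
      refine ne_top_of_le_ne_top (tsum_ofReal_geometric_ne_top
        (a := (3 * (2 * N + 1)) ^ d * C) hr0 hr1) (ENNReal.tsum_le_tsum fun n => ?_)
      rw [lintegral_finsetSum' _ fun z _ =>
        Finset.aemeasurable_fun_sum _ fun e _ => hDm n z e]
      calc ∑ z ∈ box n, ∫⁻ ω, ∑ e ∈ nbr, ENNReal.ofReal ((b ^ n) ^ m * |D n z e ω| ^ m) ∂P
          ≤ ∑ z ∈ box n, ∑ e ∈ nbr, ENNReal.ofReal (C * ((b * a) ^ m) ^ n) := by
            refine Finset.sum_le_sum fun z _ => ?_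
            rw [lintegral_finsetSum' _ fun e _ => hDm n z e]
            exact Finset.sum_le_sum fun e he => hterm n z e he
        _ = ENNReal.ofReal (((box n).card * nbr.card) * (C * ((b * a) ^ m) ^ n)) := by
            rw [ENNReal.ofReal_mul (p := ((box n).card * nbr.card : ℝ)) (by positivity),
              ENNReal.ofReal_mul (p := ((box n).card : ℝ)) (by positivity)]
            simp only [Finset.sum_const, nsmul_eq_mul, ENNReal.ofReal_natCast, mul_assoc]
        _ ≤ _ := by
            refine ENNReal.ofReal_le_ofReal ?_
            calc _ ≤ ((3 * (2 * N + 1)) ^ d * (2 ^ d) ^ n) * (C * ((b * a) ^ m) ^ n) := by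
                  exact mul_le_mul_of_nonneg_right (hcard n) (by positivity)
              _ = _ := by rw [hr, mul_pow (2 ^ d)]; ring
  filter_upwards [hfin] with ω hω
  set S := ∑' n, ∑ z ∈ box n, ∑ e ∈ nbr, ENNReal.ofReal ((b ^ n) ^ m * |D n z e ω| ^ m) with hS
  -- The added 1 avoids taking an m-th root: a number y > S + 1 exceeds 1, so y ≤ y^m ≤ S, a
  -- contradiction.
  refine ⟨S.toReal + 1, by positivity, fun n z e hz he => ?_⟩
  have hz' : z ∈ box n := Fintype.mem_piFinset.2 fun i => Finset.mem_Icc.2 (abs_le.1 (hz i))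
  have he' : e ∈ nbr := Fintype.mem_piFinset.2 fun i => Finset.mem_Icc.2 (abs_le.1 (he i))
  have h1 : ENNReal.ofReal ((b ^ n) ^ m * |D n z e ω| ^ m) ≤ S :=
    (Finset.single_le_sum (f := fun e => ENNReal.ofReal ((b ^ n) ^ m * |D n z e ω| ^ m))
      (fun _ _ => zero_le) he').trans <|
    (Finset.single_le_sum
      (f := fun z => ∑ e ∈ nbr, ENNReal.ofReal ((b ^ n) ^ m * |D n z e ω| ^ m))
      (fun _ _ => zero_le) hz').trans (ENNReal.le_tsum n)
  rw [ENNReal.ofReal_le_iff_le_toReal hω.ne, ← mul_pow] at h1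
  have h2 : b ^ n * |D n z e ω| ≤ S.toReal + 1 := by
    by_contra! hlt
    have h3 : 1 ≤ b ^ n * |D n z e ω| :=
      (le_add_of_nonneg_left ENNReal.toReal_nonneg).trans hlt.le
    have h4 := le_self_pow₀ h3 hmz
    linarith
  have h5 : ((1 / 2 : ℝ) ^ α) ^ n = (b ^ n)⁻¹ := by
    rw [hb, one_div, Real.inv_rpow (by norm_num), inv_pow]
  rw [h5, ← div_eq_mul_inv, le_div_iff₀ (by positivity), mul_comm]
  exact h2

/-- Kolmogorov-Chentsov: a process with moment bounds of order `κ` has a modification which is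
locally Hölder continuous of every order `α < κ`. -/
theorem HasMomentBounds.exists_modification [IsProbabilityMeasure P]
    (hX : HasMomentBounds X κ P) (hκ : 0 < κ) (hm : ∀ p, AEMeasurable (X p) P) :
    ∃ v : (ι → ℝ) → Ω → ℝ, (∀ p, v p =ᵐ[P] X p) ∧
      ∀ α ∈ Ioo 0 κ, ∀ N : ℕ, ∀ᵐ ω ∂P, ∃ K, 0 ≤ K ∧ ∀ p q : ι → ℝ,
        (∀ i, |p i| ≤ N) → (∀ i, |q i| ≤ N) → |v p ω - v q ω| ≤ K * ‖p - q‖ ^ α := by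
  refine ⟨fun p ω => limUnder atTop fun n => X (gridPoint n (gridFloor n p)) ω, fun p => ?_,
    fun α hα N => ?_⟩
  · filter_upwards [hX.ae_tendsto hκ hm p] with ω hω using hω.limUnder_eq
  · filter_upwards [hX.ae_gridIncrementsLE hκ hm hα.2 N] with ω ⟨B, hB, hω⟩
    exact hω.exists_holder hα.1 hB fun p => rfl

end Modification

end StochWave

/-! ### Gaussian estimates and second moments of the solution -/

namespace StochWave

open scoped RealInnerProductSpace

section Gaussian

variable {Ω : Type*} [MeasurableSpace Ω] {P : Measure Ω} {Y : Ω → ℝ} {v : ℝ}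

theorem lintegral_abs_pow_of_gaussian (hY : AEMeasurable Y P) (hv : 0 ≤ v)
    (h : P.map Y = gaussianReal 0 v.toNNReal) (m : ℕ) :
    ∫⁻ ω, ENNReal.ofReal (|Y ω| ^ m) ∂P
      = ENNReal.ofReal ((∫ y, |y| ^ m ∂(gaussianReal 0 1)) * √v ^ m) := by
  have hf : Measurable fun y : ℝ => ENNReal.ofReal (|y| ^ m) := by fun_prop
  have e1 : gaussianReal 0 v.toNNReal = (gaussianReal 0 1).map (√v * ·) := by
    rw [gaussianReal_map_const_mul, mul_zero, mul_one]
    congr 1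
    ext
    rw [Real.coe_toNNReal _ hv]
    exact (Real.sq_sqrt hv).symm
  have hint : Integrable (fun y : ℝ => |y| ^ m) (gaussianReal 0 1) := by
    have := (memLp_id_gaussianReal (μ := 0) (v := 1) m).integrable_norm_pow'
    simpa using this
  rw [← lintegral_map' (f := fun y : ℝ => ENNReal.ofReal (|y| ^ m)) hf.aemeasurable hY, h, e1,
    lintegral_map hf (by fun_prop)]
  simp_rw [abs_mul, mul_pow, abs_of_nonneg (Real.sqrt_nonneg v)]
  rw [← ofReal_integral_eq_lintegral_ofReal (hint.const_mul _)
    (Eventually.of_forall fun y => by positivity), integral_const_mul, mul_comm]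

/-- The density is at most (2πv)^(-1/2) on an interval of length 2ε, and 2 ≤ √(2π). -/
theorem measure_abs_le_of_gaussian (hY : AEMeasurable Y P) (hv : 0 < v)
    (h : P.map Y = gaussianReal 0 v.toNNReal) (ε : ℝ) :
    P {ω | |Y ω| ≤ ε} ≤ ENNReal.ofReal (ε / √v) := by
  have hs : {ω | |Y ω| ≤ ε} = Y ⁻¹' Icc (-ε) ε := by ext ω; simp [abs_le]
  have hv' : v.toNNReal ≠ 0 := by simpa using hv
  rw [hs, ← Measure.map_apply_of_aemeasurable hY measurableSet_Icc, h,
    gaussianReal_apply _ hv']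
  rcases lt_or_ge ε 0 with hε | hε
  · rw [Icc_eq_empty (by linarith)]; simp
  calc ∫⁻ x in Icc (-ε) ε, gaussianPDF 0 v.toNNReal x
      ≤ ∫⁻ _ in Icc (-ε) ε, ENNReal.ofReal (√(2 * Real.pi * v))⁻¹ := by
        refine lintegral_mono fun x => ENNReal.ofReal_le_ofReal ?_
        rw [gaussianPDFReal, Real.coe_toNNReal _ hv.le]
        refine mul_le_of_le_one_right (by positivity) (Real.exp_le_one_iff.2 ?_)
        exact div_nonpos_of_nonpos_of_nonneg (by nlinarith [sq_nonneg (x - 0)]) (by positivity)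
    _ = ENNReal.ofReal ((√(2 * Real.pi * v))⁻¹ * (2 * ε)) := by
        rw [lintegral_const, Measure.restrict_apply_univ, Real.volume_Icc,
          ← ENNReal.ofReal_mul (by positivity)]
        congr 2; ring
    _ ≤ _ := by
        refine ENNReal.ofReal_le_ofReal ?_
        have h2 : 2 ≤ √(2 * Real.pi) :=
          Real.le_sqrt_of_sq_le (by nlinarith [Real.pi_gt_three])
        have hsv : 0 < √v := Real.sqrt_pos.2 hv
        rw [Real.sqrt_mul (by positivity), ← div_eq_inv_mul,
          div_le_div_iff₀ (by positivity) hsv]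
        nlinarith [mul_nonneg hε hsv.le]

end Gaussian

section Solution

variable {Ω : Type*} [MeasurableSpace Ω] {P : Measure Ω}
  {H : Fin 3 → ℝ} {κ T : ℝ} {W : SpaceTimeTest → Ω → ℝ} {u : ℝ → Space → Ω → ℝ}

theorem IsMildSolution.sub [IsProbabilityMeasure P]
    (hu : IsMildSolution (fractionalKernel H) T W P u)
    (hH : ∀ i, 1 / 2 < H i ∧ H i < 1) (hκ : κ = H 0 + H 1 + H 2 - 2) (hκ0 : 0 < κ) (hT : 0 < T)
    (hW : IsNoise (fractionalKernel H) T W P) {s t : ℝ} (hs : s ∈ Icc 0 T) (ht : t ∈ Icc 0 T)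
    (x y : Space) :
    ∫ ω, |u s x ω - u t y ω| ^ 2 ∂P
        = ∫ p, ‖(waveFourier s x - waveFourier t y) p‖ ^ 2 ∂(spaceTimeMeasure H T) ∧
      P.map (u s x - u t y)
        = gaussianReal 0 (∫ ω, |u s x ω - u t y ω| ^ 2 ∂P).toNNReal :=
  IsStochIntegral.sub hH hT hW (isPathFourier_wave hκ hH hκ0 s x)
    (isPathFourier_wave hκ hH hκ0 t y) (hu s hs x) (hu t ht y)

theorem IsMildSolution.memLp {f : Space → ℝ} (hu : IsMildSolution f T W P u) {t : ℝ}
    (ht : t ∈ Icc 0 T) (x : Space) : MemLp (u t x) 2 P := (hu t ht x).1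

theorem IsMildSolution.aemeasurable_sub {f : Space → ℝ} (hu : IsMildSolution f T W P u) {s t : ℝ}
    (hs : s ∈ Icc 0 T) (ht : t ∈ Icc 0 T) (x y : Space) : AEMeasurable (u s x - u t y) P :=
  ((hu.memLp hs x).sub (hu.memLp ht y)).1.aemeasurable

variable [IsProbabilityMeasure P]
    (hu : IsMildSolution (fractionalKernel H) T W P u)
    (hH : ∀ i, 1 / 2 < H i ∧ H i < 1) (hκ : κ = H 0 + H 1 + H 2 - 2) (hκ0 : 0 < κ) (hT : 0 < T)
    (hW : IsNoise (fractionalKernel H) T W P)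
include hu hH hκ hκ0 hT hW

theorem IsMildSolution.space_increment_le :
    ∃ c : ℝ, 0 < c ∧ ∀ t ∈ Icc 0 T, ∀ x y : Space,
      ∫ ω, |u t x ω - u t y ω| ^ 2 ∂P ≤ c * ‖x - y‖ ^ (2 * κ) := by
  have hJ : 0 ≤ ∫ ξ, cutoff 1 ξ ∂(specMeasure H) := integral_nonneg fun _ => cutoff_nonneg _ _
  refine ⟨T * (∫ ξ, cutoff 1 ξ ∂(specMeasure H)) + 1, by positivity, fun t ht x y => ?_⟩
  rcases eq_or_ne x y with rfl | hxy
  · simp only [sub_self, abs_zero, ne_eq, OfNat.ofNat_ne_zero, not_false_eq_true, zero_pow,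
      integral_zero]
    positivity
  · rw [(hu.sub hH hκ hκ0 hT hW ht ht x y).1]
    refine (integral_wave_space_le hκ hH hκ0 hT t hxy).trans ?_
    gcongr
    linarith

theorem IsMildSolution.space_increment_ge {t₀ L : ℝ} (ht₀ : 0 < t₀) :
    ∃ c : ℝ, 0 < c ∧ ∀ t ∈ Icc t₀ T, ∀ x y : Space, ‖x - y‖ ≤ L →
      c * ‖x - y‖ ^ (2 * κ) ≤ ∫ ω, |u t x ω - u t y ω| ^ 2 ∂P := by
  obtain ⟨c, hc, h⟩ := exists_lowerIntegral_inner_ge hκ hH hκ0 (le_max_left 2 (4 * L / t₀))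
  refine ⟨t₀ / 4 * c, by positivity, fun t ht x y hL => ?_⟩
  rcases eq_or_ne x y with rfl | hxy
  · simp [Real.zero_rpow (mul_pos two_pos hκ0).ne']
  · have ht' : t ∈ Icc 0 T := ⟨ht₀.le.trans ht.1, ht.2⟩
    rw [(hu.sub hH hκ hκ0 hT hW ht' ht' x y).1]
    refine le_trans ?_ (integral_wave_space_ge hκ hH hκ0 ht₀ ht.1 ht.2 hxy hL)
    gcongr
    refine h _ ?_
    rw [norm_smul, norm_inv, norm_norm, inv_mul_cancel₀ (norm_ne_zero_iff.2 (sub_ne_zero.2 hxy))]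

theorem IsMildSolution.time_increment_le :
    ∃ c : ℝ, 0 < c ∧ ∀ t ∈ Icc 0 T, ∀ t' ∈ Icc 0 T, ∀ x : Space,
      ∫ ω, |u t x ω - u t' x ω| ^ 2 ∂P ≤ c * |t' - t| ^ (2 * κ) := by
  have hJ : 0 ≤ ∫ ξ, cutoff 1 ξ ∂(specMeasure H) := integral_nonneg fun _ => cutoff_nonneg _ _
  refine ⟨T * (∫ ξ, cutoff 1 ξ ∂(specMeasure H)) + 1, by positivity, fun t ht t' ht' x => ?_⟩
  rcases eq_or_ne t' t with rfl | htt
  · simp only [sub_self, abs_zero, ne_eq, OfNat.ofNat_ne_zero, not_false_eq_true, zero_pow,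
      integral_zero]
    positivity
  · rw [(hu.sub hH hκ hκ0 hT hW ht ht' x x).1]
    refine (integral_wave_time_le hκ hH hκ0 hT htt x).trans ?_
    gcongr
    linarith

theorem IsMildSolution.time_increment_ge {t₀ : ℝ} (ht₀ : 0 < t₀) :
    ∃ c : ℝ, 0 < c ∧ ∀ t ∈ Icc t₀ T, ∀ t' ∈ Icc t₀ T, ∀ x : Space,
      c * |t' - t| ^ (2 * κ) ≤ ∫ ω, |u t x ω - u t' x ω| ^ 2 ∂P := by
  have hc := lowerIntegral_norm_pos hκ hH hκ0 (le_max_left 2 (4 * T / t₀))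
  have key : ∀ t ∈ Icc t₀ T, ∀ t' ∈ Icc t₀ T, ∀ x : Space, t < t' →
      t₀ / 4 * lowerIntegral H (max 2 (4 * T / t₀)) (fun ξ => ‖ξ‖) * |t' - t| ^ (2 * κ)
        ≤ ∫ ω, |u t x ω - u t' x ω| ^ 2 ∂P := by
    intro t ht t' ht' x htt
    rw [(hu.sub hH hκ hκ0 hT hW ⟨ht₀.le.trans ht.1, ht.2⟩ ⟨ht₀.le.trans ht'.1, ht'.2⟩ x x).1]
    exact integral_wave_time_ge hκ hH hκ0 ht₀ ht.1 htt ht'.2 x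
  refine ⟨_, mul_pos (by positivity : 0 < t₀ / 4) hc, fun t ht t' ht' x => ?_⟩
  rcases lt_trichotomy t t' with h | rfl | h
  · exact key t ht t' ht' x h
  · simp [Real.zero_rpow (mul_pos two_pos hκ0).ne']
  · have := key t' ht' t ht x h
    rw [abs_sub_comm] at this
    simpa only [abs_sub_comm (u t' x _)] using this

/-- Pass through the intermediate point (s, y) and use (a+b)² ≤ 2a² + 2b². The single scale δ for
time and space fits a sup norm on space-time. -/
theorem IsMildSolution.increment_le :
    ∃ c : ℝ, 0 ≤ c ∧ ∀ s ∈ Icc 0 T, ∀ t ∈ Icc 0 T, ∀ (x y : Space) (δ : ℝ), |s - t| ≤ δ →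
      ‖x - y‖ ≤ δ → ∫ ω, |u s x ω - u t y ω| ^ 2 ∂P ≤ c * (δ ^ κ) ^ 2 := by
  obtain ⟨c₁, hc₁, h₁⟩ := hu.space_increment_le hH hκ hκ0 hT hW
  obtain ⟨c₂, hc₂, h₂⟩ := hu.time_increment_le hH hκ hκ0 hT hW
  refine ⟨2 * (c₁ + c₂), by positivity, fun s hs t ht x y δ hst hxy => ?_⟩
  have hδ : 0 ≤ δ := (abs_nonneg _).trans hst
  have i1 : Integrable (fun ω => |u s x ω - u s y ω| ^ 2) P :=
    ((hu.memLp hs x).sub (hu.memLp hs y)).integrable_norm_pow two_ne_zero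
  have i2 : Integrable (fun ω => |u s y ω - u t y ω| ^ 2) P :=
    ((hu.memLp hs y).sub (hu.memLp ht y)).integrable_norm_pow two_ne_zero
  have e : (δ ^ κ) ^ 2 = δ ^ (2 * κ) := by
    rw [← Real.rpow_natCast, ← Real.rpow_mul hδ, mul_comm]; norm_num
  calc ∫ ω, |u s x ω - u t y ω| ^ 2 ∂P
      ≤ ∫ ω, (2 * |u s x ω - u s y ω| ^ 2 + 2 * |u s y ω - u t y ω| ^ 2) ∂P := by
        refine integral_mono_of_nonneg (Eventually.of_forall fun _ => by positivity)
          ((i1.const_mul 2).add (i2.const_mul 2)) (Eventually.of_forall fun ω => ?_)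
        simp only [sq_abs]
        nlinarith [sq_nonneg ((u s x ω - u s y ω) - (u s y ω - u t y ω))]
    _ = 2 * ∫ ω, |u s x ω - u s y ω| ^ 2 ∂P + 2 * ∫ ω, |u s y ω - u t y ω| ^ 2 ∂P := by
        rw [integral_add (i1.const_mul 2) (i2.const_mul 2), integral_const_mul,
          integral_const_mul]
    _ ≤ 2 * (c₁ * δ ^ (2 * κ)) + 2 * (c₂ * δ ^ (2 * κ)) := by
        have a1 := h₁ s hs x y
        have a2 := h₂ s hs t ht y
        rw [abs_sub_comm] at a2
        have b1 : ‖x - y‖ ^ (2 * κ) ≤ δ ^ (2 * κ) :=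
          Real.rpow_le_rpow (norm_nonneg _) hxy (by positivity)
        have b2 : |s - t| ^ (2 * κ) ≤ δ ^ (2 * κ) :=
          Real.rpow_le_rpow (abs_nonneg _) hst (by positivity)
        have := mul_le_mul_of_nonneg_left b1 hc₁.le
        have := mul_le_mul_of_nonneg_left b2 hc₂.le
        linarith
    _ = _ := by rw [e]; ring

end Solution

end StochWave

/-! ### Optimality of the exponent and the Hölder modification -/

namespace StochWave

section LowerRegularity

variable {Ω : Type*} [MeasurableSpace Ω] {P : Measure Ω}

/-- Gaussian variables whose standard deviations are at least of order `δₙ ^ κ`, with `δₙ`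
geometric, are almost surely not of order `δₙ ^ α` for `α > κ`. -/
theorem ae_not_eventually_abs_le {Y : ℕ → Ω → ℝ} {v : ℕ → ℝ} {c ρ κ α : ℝ}
    (hY : ∀ n, AEMeasurable (Y n) P) (h : ∀ n, P.map (Y n) = gaussianReal 0 (v n).toNNReal)
    (hc : 0 < c) (hρ : 0 < ρ) (hv : ∀ n, c * (ρ * (1 / 2) ^ n) ^ (2 * κ) ≤ v n) (hα : κ < α) :
    ∀ᵐ ω ∂P, ¬ ∃ K : ℝ, ∀ᶠ n in atTop, |Y n ω| ≤ K * (ρ * (1 / 2) ^ n) ^ α := by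
  have hr : (1 / 2 : ℝ) ^ (α - κ) < 1 :=
    Real.rpow_lt_one (by norm_num) (by norm_num) (sub_pos.2 hα)
  -- Borel-Cantelli for each natural K, so that only countably many null sets arise; every real
  -- constant is below a natural one.
  have hK : ∀ K : ℕ, ∀ᵐ ω ∂P, ∀ᶠ n in atTop,
      ω ∉ {ω | |Y n ω| ≤ K * (ρ * (1 / 2) ^ n) ^ α} := by
    intro K
    refine ae_eventually_notMem (ne_top_of_le_ne_top (tsum_ofReal_geometric_ne_top
      (a := K / √c * ρ ^ (α - κ)) (by positivity) hr) (ENNReal.tsum_le_tsum fun n => ?_))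
    set δ : ℝ := ρ * (1 / 2) ^ n with hδ
    have hδ0 : 0 < δ := by positivity
    have hvn : 0 < v n := lt_of_lt_of_le (by positivity) (hv n)
    refine (measure_abs_le_of_gaussian (hY n) hvn (h n) _).trans (ENNReal.ofReal_le_ofReal ?_)
    have h1 : √c * δ ^ κ ≤ √(v n) := by
      refine Real.le_sqrt_of_sq_le ?_
      rw [mul_pow, Real.sq_sqrt hc.le, ← Real.rpow_natCast, ← Real.rpow_mul hδ0.le,
        mul_comm κ]
      exact_mod_cast hv n
    calc K * δ ^ α / √(v n) ≤ K * δ ^ α / (√c * δ ^ κ) := by gcongr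
      _ = K / √c * δ ^ (α - κ) := by rw [Real.rpow_sub hδ0]; field_simp
      _ = _ := by
        rw [hδ, Real.mul_rpow hρ.le (by positivity), ← Real.rpow_natCast,
          ← Real.rpow_natCast, ← Real.rpow_mul (by norm_num), ← Real.rpow_mul (by norm_num),
          mul_comm (α - κ) n, mul_assoc]
  filter_upwards [ae_all_iff.2 hK] with ω hω
  rintro ⟨K, hKω⟩
  obtain ⟨K', hK'⟩ := exists_nat_ge K
  obtain ⟨n, h1, h2⟩ := ((hω K').and hKω).exists
  refine h1 (h2.trans ?_)
  gcongr

theorem eventually_geometric_le {ρ r : ℝ} (hr : 0 < r) :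
    ∀ᶠ n : ℕ in atTop, ρ * (1 / 2) ^ n ≤ r := by
  have := (tendsto_pow_atTop_nhds_zero_of_lt_one (by norm_num : (0 : ℝ) ≤ 1 / 2)
    (by norm_num)).const_mul ρ
  rw [mul_zero] at this
  exact (this.eventually_lt_const hr).mono fun _ h => h.le

end LowerRegularity

theorem norm_space_le {x : Space} {δ : ℝ} (hδ : 0 ≤ δ) (h : ∀ i, |x i| ≤ δ) :
    ‖x‖ ≤ 2 * δ := by
  rw [EuclideanSpace.norm_eq]
  refine Real.sqrt_le_iff.2 ⟨by positivity, ?_⟩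
  have h1 : ∀ i, ‖x i‖ ^ 2 ≤ δ ^ 2 := fun i =>
    pow_le_pow_left₀ (norm_nonneg _) (h i) 2
  calc ∑ i, ‖x i‖ ^ 2 ≤ ∑ _i : Fin 3, δ ^ 2 := Finset.sum_le_sum fun i _ => h1 i
    _ ≤ _ := by simp; nlinarith [sq_nonneg δ]

section Solution

variable {Ω : Type*} [MeasurableSpace Ω] {P : Measure Ω} [IsProbabilityMeasure P]
  {H : Fin 3 → ℝ} {κ T : ℝ} {W : SpaceTimeTest → Ω → ℝ} {u : ℝ → Space → Ω → ℝ}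
  (hu : IsMildSolution (fractionalKernel H) T W P u)
  (hH : ∀ i, 1 / 2 < H i ∧ H i < 1) (hκ : κ = H 0 + H 1 + H 2 - 2) (hκ0 : 0 < κ) (hT : 0 < T)
  (hW : IsNoise (fractionalKernel H) T W P)
include hu hH hκ hκ0 hT hW

theorem IsMildSolution.not_holder_space {α t : ℝ} (hα : κ < α) (ht : t ∈ Ioc 0 T) (x : Space) :
    ∀ᵐ ω ∂P, ¬ ∃ K r : ℝ, 0 < r ∧ ∀ y : Space, ‖y - x‖ ≤ r →
      |u t x ω - u t y ω| ≤ K * ‖x - y‖ ^ α := by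
  obtain ⟨c, hc, h⟩ := hu.space_increment_ge hH hκ hκ0 hT hW (L := 1) ht.1
  have ht' : t ∈ Icc 0 T := ⟨ht.1.le, ht.2⟩
  let y : ℕ → Space := fun n => x + (1 / 2 : ℝ) ^ n • EuclideanSpace.single 0 1
  have hy : ∀ n, ‖y n - x‖ = 1 * (1 / 2) ^ n := by
    intro n
    simp [y, norm_smul]
  have hy' : ∀ n, ‖x - y n‖ = 1 * (1 / 2) ^ n := fun n => by rw [norm_sub_rev, hy]
  have key := ae_not_eventually_abs_le (fun n => hu.aemeasurable_sub ht' ht' x (y n))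
    (fun n => (hu.sub hH hκ hκ0 hT hW ht' ht' x (y n)).2) hc one_pos (fun n => ?_) hα
  · filter_upwards [key] with ω hω
    rintro ⟨K, r, hr, hK⟩
    refine hω ⟨K, (eventually_geometric_le (ρ := 1) hr).mono fun n hn => ?_⟩
    rw [← hy' n]
    exact hK (y n) (by rwa [hy])
  · rw [← hy' n]
    refine h t ⟨le_rfl, ht.2⟩ x (y n) ?_
    rw [hy', one_mul]
    exact pow_le_one₀ (by norm_num) (by norm_num)

theorem IsMildSolution.not_holder_time {α t : ℝ} (hα : κ < α) (ht : t ∈ Ioc 0 T) (x : Space) :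
    ∀ᵐ ω ∂P, ¬ ∃ K r : ℝ, 0 < r ∧ ∀ s ∈ Icc 0 T, |s - t| ≤ r →
      |u t x ω - u s x ω| ≤ K * |t - s| ^ α := by
  have ht2 : 0 < t / 2 := half_pos ht.1
  obtain ⟨c, hc, h⟩ := hu.time_increment_ge hH hκ hκ0 hT hW ht2
  have ht' : t ∈ Icc 0 T := ⟨ht.1.le, ht.2⟩
  -- Approaching t from the left keeps s n in [0, T] even when t = T, and s n ≥ t/2 keeps one
  -- lower-bound constant valid.
  let s : ℕ → ℝ := fun n => t - t / 2 * (1 / 2) ^ n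
  have hs : ∀ n, |s n - t| = t / 2 * (1 / 2) ^ n := by
    intro n
    rw [abs_sub_comm, abs_of_nonneg] <;> simp only [s, sub_sub_cancel]
    positivity
  have hst : ∀ n, s n ∈ Icc (t / 2) T := by
    intro n
    have h1 : (1 / 2 : ℝ) ^ n ≤ 1 := pow_le_one₀ (by norm_num) (by norm_num)
    have h2 : (0 : ℝ) ≤ t / 2 * (1 / 2) ^ n := by positivity
    constructor <;> simp only [s]
    · nlinarith
    · linarith [ht.2]
  have hs' : ∀ n, s n ∈ Icc 0 T := fun n => ⟨ht2.le.trans (hst n).1, (hst n).2⟩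
  have key := ae_not_eventually_abs_le (fun n => hu.aemeasurable_sub ht' (hs' n) x x)
    (fun n => (hu.sub hH hκ hκ0 hT hW ht' (hs' n) x x).2) hc ht2 (fun n => ?_) hα
  · filter_upwards [key] with ω hω
    rintro ⟨K, r, hr, hK⟩
    refine hω ⟨K, (eventually_geometric_le (ρ := t / 2) hr).mono fun n hn => ?_⟩
    have := hK (s n) (hs' n) (by rwa [hs])
    rwa [abs_sub_comm t, hs] at this
  · rw [← hs n]
    exact h t ⟨by linarith [ht.1], ht.2⟩ (s n) (hst n) x

/-- Clamping time to [0, T] is 1-Lipschitz and gives a process on all of ℝ⁴, as the chaining theorem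
requires. For Gaussian increments each moment is a constant times a power of the standard deviation.
-/
theorem IsMildSolution.hasMomentBounds :
    HasMomentBounds (fun (p : Fin 4 → ℝ) =>
      u (projIcc 0 T hT.le (p 0)) (WithLp.toLp 2 fun i => p i.succ)) κ P := by
  obtain ⟨c, hc, h⟩ := hu.increment_le hH hκ hκ0 hT hW
  intro m
  have hm0 : 0 ≤ ∫ y, |y| ^ m ∂(gaussianReal 0 1) := integral_nonneg fun y => by positivity
  refine ⟨(∫ y, |y| ^ m ∂(gaussianReal 0 1)) * (√c * 2 ^ κ) ^ m, by positivity,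
    fun p q => ?_⟩
  have hp := (projIcc 0 T hT.le (p 0)).2
  have hq := (projIcc 0 T hT.le (q 0)).2
  have hcoord : ∀ i, |p i - q i| ≤ ‖p - q‖ := fun i => norm_le_pi_norm (p - q) i
  have hn := norm_nonneg (p - q)
  -- The scale 2‖p - q‖ covers the Euclidean norm of the spatial part, which is at most √3 times the
  -- sup norm.
  have hvar := h _ hp _ hq (WithLp.toLp 2 fun i => p i.succ) (WithLp.toLp 2 fun i => q i.succ)
    (2 * ‖p - q‖)
    (((abs_projIcc_sub_projIcc hT.le).trans (hcoord 0)).trans (by linarith))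
    (norm_space_le hn fun i => hcoord i.succ)
  refine (lintegral_abs_pow_of_gaussian (hu.aemeasurable_sub hp hq _ _)
    (integral_nonneg fun ω => by positivity)
    (hu.sub hH hκ hκ0 hT hW hp hq _ _).2 m).le.trans (ENNReal.ofReal_le_ofReal ?_)
  rw [mul_assoc, ← mul_pow]
  gcongr
  refine (Real.sqrt_le_sqrt hvar).trans (le_of_eq ?_)
  rw [Real.sqrt_mul hc, Real.sqrt_sq (by positivity), Real.mul_rpow (by norm_num) hn, mul_assoc]

theorem IsMildSolution.exists_holder_modification :
    ∃ v : ℝ → Space → Ω → ℝ,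
      (∀ t ∈ Icc 0 T, ∀ x : Space, v t x =ᵐ[P] u t x) ∧
      ∀ α ∈ Ioo 0 κ, ∀ R : ℝ, ∀ᵐ ω ∂P, ∃ K : ℝ,
        ∀ s ∈ Icc 0 T, ∀ t ∈ Icc 0 T, ∀ x y : Space, ‖x‖ ≤ R → ‖y‖ ≤ R →
          |v s x ω - v t y ω| ≤ K * (|s - t| ^ α + ‖x - y‖ ^ α) := by
  obtain ⟨v, hv, hhold⟩ := (hu.hasMomentBounds hH hκ hκ0 hT hW).exists_modification hκ0
    fun p => (hu.memLp (projIcc 0 T hT.le (p 0)).2 _).1.aemeasurable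
  let pt : ℝ → Space → Fin 4 → ℝ := fun t x => Fin.cons t fun i => x i
  refine ⟨fun t x => v (pt t x), fun t ht x => ?_, fun α hα R => ?_⟩
  · have := hv (pt t x)
    simp only [pt, Fin.cons_zero, Fin.cons_succ, projIcc_of_mem hT.le ht] at this
    exact this
  -- One box in ℝ⁴ containing both the time interval and the ball of radius R.
  · obtain ⟨N, hN⟩ := exists_nat_ge (max T R)
    filter_upwards [hhold α hα N] with ω ⟨K, hK0, hK⟩
    refine ⟨K, fun s hs t ht x y hx hy => ?_⟩
    have hbox : ∀ t ∈ Icc 0 T, ∀ x : Space, ‖x‖ ≤ R → ∀ i, |pt t x i| ≤ N := by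
      intro t ht x hx i
      refine Fin.cases ?_ (fun j => ?_) i
      · simp only [pt, Fin.cons_zero]
        rw [abs_of_nonneg ht.1]
        exact ht.2.trans ((le_max_left _ _).trans hN)
      · simp only [pt, Fin.cons_succ]
        exact (PiLp.norm_apply_le x j).trans (hx.trans ((le_max_right _ _).trans hN))
    refine (hK _ _ (hbox s hs x hx) (hbox t ht y hy)).trans ?_
    refine mul_le_mul_of_nonneg_left ?_ hK0
    have hle : ‖pt s x - pt t y‖ ≤ max |s - t| ‖x - y‖ := by
      refine (pi_norm_le_iff_of_nonneg (le_max_of_le_left (abs_nonneg _))).2 fun i => ?_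
      refine Fin.cases ?_ (fun j => ?_) i
      · simp [pt]
      · simp only [pt, Pi.sub_apply, Fin.cons_succ]
        exact (PiLp.norm_apply_le (x - y) j).trans (le_max_right _ _)
    refine (Real.rpow_le_rpow (norm_nonneg _) hle hα.1.le).trans ?_
    have h1 : 0 ≤ |s - t| ^ α := by positivity
    have h2 : 0 ≤ ‖x - y‖ ^ α := by positivity
    rcases max_cases |s - t| ‖x - y‖ with ⟨e, _⟩ | ⟨e, _⟩ <;> rw [e] <;> linarith

end Solution

end StochWave

theorem theorem6p2 {Ω : Type*} [MeasurableSpace Ω] (P : Measure Ω) [IsProbabilityMeasure P]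
    (H : Fin 3 → ℝ) (hH : ∀ i, 1 / 2 < H i ∧ H i < 1)
    (κ : ℝ) (hκ : κ = H 0 + H 1 + H 2 - 2) (hκ_pos : 0 < κ)
    (T : ℝ) (hT : 0 < T)
    (W : StochWave.SpaceTimeTest → Ω → ℝ)
    (hW : StochWave.IsNoise (StochWave.fractionalKernel H) T W P)
    (u : ℝ → StochWave.Space → Ω → ℝ)
    (hu : StochWave.IsMildSolution (StochWave.fractionalKernel H) T W P u) :
    -- space increments: upper bound, then lower bound
    (∃ c₂ : ℝ, 0 < c₂ ∧ ∀ t ∈ Icc 0 T, ∀ x y : StochWave.Space,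
      ∫ ω, |u t x ω - u t y ω| ^ 2 ∂P ≤ c₂ * ‖x - y‖ ^ (2 * κ)) ∧
    (∀ t₀ ∈ Ioc 0 T, ∀ L : ℝ, 0 < L → ∃ c₁ : ℝ, 0 < c₁ ∧
      ∀ t ∈ Icc t₀ T, ∀ x y : StochWave.Space, ‖x - y‖ ≤ L →
        c₁ * ‖x - y‖ ^ (2 * κ) ≤ ∫ ω, |u t x ω - u t y ω| ^ 2 ∂P) ∧
    -- time increments: upper bound, then lower bound
    (∃ c₂ : ℝ, 0 < c₂ ∧ ∀ t ∈ Icc 0 T, ∀ t' ∈ Icc 0 T, ∀ x : StochWave.Space,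
      ∫ ω, |u t x ω - u t' x ω| ^ 2 ∂P ≤ c₂ * |t' - t| ^ (2 * κ)) ∧
    (∀ t₀ ∈ Ioc 0 T, ∃ c₁ : ℝ, 0 < c₁ ∧
      ∀ t ∈ Icc t₀ T, ∀ t' ∈ Icc t₀ T, ∀ x : StochWave.Space,
        c₁ * |t' - t| ^ (2 * κ) ≤ ∫ ω, |u t x ω - u t' x ω| ^ 2 ∂P) ∧
    -- a version of `u` is locally Hölder continuous of every order `α < κ`
    (∃ v : ℝ → StochWave.Space → Ω → ℝ,
      (∀ t ∈ Icc 0 T, ∀ x : StochWave.Space, v t x =ᵐ[P] u t x) ∧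
      ∀ α ∈ Ioo 0 κ, ∀ R : ℝ, 0 < R → ∀ᵐ ω ∂P, ∃ K : ℝ,
        ∀ s ∈ Icc 0 T, ∀ t ∈ Icc 0 T, ∀ x y : StochWave.Space, ‖x‖ ≤ R → ‖y‖ ≤ R →
          |v s x ω - v t y ω| ≤ K * (|s - t| ^ α + ‖x - y‖ ^ α)) ∧
    -- no order `α > κ` is possible, neither in space nor in time
    (∀ α : ℝ, κ < α → ∀ t ∈ Ioc 0 T, ∀ x : StochWave.Space,
      (∀ᵐ ω ∂P, ¬ ∃ K r : ℝ, 0 < r ∧ ∀ y : StochWave.Space, ‖y - x‖ ≤ r →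
        |u t x ω - u t y ω| ≤ K * ‖x - y‖ ^ α) ∧
      (∀ᵐ ω ∂P, ¬ ∃ K r : ℝ, 0 < r ∧ ∀ s ∈ Icc 0 T, |s - t| ≤ r →
        |u t x ω - u s x ω| ≤ K * |t - s| ^ α)) :=
  ⟨hu.space_increment_le hH hκ hκ_pos hT hW,
    fun _ ht₀ _ _ => hu.space_increment_ge hH hκ hκ_pos hT hW ht₀.1,
    hu.time_increment_le hH hκ hκ_pos hT hW,
    fun _ ht₀ => hu.time_increment_ge hH hκ hκ_pos hT hW ht₀.1,
    (hu.exists_holder_modification hH hκ hκ_pos hT hW).imp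
      fun _ h => ⟨h.1, fun α hα R _ => h.2 α hα R⟩,
    fun _ hα _ ht x => ⟨hu.not_holder_space hH hκ hκ_pos hT hW hα ht x,
      hu.not_holder_time hH hκ hκ_pos hT hW hα ht x⟩⟩
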